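/- Let $\rho\in(0,1)$. For $n\ge 2$ let $\Lambda_n=\{1,\dots,n-1\}$ and $\Omega_n=\{0,1\}^{\Lambda_n}$. For $\eta\in\Omega_n$ let $\eta^{x,y}$ be obtained from $\eta$ by exchanging the values at $x$ and $y$, and $\eta^x$ by replacing $\eta(x)$ with $1-\eta(x)$. The symmetric simple exclusion process (SSEP) with reservoirs of density $\rho$, in diffusive time scale, is the continuous-time Markov chain $(\eta_t)_{t\ge0}$ on $\Omega_n$ with generator \[ L_nf(\eta)=n^2\sum_{x=1}^{n-2}\big(f(\eta^{x,x+1})-f(\eta)\big)+n^2\sum_{x\in\{1,n-1\}}\big(\rho(1-\eta(x))+(1-\rho)\eta(x)\big)\big(f(\eta^x)-f(\eta)\big), \] where $\{1,n-1\}$ is read as a set (a single site if $n=2$). For $u:\Lambda_n\to[0,1]$ let $\nu^n_{u}$ be the Bernoulli product measure on $\Omega_n$ with $\nu^n_u(\eta(x)=1)=u(x)$, and let $\bar\nu^n_\rho$ be the one with $u\equiv\rho$. Let $u_0:[0,1]\to(0,1)$ be differentiable with bounded derivative, and assume $u_0(0)=u_0(1)=\rho$. For $\ell\in\mathbb N=\{1,2,\dots\}$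 put \[ c_\ell(u_0)=\sqrt2\int_0^1(u_0(x)-\rho)\sin(\pi\ell x)\,dx . \] Assume that $u_0\not\equiv\rho$, and let $\ell_0\ge1$ be the smallest integer such that $c_{\ell_0}(u_0)\ne0$. Let $\mu^n_t$ be the law of $\eta_t$ when $\eta_0$ has law $\nu^n_{u_0^n}$, $u_0^n(x)=u_0(x/n)$, and let \[ D_n(t)=\|\mu^n_t-\bar\nu^n_\rho\|_{TV},\qquad \|\mu-\nu\|_{TV}=\sup_A|\mu(A)-\nu(A)| . \] Let $\mathcal G(m)=\|\mathcal N(m,1)-\mathcal N(0,1)\|_{TV}$ for $m\in\mathbb R$. Then for every $b\in\mathbb R$, \[ \lim_{n\to\infty}D_n\big(t^n(b)\big)=\mathcal G(\gamma e^{-b}), \] where \[ t^n(b)=\frac{\log n}{2\pi^2\ell_0^2}+\frac{b}{\pi^2\ell_0^2}\quad\text{(which is nonnegative for all large }n\text{)},\qquad \gamma=\frac{|c_{\ell_0}(u_0)|}{\sqrt{\rho(1-\rho)}} . \] -/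

import Mathlib

open Set Filter Topology MeasureTheory ProbabilityTheory

noncomputable section

namespace SSEP

/-- The bulk `Λ_n = {1, …, n-1}`. -/
abbrev Site (n : ℕ) : Type := ↥(Finset.Ico 1 n)

/-- Configurations of particles `Ω_n = {0,1}^{Λ_n}`; `true` means occupied. -/
abbrev Config (n : ℕ) : Type := Site n → Bool

/-- The occupation number `η(x) ∈ {0,1}` as a real number. -/
def occ {n : ℕ} (η : Config n) (x : Site n) : ℝ := if η x then 1 else 0

/-- `η^{x,y}`: the contents of `x` and `y` are exchanged. -/
def exchange {n : ℕ} (x y : Site n) (η : Config n) : Config n :=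
  fun z => η (Equiv.swap x y z)

/-- `η^x`: the content of `x` is flipped. -/
def flip {n : ℕ} (x : Site n) (η : Config n) : Config n :=
  Function.update η x (!(η x))

/-- The (diffusively accelerated) generator of SSEP on `{1, …, n-1}` with reservoirs of density
`ρ`: exchanges across the edges `{x, x+1}` and flips at the boundary sites `{1, n-1}` with rate
`ρ` (creation) and `1 - ρ` (annihilation), everything multiplied by `n²`. -/
def generator (n : ℕ) (ρ : ℝ) (f : Config n → ℝ) (η : Config n) : ℝ :=
  (n : ℝ) ^ 2 * (∑ x : Site n, ∑ y : Site n,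
    if (y : ℕ) = (x : ℕ) + 1 then f (exchange x y η) - f η else 0)
  + (n : ℝ) ^ 2 * (∑ x : Site n,
    if (x : ℕ) = 1 ∨ (x : ℕ) = n - 1 then
      (ρ * (1 - occ η x) + (1 - ρ) * occ η x) * (f (flip x η) - f η) else 0)

/-- The matrix of jump rates: the entry `(η, ζ)` is the generator applied to the indicator of
`ζ`, evaluated at `η`. -/
def rateMatrix (n : ℕ) (ρ : ℝ) : Matrix (Config n) (Config n) ℝ :=
  Matrix.of fun η ζ => generator n ρ (Pi.single ζ 1) η

/-- The transition probabilities `P_t(η, ζ) = P(η_t = ζ | η_0 = η)` of the continuous-time Markov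
chain on the finite space `Ω_n` with the above generator: `P_t = e^{t L}`. -/
def transition (n : ℕ) (ρ t : ℝ) : Matrix (Config n) (Config n) ℝ :=
  NormedSpace.exp (t • rateMatrix n ρ)

/-- The Bernoulli product weights with density `u : Λ_n → [0,1]`. -/
def bernoulliWeight {n : ℕ} (u : Site n → ℝ) (η : Config n) : ℝ :=
  ∏ x : Site n, (occ η x * u x + (1 - occ η x) * (1 - u x))

/-- The weights of the law of `η_t` when `η_0` has the Bernoulli product law with density `u`. -/
def lawWeight (n : ℕ) (ρ : ℝ) (u : Site n → ℝ) (t : ℝ) (ζ : Config n) : ℝ :=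
  ∑ η : Config n, bernoulliWeight u η * transition n ρ t η ζ

/-- The measure on a finite set with given (nonnegative) point masses. -/
def ofWeight {α : Type*} [Fintype α] [MeasurableSpace α] (w : α → ℝ) : Measure α :=
  ∑ a : α, ENNReal.ofReal (w a) • Measure.dirac a

/-- The total variation distance of two probability measures,
`sup_A |μ(A) - ν(A)|` over measurable `A`. -/
def tvDist {α : Type*} [MeasurableSpace α] (μ ν : Measure α) : ℝ :=
  ⨆ A : {A : Set α // MeasurableSet A}, |μ.real A - ν.real A|

/-- The discretization `u^n(x) = u(x/n)` of a profile `u` on `[0,1]`. -/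
def discretize (n : ℕ) (u : ℝ → ℝ) (x : Site n) : ℝ := u ((x : ℕ) / (n : ℝ))

/-- The distance to equilibrium at time `t ≥ 0` of SSEP started from the profile measure
of `u₀`. -/
def distEq (n : ℕ) (ρ : ℝ) (u₀ : ℝ → ℝ) (t : ℝ) : ℝ :=
  tvDist (ofWeight (lawWeight n ρ (discretize n u₀) t))
    (ofWeight (bernoulliWeight fun _ : Site n => ρ))

/-- The sine-Fourier coefficient `c_ℓ(u₀)` of `u₀ - ρ`. -/
def fourierCoeff (ρ : ℝ) (u₀ : ℝ → ℝ) (ℓ : ℕ) : ℝ :=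
  √2 * ∫ x in (0 : ℝ)..1, (u₀ x - ρ) * Real.sin (Real.pi * ℓ * x)

/-- The Gaussian profile `G(m)`: total variation distance between `N(m,1)` and `N(0,1)`. -/
def gaussianProfile (m : ℝ) : ℝ := tvDist (gaussianReal m 1) (gaussianReal 0 1)

/-- The time `t^n(b) = log n / (2π²ℓ²) + b / (π²ℓ²)`. -/
def cutoffTime (ℓ n : ℕ) (b : ℝ) : ℝ :=
  1 / (2 * Real.pi ^ 2 * (ℓ : ℝ) ^ 2) * Real.log n + b / (Real.pi ^ 2 * (ℓ : ℝ) ^ 2)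

end SSEP

end

/-!
Let `κ_t(S)` be the expectation under the law of `η_t` of `∏_{x ∈ S} (η(x) - u_t(x))`, where `u_t`
solves the discrete heat equation with boundary value `ρ` started from `u₀`. By duality `κ_t` solves
a closed hierarchy: exclusion particles on `{1, …, n-1}` which are killed at the boundary, with
sources at pairs of neighbouring sites, driven by the gradient of `u_t` and its square. Since `κ_0`
vanishes off `∅` and the gradient of `u_t` decays exponentially, the energy `∑_S a_t^{|S|} κ_t(S)²`
stays bounded for a weight `a_t` growing exponentially in `t`; hence, for a fixed weight `A`, the
sum of `A^{|S|} κ_t(S)²` over `S ≠ ∅` tends to zero. By Parseval's identity for the orthogonal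
monomials of a Bernoulli product measure, this sum bounds the squared distance in total variation
between the law of `η_t` and the product measure with density `u_t`.

It remains to compare two product measures. At the cutoff time `u_t - ρ` is uniformly small and
`∑_x (u_t(x) - ρ)²` tends to `(c_{ℓ₀} e^{-b})²`, because only the mode `ℓ₀` survives. By a central
limit theorem, the log-likelihood ratio of the two product measures is then asymptotically that of
two unit Gaussians at distance `γ e^{-b}`.
-/

open scoped Finset NNReal

namespace SSEP

/-! ### Total variation distance -/

section TotalVariation

variable {α : Type*} [MeasurableSpace α]

theorem tvDist_le {μ ν : Measure α} {c : ℝ}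
    (h : ∀ A, MeasurableSet A → |μ.real A - ν.real A| ≤ c) : tvDist μ ν ≤ c :=
  have : Nonempty {A : Set α // MeasurableSet A} := ⟨⟨∅, MeasurableSet.empty⟩⟩
  ciSup_le fun A => h A.1 A.2

theorem tvDist_comm (μ ν : Measure α) : tvDist μ ν = tvDist ν μ := by
  simp only [tvDist, abs_sub_comm]

section FiniteMeasure

variable (μ ν π : Measure α) [IsFiniteMeasure μ] [IsFiniteMeasure ν]

theorem abs_measureReal_sub_le_tvDist {A : Set α} (hA : MeasurableSet A) :
    |μ.real A - ν.real A| ≤ tvDist μ ν := by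
  refine le_ciSup (f := fun A : {A : Set α // MeasurableSet A} => |μ.real A - ν.real A|)
    ⟨μ.real univ + ν.real univ, ?_⟩ ⟨A, hA⟩
  rintro _ ⟨A, rfl⟩
  refine (abs_sub _ _).trans (add_le_add ?_ ?_) <;> rw [abs_of_nonneg measureReal_nonneg] <;>
    exact measureReal_mono (subset_univ _)

variable [IsFiniteMeasure π]

theorem tvDist_triangle : tvDist μ π ≤ tvDist μ ν + tvDist ν π :=
  tvDist_le fun _ hA => (abs_sub_le _ _ _).trans
    (add_le_add (abs_measureReal_sub_le_tvDist μ ν hA) (abs_measureReal_sub_le_tvDist ν π hA))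

theorem abs_tvDist_sub_tvDist_le : |tvDist μ π - tvDist ν π| ≤ tvDist μ ν := by
  have hνμ := tvDist_triangle ν μ π
  rw [tvDist_comm ν μ] at hνμ
  rw [abs_le]
  constructor <;> linarith [tvDist_triangle μ ν π]

end FiniteMeasure

section Density

variable {μ ν : Measure α} [IsProbabilityMeasure ν] {f : α → ℝ}

theorem measureReal_sub_withDensity (hf₀ : ∀ a, 0 ≤ f a) (hf : Integrable f ν) {A : Set α}
    (hA : MeasurableSet A) :
    ν.real A - (ν.withDensity fun a => ENNReal.ofReal (f a)).real A = ∫ a in A, (1 - f a) ∂ν := by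
  have hdensity : (ν.withDensity fun a => ENNReal.ofReal (f a)).real A = ∫ a in A, f a ∂ν := by
    rw [measureReal_def, withDensity_apply _ hA, integral_eq_lintegral_of_nonneg_ae
      (Eventually.of_forall hf₀) hf.aestronglyMeasurable.restrict]
  rw [hdensity, integral_sub (integrable_const _).integrableOn hf.integrableOn]
  simp

theorem setIntegral_le_integral_posPart {g : α → ℝ} (hg : Integrable g μ) (A : Set α) :
    ∫ a in A, g a ∂μ ≤ ∫ a, max (g a) 0 ∂μ :=
  (setIntegral_mono hg.integrableOn hg.pos_part.integrableOn fun _ => le_max_left _ _).trans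
    (setIntegral_le_integral hg.pos_part (Eventually.of_forall fun _ => le_max_right _ _))

/-- The supremum is attained at the event `{f ≤ 1}`. -/
theorem tvDist_withDensity (hf : Measurable f) (hf₀ : ∀ a, 0 ≤ f a)
    [IsProbabilityMeasure (ν.withDensity fun a => ENNReal.ofReal (f a))] :
    tvDist (ν.withDensity fun a => ENNReal.ofReal (f a)) ν = ∫ a, max (1 - f a) 0 ∂ν := by
  set μ := ν.withDensity fun a => ENNReal.ofReal (f a)
  have hint : Integrable f ν := by
    refine ⟨hf.aestronglyMeasurable, ?_⟩
    rw [hasFiniteIntegral_iff_ofReal (Eventually.of_forall hf₀), ← setLIntegral_univ,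
      ← withDensity_apply _ MeasurableSet.univ]
    exact measure_lt_top μ univ
  have hle {A : Set α} (hA : MeasurableSet A) : ν.real A - μ.real A ≤ ∫ a, max (1 - f a) 0 ∂ν :=
    (measureReal_sub_withDensity hf₀ hint hA).trans_le
      (setIntegral_le_integral_posPart ((integrable_const 1).sub hint) A)
  apply le_antisymm
  · refine tvDist_le fun A hA => ?_
    have hcompl := hle hA.compl
    rw [probReal_compl_eq_one_sub hA, probReal_compl_eq_one_sub hA] at hcompl
    rw [abs_le]
    constructor <;> linarith [hle hA]
  · have hA : MeasurableSet {a | f a ≤ 1} := measurableSet_le hf measurable_const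
    have hpos : ∫ a, max (1 - f a) 0 ∂ν = ν.real {a | f a ≤ 1} - μ.real {a | f a ≤ 1} := by
      rw [measureReal_sub_withDensity hf₀ hint hA, ← integral_indicator hA]
      refine integral_congr_ae (Eventually.of_forall fun a => ?_)
      by_cases ha : f a ≤ 1
      · simp [Set.indicator, ha]
      · simp [Set.indicator, ha, (not_le.1 ha).le]
    rw [hpos, tvDist_comm]
    exact (le_abs_self _).trans (abs_measureReal_sub_le_tvDist ν μ hA)

end Density

section Weights

variable [Fintype α]

instance isFiniteMeasure_ofWeight (w : α → ℝ) : IsFiniteMeasure (ofWeight w) := by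
  constructor
  simp [ofWeight]

theorem isProbabilityMeasure_ofWeight {w : α → ℝ} (hw : ∀ a, 0 ≤ w a) (hsum : ∑ a, w a = 1) :
    IsProbabilityMeasure (ofWeight w) := by
  constructor
  simp [ofWeight, ← ENNReal.ofReal_sum_of_nonneg fun a _ => hw a, hsum]

theorem ofWeight_real_apply (w : α → ℝ) {A : Set α} (hA : MeasurableSet A) :
    (ofWeight w).real A = ∑ a, A.indicator (fun a => max (w a) 0) a := by
  have hne (a : α) : ENNReal.ofReal (w a) * A.indicator 1 a ≠ ⊤ := by
    by_cases ha : a ∈ A <;> simp [ha]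
  simp only [ofWeight, measureReal_def, Measure.finsetSum_apply, Measure.smul_apply, smul_eq_mul,
    Measure.dirac_apply' _ hA, ENNReal.toReal_sum fun a _ => hne a]
  refine Finset.sum_congr rfl fun a _ => ?_
  by_cases ha : a ∈ A <;> simp [ha, ENNReal.toReal_ofReal']

theorem tvDist_ofWeight_le (w w' : α → ℝ) :
    tvDist (ofWeight w) (ofWeight w') ≤ ∑ a, |w a - w' a| := by
  refine tvDist_le fun A hA => ?_
  rw [ofWeight_real_apply w hA, ofWeight_real_apply w' hA, ← Finset.sum_sub_distrib]
  refine (Finset.abs_sum_le_sum_abs _ _).trans (Finset.sum_le_sum fun a _ => ?_)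
  by_cases ha : a ∈ A
  · simpa only [Set.indicator_of_mem ha] using abs_max_sub_max_le_abs _ _ _
  · simp [ha]

theorem integral_ofWeight {E : Type*} [MeasurableSingletonClass α] [NormedAddCommGroup E]
    [NormedSpace ℝ E] [CompleteSpace E] {w : α → ℝ} (hw : ∀ a, 0 ≤ w a) (f : α → E) :
    ∫ a, f a ∂(ofWeight w) = ∑ a, w a • f a := by
  rw [ofWeight, integral_finsetSum_measure fun a _ =>
    (integrable_dirac (by simp [enorm_lt_top])).smul_measure ENNReal.ofReal_ne_top]
  simp [integral_smul_measure, integral_dirac, ENNReal.toReal_ofReal, hw]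

theorem ofWeight_mul_eq_withDensity [DiscreteMeasurableSpace α] {w : α → ℝ} (hw : ∀ a, 0 ≤ w a)
    (f : α → ℝ) :
    ofWeight (fun a => w a * f a) = (ofWeight w).withDensity fun a => ENNReal.ofReal (f a) := by
  ext A hA
  rw [withDensity_apply _ hA, ← lintegral_indicator hA]
  simp only [ofWeight, Measure.finsetSum_apply, Measure.smul_apply, smul_eq_mul,
    lintegral_finsetSum_measure, lintegral_smul_measure, lintegral_dirac]
  refine Finset.sum_congr rfl fun a _ => ?_
  rw [Measure.dirac_apply' _ hA, ENNReal.ofReal_mul (hw a)]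
  by_cases ha : a ∈ A <;> simp [ha]

end Weights

end TotalVariation

/-! ### Bernoulli product measures -/

section ProductMeasures

variable {n : ℕ}

theorem sum_config_prod {R : Type*} [CommSemiring R] (f : Site n → Bool → R) :
    ∑ η : Config n, ∏ x, f x (η x) = ∏ x, (f x true + f x false) := by
  simp only [← Fintype.prod_sum, Fintype.sum_bool]

theorem bernoulliWeight_eq_prod_ite (u : Site n → ℝ) (η : Config n) :
    bernoulliWeight u η = ∏ x, if η x then u x else 1 - u x := by
  refine Finset.prod_congr rfl fun x _ => ?_
  cases hx : η x <;> simp [occ, hx]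

/-- The product over `S` of the occupation numbers centred at `u`; these monomials are an
orthogonal basis of `L²` of the Bernoulli product measure with density `u`. -/
noncomputable def monomial (u : Site n → ℝ) (S : Finset (Site n)) (η : Config n) : ℝ :=
  ∏ x ∈ S, (occ η x - u x)

theorem monomial_eq_prod_univ (u : Site n → ℝ) (S : Finset (Site n)) (η : Config n) :
    monomial u S η = ∏ x, if x ∈ S then occ η x - u x else 1 := by
  rw [monomial, Finset.prod_ite_mem, Finset.univ_inter]

theorem sum_bernoulliWeight_mul_monomial (u : Site n → ℝ) (S : Finset (Site n)) :
    ∑ η, bernoulliWeight u η * monomial u S η = if S = ∅ then 1 else 0 := by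
  have hfactor : ∑ η, bernoulliWeight u η * monomial u S η = ∏ x,
      (u x * (if x ∈ S then 1 - u x else 1) + (1 - u x) * (if x ∈ S then 0 - u x else 1)) := by
    have hprod := sum_config_prod (n := n) fun x b =>
      (if b then u x else 1 - u x) * (if x ∈ S then (if b then 1 else 0) - u x else 1)
    simpa only [bernoulliWeight_eq_prod_ite, monomial_eq_prod_univ, occ, ← Finset.prod_mul_distrib,
      if_true, Bool.false_eq_true, if_false] using hprod
  rw [hfactor]
  split_ifs with hS
  · simp [hS]
  · obtain ⟨x, hx⟩ := Finset.nonempty_iff_ne_empty.2 hS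
    refine Finset.prod_eq_zero (Finset.mem_univ x) ?_
    simp only [if_pos hx]
    ring

theorem sum_bernoulliWeight (u : Site n → ℝ) : ∑ η, bernoulliWeight u η = 1 := by
  simpa [monomial] using sum_bernoulliWeight_mul_monomial u ∅

variable {u : Site n → ℝ}

theorem bernoulliWeight_pos (hu : ∀ x, u x ∈ Ioo (0 : ℝ) 1) (η : Config n) :
    0 < bernoulliWeight u η := by
  rw [bernoulliWeight_eq_prod_ite]
  refine Finset.prod_pos fun x _ => ?_
  split_ifs
  · exact (hu x).1
  · exact sub_pos.2 (hu x).2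

theorem isProbabilityMeasure_bernoulli (hu : ∀ x, u x ∈ Ioo (0 : ℝ) 1) :
    IsProbabilityMeasure (ofWeight (bernoulliWeight u)) :=
  isProbabilityMeasure_ofWeight (fun η => (bernoulliWeight_pos hu η).le) (sum_bernoulliWeight u)

theorem one_add_occ_sub_mul_occ_sub_div {x : Site n} (hu : u x ∈ Ioo (0 : ℝ) 1) (ζ η : Config n) :
    1 + (occ ζ x - u x) * (occ η x - u x) / (u x * (1 - u x))
      = if ζ x = η x then (if η x then u x else 1 - u x)⁻¹ else 0 := by
  have hu₀ : u x ≠ 0 := hu.1.ne'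
  have hu₁ : 1 - u x ≠ 0 := (sub_pos.2 hu.2).ne'
  cases hζ : ζ x <;> cases hη : η x <;> simp [occ, hζ, hη] <;> field_simp <;> ring

theorem sum_monomial_mul_monomial (hu : ∀ x, u x ∈ Ioo (0 : ℝ) 1) (ζ η : Config n) :
    ∑ S, monomial u S ζ * monomial u S η / ∏ x ∈ S, (u x * (1 - u x))
      = if ζ = η then (bernoulliWeight u η)⁻¹ else 0 := by
  have hfactor : ∑ S, monomial u S ζ * monomial u S η / ∏ x ∈ S, (u x * (1 - u x))
      = ∏ x, (1 + (occ ζ x - u x) * (occ η x - u x) / (u x * (1 - u x))) := by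
    simp only [Finset.prod_one_add, Finset.powerset_univ, monomial, Finset.prod_mul_distrib,
      Finset.prod_div_distrib]
  simp only [hfactor, one_add_occ_sub_mul_occ_sub_div (hu _)]
  split_ifs with h
  · simp [h, bernoulliWeight_eq_prod_ite]
  · obtain ⟨x, hx⟩ := Function.ne_iff.1 h
    exact Finset.prod_eq_zero (Finset.mem_univ x) (if_neg hx)

/-- Parseval's identity. -/
theorem sum_sq_div_bernoulliWeight (hu : ∀ x, u x ∈ Ioo (0 : ℝ) 1) (m : Config n → ℝ) :
    ∑ η, m η ^ 2 / bernoulliWeight u η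
      = ∑ S, (∑ η, m η * monomial u S η) ^ 2 / ∏ x ∈ S, (u x * (1 - u x)) := by
  symm
  calc
    _ = ∑ S, ∑ ζ, ∑ η, m ζ * m η
          * (monomial u S ζ * monomial u S η / ∏ x ∈ S, (u x * (1 - u x))) := by
      refine Finset.sum_congr rfl fun S _ => ?_
      simp only [sq, Finset.sum_mul_sum, Finset.sum_div]
      exact Finset.sum_congr rfl fun ζ _ => Finset.sum_congr rfl fun η _ => by ring
    _ = ∑ ζ, ∑ η, m ζ * m η * if ζ = η then (bernoulliWeight u η)⁻¹ else 0 := by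
      rw [Finset.sum_comm]
      refine Finset.sum_congr rfl fun ζ _ => ?_
      rw [Finset.sum_comm]
      simp_rw [← Finset.mul_sum, sum_monomial_mul_monomial hu]
    _ = _ := by simp [sq, div_eq_mul_inv]

theorem sum_abs_sub_bernoulliWeight_sq_le_sum_sq_div (hu : ∀ x, u x ∈ Ioo (0 : ℝ) 1)
    (μ : Config n → ℝ) :
    (∑ η, |μ η - bernoulliWeight u η|) ^ 2
      ≤ ∑ η, (μ η - bernoulliWeight u η) ^ 2 / bernoulliWeight u η := by
  have hcs := Finset.sum_sq_le_sum_mul_sum_of_sq_le_mul Finset.univ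
    (r := fun η => |μ η - bernoulliWeight u η|) (f := bernoulliWeight u)
    (g := fun η => (μ η - bernoulliWeight u η) ^ 2 / bernoulliWeight u η)
    (fun η _ => (bernoulliWeight_pos hu η).le)
    (fun η _ => div_nonneg (sq_nonneg _) (bernoulliWeight_pos hu η).le)
    (fun η _ => by rw [sq_abs, mul_div_cancel₀ _ (bernoulliWeight_pos hu η).ne'])
  rwa [sum_bernoulliWeight, one_mul] at hcs

theorem sum_abs_sub_bernoulliWeight_sq_le (hu : ∀ x, u x ∈ Ioo (0 : ℝ) 1) {μ : Config n → ℝ}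
    (hμ : ∑ η, μ η * monomial u ∅ η = 1) :
    (∑ η, |μ η - bernoulliWeight u η|) ^ 2 ≤ ∑ S ∈ Finset.univ.erase ∅,
      (∑ η, μ η * monomial u S η) ^ 2 / ∏ x ∈ S, (u x * (1 - u x)) := by
  refine (sum_abs_sub_bernoulliWeight_sq_le_sum_sq_div hu μ).trans_eq ?_
  rw [sum_sq_div_bernoulliWeight hu]
  simp_rw [sub_mul, Finset.sum_sub_distrib, sum_bernoulliWeight_mul_monomial]
  rw [← Finset.add_sum_erase _ _ (Finset.mem_univ ∅), hμ, if_pos rfl, sub_self,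
    zero_pow two_ne_zero, zero_div, zero_add]
  refine Finset.sum_congr rfl fun S hS => ?_
  rw [if_neg (Finset.ne_of_mem_erase hS), sub_zero]

/-- The χ² bound on the total variation distance to a product measure, expressed through the
correlation functions. -/
theorem tvDist_bernoulli_le_sqrt (hu : ∀ x, u x ∈ Ioo (0 : ℝ) 1) {A : ℝ}
    (hA : ∀ x, (u x * (1 - u x))⁻¹ ≤ A) {μ : Config n → ℝ}
    (hμ : ∑ η, μ η * monomial u ∅ η = 1) :
    tvDist (ofWeight μ) (ofWeight (bernoulliWeight u))
      ≤ √(∑ S ∈ Finset.univ.erase ∅, A ^ #S * (∑ η, μ η * monomial u S η) ^ 2) := by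
  refine (tvDist_ofWeight_le _ _).trans (Real.le_sqrt_of_sq_le
    ((sum_abs_sub_bernoulliWeight_sq_le hu hμ).trans (Finset.sum_le_sum fun S _ => ?_)))
  rw [div_eq_inv_mul, ← Finset.prod_inv_distrib, ← Finset.prod_const]
  gcongr with x
  · exact fun x _ => (inv_pos.2 (mul_pos (hu x).1 (sub_pos.2 (hu x).2))).le
  · exact hA x

end ProductMeasures

/-! ### Total variation distance of nearby Bernoulli product measures -/

section Expansions

open Asymptotics

theorem isLittleO_log_one_add_sub :
    (fun y : ℝ => Real.log (1 + y) - y + y ^ 2 / 2) =o[𝓝 0] fun y => y ^ 2 := by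
  have hbound : (fun y : ℝ => Real.log (1 + y) - y + y ^ 2 / 2) =O[𝓝 0] fun y => y ^ 3 := by
    refine IsBigO.of_bound 2 ?_
    filter_upwards [Metric.ball_mem_nhds (0 : ℝ) one_half_pos] with y hy
    have hy : |y| < 1 / 2 := by simpa using hy
    have hle := Real.abs_log_sub_add_sum_range_le (x := -y) (by rw [abs_neg]; linarith) 2
    rw [abs_neg] at hle
    calc ‖Real.log (1 + y) - y + y ^ 2 / 2‖ ≤ |y| ^ 3 / (1 - |y|) := by
          convert! hle using 2
          simp [Finset.sum_range_succ]
          ring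
      _ ≤ 2 * ‖y ^ 3‖ := by
          rw [norm_pow, Real.norm_eq_abs, div_le_iff₀ (by linarith)]
          nlinarith [pow_nonneg (abs_nonneg y) 3]
  exact hbound.trans_isLittleO (isLittleO_pow_pow (by norm_num))

theorem isLittleO_log_one_add_sq_sub :
    (fun y : ℝ => Real.log (1 + y) ^ 2 - y ^ 2) =o[𝓝 0] fun y => y ^ 2 := by
  have hsub : (fun y : ℝ => Real.log (1 + y) - y) =o[𝓝 0] fun y => y := by
    have hsq : (fun y : ℝ => y ^ 2) =o[𝓝 0] fun y => y := by
      simpa using isLittleO_pow_pow (𝕜 := ℝ) one_lt_two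
    refine ((isLittleO_log_one_add_sub.trans hsq).sub (hsq.const_mul_left (1 / 2))).congr_left
      fun y => by ring
  have hadd : (fun y : ℝ => Real.log (1 + y) + y) =O[𝓝 0] fun y => y :=
    (hsub.isBigO.add ((isBigO_refl _ _).const_mul_left 2)).congr_left fun y => by ring
  exact (hsub.mul_isBigO hadd).congr (fun y => by ring) fun y => by ring

theorem isLittleO_cexp_sub_sq :
    (fun z : ℂ => Complex.exp z - 1 - z - z ^ 2 / 2) =o[𝓝 0] fun z => z ^ 2 :=
  (Complex.exp_sub_sum_range_succ_isLittleO_pow 2).congr_left fun z => by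
    simp [Finset.sum_range_succ]
    ring

theorem isLittleO_cexp_log_one_add_sub (s : ℝ) :
    (fun y : ℝ => Complex.exp ((s * Real.log (1 + y) : ℝ) * Complex.I) - 1
      - Complex.I * s * y - (-(s : ℂ) ^ 2 - Complex.I * s) / 2 * y ^ 2)
      =o[𝓝 0] fun y : ℝ => y ^ 2 := by
  have hlog : Tendsto (fun y : ℝ => ((s * Real.log (1 + y) : ℝ) : ℂ) * Complex.I) (𝓝 0) (𝓝 0) := by
    have hcont : ContinuousAt (fun y : ℝ => ((s * Real.log (1 + y) : ℝ) : ℂ) * Complex.I) 0 := by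
      fun_prop (disch := norm_num)
    simpa using hcont.tendsto
  have hexp : (fun y : ℝ => Complex.exp ((s * Real.log (1 + y) : ℝ) * Complex.I) - 1
      - (s * Real.log (1 + y) : ℝ) * Complex.I - ((s * Real.log (1 + y) : ℝ) * Complex.I) ^ 2 / 2)
      =o[𝓝 0] fun y : ℝ => y ^ 2 := by
    refine (isLittleO_cexp_sub_sq.comp_tendsto hlog).trans_isBigO ?_
    refine (((isLittleO_log_one_add_sq_sub.isBigO.add (isBigO_refl _ _)).const_mul_left
      (s ^ 2)).congr_left fun y => ?_).of_norm_left
    simp [mul_pow]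
  have hfirst := (Complex.isLittleO_ofReal_left.2 isLittleO_log_one_add_sub).const_mul_left
    (Complex.I * s)
  have hsecond := (Complex.isLittleO_ofReal_left.2 isLittleO_log_one_add_sq_sub).const_mul_left
    ((s : ℂ) ^ 2 / 2)
  refine ((hexp.add hfirst).sub hsecond).congr_left fun y => ?_
  push_cast
  linear_combination -(s * Real.log (1 + y)) ^ 2 / 2 * Complex.I_sq

end Expansions

section CharacteristicFunction

open Asymptotics

/-- The characteristic function at `s` of the log-likelihood ratio of two Bernoulli measures with
densities `ρ + h` and `ρ`. -/
noncomputable def logRatioCharFun (ρ s h : ℝ) : ℂ :=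
  ρ * Complex.exp ((s * Real.log (1 + h / ρ) : ℝ) * Complex.I)
    + (1 - ρ) * Complex.exp ((s * Real.log (1 + -h / (1 - ρ)) : ℝ) * Complex.I)

/-- The characteristic exponent at `s` of the Gaussian law `N(-1/(2χ), 1/χ)`, where
`χ = ρ(1-ρ)`: the limit of the log-likelihood ratios of Bernoulli product measures whose densities
`ρ + h` satisfy `∑ h² → 1`. -/
noncomputable def logRatioExponent (ρ s : ℝ) : ℂ :=
  (-(s : ℂ) ^ 2 - Complex.I * s) / (2 * (ρ * (1 - ρ)))

variable {ρ : ℝ}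

theorem norm_logRatioCharFun_le (hρ : ρ ∈ Icc (0 : ℝ) 1) (s h : ℝ) :
    ‖logRatioCharFun ρ s h‖ ≤ 1 := by
  calc ‖logRatioCharFun ρ s h‖ ≤ ‖(ρ : ℂ)‖ + ‖((1 - ρ : ℝ) : ℂ)‖ := by
        refine (norm_add_le _ _).trans_eq ?_
        rw [norm_mul, norm_mul, Complex.norm_exp_ofReal_mul_I, Complex.norm_exp_ofReal_mul_I]
        simp
    _ = 1 := by
        rw [Complex.norm_of_nonneg hρ.1, Complex.norm_of_nonneg (sub_nonneg.2 hρ.2)]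
        ring

theorem re_logRatioExponent_nonpos (hρ : ρ ∈ Icc (0 : ℝ) 1) (s : ℝ) :
    (logRatioExponent ρ s).re ≤ 0 := by
  have hre : (logRatioExponent ρ s).re = -s ^ 2 / (2 * (ρ * (1 - ρ))) := by
    have hdecomp : logRatioExponent ρ s = ((-s ^ 2 / (2 * (ρ * (1 - ρ))) : ℝ) : ℂ)
        + ((-s / (2 * (ρ * (1 - ρ))) : ℝ) : ℂ) * Complex.I := by
      rw [logRatioExponent]
      push_cast
      ring
    rw [hdecomp, Complex.add_re, Complex.ofReal_re, Complex.re_ofReal_mul, Complex.I_re, mul_zero,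
      add_zero]
  rw [hre]
  exact div_nonpos_of_nonpos_of_nonneg (neg_nonpos.2 (sq_nonneg s))
    (mul_nonneg zero_le_two (mul_nonneg hρ.1 (sub_nonneg.2 hρ.2)))

theorem isLittleO_comp_mul_const {E : Type*} [NormedAddCommGroup E] {f : ℝ → E} {p : ℕ}
    (hf : f =o[𝓝 0] fun y => y ^ p) (k : ℝ) : (fun h => f (h * k)) =o[𝓝 0] fun h => h ^ p := by
  have hlim : Tendsto (fun h : ℝ => h * k) (𝓝 0) (𝓝 0) := by
    simpa using (continuous_id.mul_const k).tendsto (0 : ℝ)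
  refine (hf.comp_tendsto hlim).trans_isBigO
    (((isBigO_refl _ _).const_mul_left (k ^ p)).congr_left fun h => ?_)
  simp [mul_pow, mul_comm]

theorem isLittleO_cexp_mul_sq_sub (w : ℂ) :
    (fun h : ℝ => Complex.exp (w * (h : ℂ) ^ 2) - 1 - w * (h : ℂ) ^ 2)
      =o[𝓝 0] fun h : ℝ => h ^ 2 := by
  have hexp : (fun z : ℂ => Complex.exp z - 1 - z) =o[𝓝 0] fun z : ℂ => z := by
    simpa using (Complex.hasDerivAt_exp 0).isLittleO
  have hlim : Tendsto (fun h : ℝ => w * (h : ℂ) ^ 2) (𝓝 0) (𝓝 0) := by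
    have hcont : Continuous fun h : ℝ => w * (h : ℂ) ^ 2 := by fun_prop
    simpa using hcont.tendsto 0
  exact (hexp.comp_tendsto hlim).trans_isBigO
    (IsBigO.of_bound ‖w‖ (Eventually.of_forall fun h => by simp [norm_pow]))

/-- The terms of first order in `h` cancel because the log-likelihood ratio has mean `O(h²)`. -/
theorem isLittleO_logRatioCharFun_sub (hρ : ρ ∈ Ioo (0 : ℝ) 1) (s : ℝ) :
    (fun h : ℝ => logRatioCharFun ρ s h - Complex.exp (logRatioExponent ρ s * (h : ℂ) ^ 2))
      =o[𝓝 0] fun h : ℝ => h ^ 2 := by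
  have hρ₀ : (ρ : ℂ) ≠ 0 := by exact_mod_cast hρ.1.ne'
  have hρ₁ : (1 : ℂ) - ρ ≠ 0 := by exact_mod_cast (sub_pos.2 hρ.2).ne'
  have hoccupied := (isLittleO_comp_mul_const (isLittleO_cexp_log_one_add_sub s)
    ρ⁻¹).const_mul_left (ρ : ℂ)
  have hempty := (isLittleO_comp_mul_const (isLittleO_cexp_log_one_add_sub s)
    (-(1 - ρ)⁻¹)).const_mul_left ((1 : ℂ) - ρ)
  refine ((hoccupied.add hempty).sub
    (isLittleO_cexp_mul_sq_sub (logRatioExponent ρ s))).congr_left fun h => ?_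
  simp only [logRatioCharFun, logRatioExponent, div_eq_mul_inv h, div_eq_mul_inv (-h), neg_mul,
    mul_neg]
  push_cast
  field_simp
  ring

theorem norm_prod_sub_prod_le {ι R : Type*} [NormedCommRing R] [NormOneClass R] (t : Finset ι)
    {a b : ι → R} (ha : ∀ i ∈ t, ‖a i‖ ≤ 1) (hb : ∀ i ∈ t, ‖b i‖ ≤ 1) :
    ‖∏ i ∈ t, a i - ∏ i ∈ t, b i‖ ≤ ∑ i ∈ t, ‖a i - b i‖ := by
  induction t using Finset.cons_induction with
  | empty => simp
  | cons i t hi ih =>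
    rw [Finset.forall_mem_cons] at ha hb
    have hprod : ‖∏ j ∈ t, a j‖ ≤ 1 :=
      (Finset.norm_prod_le t a).trans (Finset.prod_le_one (fun _ _ => norm_nonneg _) ha.2)
    rw [Finset.prod_cons, Finset.prod_cons, Finset.sum_cons]
    calc ‖a i * ∏ j ∈ t, a j - b i * ∏ j ∈ t, b j‖
        = ‖(a i - b i) * ∏ j ∈ t, a j + b i * (∏ j ∈ t, a j - ∏ j ∈ t, b j)‖ := by ring_nf
      _ ≤ ‖a i - b i‖ * ‖∏ j ∈ t, a j‖ + ‖b i‖ * ‖∏ j ∈ t, a j - ∏ j ∈ t, b j‖ :=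
          (norm_add_le _ _).trans (add_le_add (norm_mul_le _ _) (norm_mul_le _ _))
      _ ≤ ‖a i - b i‖ * 1 + 1 * ∑ j ∈ t, ‖a j - b j‖ := by
          gcongr
          exacts [hb.1, ih ha.2 hb.2]
      _ = _ := by rw [mul_one, one_mul]

variable {ι : ℕ → Type*} [∀ n, Fintype (ι n)] {F : ℝ → ℂ} {w : ℂ} {h : ∀ n, ι n → ℝ} {δ : ℕ → ℝ}

theorem norm_prod_sub_cexp_sum_le {ι : Type*} [Fintype ι] (hF : ∀ y, ‖F y‖ ≤ 1) (hw : w.re ≤ 0)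
    {c : ℝ} {h : ι → ℝ}
    (hFw : ∀ i, ‖F (h i) - Complex.exp (w * (h i : ℂ) ^ 2)‖ ≤ c * ‖h i ^ 2‖) :
    ‖∏ i, F (h i) - Complex.exp (w * (∑ i, h i ^ 2 : ℝ))‖ ≤ c * ‖∑ i, h i ^ 2‖ := by
  have hexp (y : ℝ) : ‖Complex.exp (w * (y : ℂ) ^ 2)‖ ≤ 1 := by
    rw [Complex.norm_exp, Real.exp_le_one_iff, ← Complex.ofReal_pow, Complex.re_mul_ofReal]
    exact mul_nonpos_of_nonpos_of_nonneg hw (sq_nonneg y)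
  have hprod : Complex.exp (w * (∑ i, h i ^ 2 : ℝ)) = ∏ i, Complex.exp (w * (h i : ℂ) ^ 2) := by
    rw [← Complex.exp_sum, ← Finset.mul_sum]
    push_cast
    rfl
  rw [hprod]
  calc _ ≤ ∑ i, ‖F (h i) - Complex.exp (w * (h i : ℂ) ^ 2)‖ :=
        norm_prod_sub_prod_le _ (fun i _ => hF _) fun i _ => hexp _
    _ ≤ ∑ i, c * ‖h i ^ 2‖ := Finset.sum_le_sum fun i _ => hFw i
    _ = c * ‖∑ i, h i ^ 2‖ := by
        rw [← Finset.mul_sum, Real.norm_of_nonneg (Finset.sum_nonneg fun i _ => sq_nonneg _)]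
        simp

theorem tendsto_prod_of_isLittleO (hF : ∀ y, ‖F y‖ ≤ 1) (hw : w.re ≤ 0)
    (hFw : (fun y : ℝ => F y - Complex.exp (w * (y : ℂ) ^ 2)) =o[𝓝 0] fun y : ℝ => y ^ 2)
    (hδ : Tendsto δ atTop (𝓝 0)) (hh : ∀ᶠ n in atTop, ∀ i, |h n i| ≤ δ n) {v : ℝ}
    (hv : Tendsto (fun n => ∑ i, h n i ^ 2) atTop (𝓝 v)) :
    Tendsto (fun n => ∏ i, F (h n i)) atTop (𝓝 (Complex.exp (w * v))) := by
  have hexp : Tendsto (fun n => Complex.exp (w * (∑ i, h n i ^ 2 : ℝ))) atTop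
      (𝓝 (Complex.exp (w * v))) := by
    have hcont : Continuous fun v : ℝ => Complex.exp (w * (v : ℂ)) := by fun_prop
    exact (hcont.tendsto v).comp hv
  have hdiff : (fun n => ∏ i, F (h n i) - Complex.exp (w * (∑ i, h n i ^ 2 : ℝ)))
      =o[atTop] fun n => ∑ i, h n i ^ 2 := by
    refine isLittleO_iff.2 fun c hc => ?_
    obtain ⟨r, hr, hball⟩ := Metric.eventually_nhds_iff_ball.1 (isLittleO_iff.1 hFw hc)
    filter_upwards [hδ.eventually_lt_const hr, hh] with n hδn hhn
    refine norm_prod_sub_cexp_sum_le hF hw fun i => hball _ ?_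
    rw [mem_ball_zero_iff, Real.norm_eq_abs]
    exact (hhn i).trans_lt hδn
  have hzero := (isLittleO_one_iff ℝ).1 (hdiff.trans_isBigO (hv.isBigO_one ℝ))
  simpa using hzero.add hexp

end CharacteristicFunction

section LogLikelihoodRatio

/-- The log-likelihood ratio of the Bernoulli product measures with densities `ρ + h` and `ρ`. -/
noncomputable def logRatio {n : ℕ} (ρ : ℝ) (h : Site n → ℝ) (η : Config n) : ℝ :=
  ∑ x, if η x then Real.log (1 + h x / ρ) else Real.log (1 + -h x / (1 - ρ))

variable {n : ℕ} {ρ : ℝ} {h : Site n → ℝ}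

theorem bernoulliWeight_add (hρ : ρ ∈ Ioo (0 : ℝ) 1) (hh : ∀ x, ρ + h x ∈ Ioo (0 : ℝ) 1)
    (η : Config n) :
    bernoulliWeight (fun x => ρ + h x) η
      = bernoulliWeight (fun _ => ρ) η * Real.exp (logRatio ρ h η) := by
  have hρ₁ : 0 < 1 - ρ := sub_pos.2 hρ.2
  rw [logRatio, Real.exp_sum, bernoulliWeight_eq_prod_ite, bernoulliWeight_eq_prod_ite,
    ← Finset.prod_mul_distrib]
  refine Finset.prod_congr rfl fun x _ => ?_
  split_ifs
  · have hratio : 1 + h x / ρ = (ρ + h x) / ρ := by rw [add_div, div_self hρ.1.ne']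
    rw [hratio, Real.exp_log (div_pos (hh x).1 hρ.1), mul_div_cancel₀ _ hρ.1.ne']
  · have hratio : 1 + -h x / (1 - ρ) = (1 - (ρ + h x)) / (1 - ρ) := by field
    rw [hratio, Real.exp_log (div_pos (sub_pos.2 (hh x).2) hρ₁), mul_div_cancel₀ _ hρ₁.ne']

theorem tvDist_bernoulli_eq_integral (hρ : ρ ∈ Ioo (0 : ℝ) 1)
    (hh : ∀ x, ρ + h x ∈ Ioo (0 : ℝ) 1) :
    tvDist (ofWeight (bernoulliWeight fun x => ρ + h x)) (ofWeight (bernoulliWeight fun _ => ρ))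
      = ∫ y, max (1 - Real.exp y) 0
        ∂((ofWeight (bernoulliWeight fun _ : Site n => ρ)).map (logRatio ρ h)) := by
  have hdensity : ofWeight (bernoulliWeight fun x => ρ + h x)
      = (ofWeight (bernoulliWeight fun _ => ρ)).withDensity
        fun η => ENNReal.ofReal (Real.exp (logRatio ρ h η)) := by
    rw [← ofWeight_mul_eq_withDensity fun η => (bernoulliWeight_pos (fun _ => hρ) η).le]
    exact congrArg ofWeight (funext (bernoulliWeight_add hρ hh))
  have := isProbabilityMeasure_bernoulli (n := n) (u := fun _ => ρ) fun _ => hρ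
  have hprob := isProbabilityMeasure_bernoulli hh
  rw [hdensity] at hprob ⊢
  rw [tvDist_withDensity .of_discrete fun η => (Real.exp_pos _).le,
    integral_map Measurable.of_discrete.aemeasurable
      (Continuous.aestronglyMeasurable (by fun_prop))]

theorem charFun_map_logRatio (hρ : ρ ∈ Ioo (0 : ℝ) 1) (h : Site n → ℝ) (s : ℝ) :
    charFun ((ofWeight (bernoulliWeight fun _ : Site n => ρ)).map (logRatio ρ h)) s
      = ∏ x, logRatioCharFun ρ s (h x) := by
  rw [charFun_apply_real, integral_map Measurable.of_discrete.aemeasurable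
    (Continuous.aestronglyMeasurable (by fun_prop)),
    integral_ofWeight fun η => (bernoulliWeight_pos (fun _ => hρ) η).le]
  have hprod := sum_config_prod (R := ℂ) (n := n) fun x b =>
    ((if b then ρ else 1 - ρ : ℝ) : ℂ) * Complex.exp ((s * (if b then Real.log (1 + h x / ρ)
      else Real.log (1 + -h x / (1 - ρ))) : ℝ) * Complex.I)
  simp only [if_true, Bool.false_eq_true, if_false, Complex.ofReal_sub, Complex.ofReal_one] at hprod
  simp only [logRatioCharFun]
  rw [← hprod]
  refine Finset.sum_congr rfl fun η _ => ?_
  rw [Complex.real_smul, bernoulliWeight_eq_prod_ite, logRatio, Finset.prod_mul_distrib,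
    ← Complex.exp_sum, ← Finset.sum_mul]
  push_cast
  rw [Finset.mul_sum]

end LogLikelihoodRatio

section Gaussian

theorem gaussianReal_eq_withDensity (m : ℝ) :
    gaussianReal m 1 = (gaussianReal 0 1).withDensity
      fun z => ENNReal.ofReal (Real.exp (m * z - m ^ 2 / 2)) := by
  rw [gaussianReal_of_var_ne_zero _ one_ne_zero, gaussianReal_of_var_ne_zero _ one_ne_zero,
    ← withDensity_mul _ (measurable_gaussianPDF _ _) (by fun_prop)]
  congr 1
  ext z
  rw [Pi.mul_apply, gaussianPDF, gaussianPDF, ← ENNReal.ofReal_mul (gaussianPDFReal_nonneg _ _ _)]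
  simp only [gaussianPDFReal, NNReal.coe_one, mul_assoc, ← Real.exp_add]
  congr 3
  ring

theorem gaussianReal_map_mul_sub (m : ℝ) :
    (gaussianReal 0 1).map (fun z => m * z - m ^ 2 / 2)
      = gaussianReal (-(m ^ 2 / 2)) (.mk (m ^ 2) (sq_nonneg m)) := by
  have hmap := gaussianReal_map_sub_const (μ := m * 0) (v := .mk (m ^ 2) (sq_nonneg m) * 1)
    (m ^ 2 / 2)
  rw [← gaussianReal_map_const_mul m, Measure.map_map (by fun_prop) (by fun_prop)] at hmap
  simpa [Function.comp_def] using hmap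

theorem gaussianProfile_eq_integral (m : ℝ) :
    gaussianProfile m = ∫ y, max (1 - Real.exp y) 0
      ∂(gaussianReal (-(m ^ 2 / 2)) (.mk (m ^ 2) (sq_nonneg m))) := by
  have : IsProbabilityMeasure ((gaussianReal 0 1).withDensity
      fun z => ENNReal.ofReal (Real.exp (m * z - m ^ 2 / 2))) := by
    rw [← gaussianReal_eq_withDensity]
    infer_instance
  rw [gaussianProfile, gaussianReal_eq_withDensity m,
    tvDist_withDensity (by fun_prop) fun z => (Real.exp_pos _).le, ← gaussianReal_map_mul_sub,
    integral_map (by fun_prop) (Continuous.aestronglyMeasurable (by fun_prop))]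

theorem charFun_gaussianReal_eq_cexp_logRatioExponent {ρ : ℝ} (hρ : ρ ∈ Ioo (0 : ℝ) 1)
    (m s : ℝ) :
    charFun (gaussianReal (-(m ^ 2 / 2)) (.mk (m ^ 2) (sq_nonneg m))) s
      = Complex.exp (logRatioExponent ρ s * (m ^ 2 * (ρ * (1 - ρ)) : ℝ)) := by
  have hρ₀ : (ρ : ℂ) ≠ 0 := by exact_mod_cast hρ.1.ne'
  have hρ₁ : (1 : ℂ) - ρ ≠ 0 := by exact_mod_cast (sub_pos.2 hρ.2).ne'
  rw [charFun_gaussianReal, logRatioExponent]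
  congr 1
  push_cast
  field_simp
  ring

theorem tendsto_integral_posPart_one_sub_exp {P : ℕ → ProbabilityMeasure ℝ}
    {Q : ProbabilityMeasure ℝ} (hPQ : Tendsto P atTop (𝓝 Q)) :
    Tendsto (fun n => ∫ y, max (1 - Real.exp y) 0 ∂(P n : Measure ℝ)) atTop
      (𝓝 (∫ y, max (1 - Real.exp y) 0 ∂(Q : Measure ℝ))) :=
  ProbabilityMeasure.tendsto_iff_forall_integral_tendsto.1 hPQ
    (.ofNormedAddCommGroup (fun y => max (1 - Real.exp y) 0) (by fun_prop) 1 fun y => by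
      rw [Real.norm_eq_abs, abs_of_nonneg (le_max_right _ _)]
      exact max_le (by linarith [Real.exp_pos y]) zero_le_one)

end Gaussian

theorem tendsto_tvDist_bernoulli {ρ : ℝ} (hρ : ρ ∈ Ioo (0 : ℝ) 1) {h : ∀ n : ℕ, Site n → ℝ}
    {δ : ℕ → ℝ} (hδ : Tendsto δ atTop (𝓝 0)) (hh : ∀ᶠ n in atTop, ∀ x, |h n x| ≤ δ n) {m : ℝ}
    (hm : Tendsto (fun n => ∑ x, h n x ^ 2) atTop (𝓝 (m ^ 2 * (ρ * (1 - ρ))))) :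
    Tendsto (fun n => tvDist (ofWeight (bernoulliWeight fun x => ρ + h n x))
      (ofWeight (bernoulliWeight fun _ : Site n => ρ))) atTop (𝓝 (gaussianProfile m)) := by
  have hprob (n : ℕ) : IsProbabilityMeasure
      ((ofWeight (bernoulliWeight fun _ : Site n => ρ)).map (logRatio ρ (h n))) :=
    have := isProbabilityMeasure_bernoulli (n := n) (u := fun _ => ρ) fun _ => hρ
    Measure.isProbabilityMeasure_map Measurable.of_discrete.aemeasurable
  have hlaw : Tendsto (β := ProbabilityMeasure ℝ) (fun n => ⟨_, hprob n⟩) atTop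
      (𝓝 ⟨gaussianReal (-(m ^ 2 / 2)) (.mk (m ^ 2) (sq_nonneg m)), inferInstance⟩) := by
    refine ProbabilityMeasure.tendsto_iff_tendsto_charFun.2 fun s => ?_
    have hprod := tendsto_prod_of_isLittleO (norm_logRatioCharFun_le (Ioo_subset_Icc_self hρ) s)
      (re_logRatioExponent_nonpos (Ioo_subset_Icc_self hρ) s)
      (isLittleO_logRatioCharFun_sub hρ s) hδ hh hm
    rw [← charFun_gaussianReal_eq_cexp_logRatioExponent hρ] at hprod
    exact hprod.congr fun n => (charFun_map_logRatio hρ (h n) s).symm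
  rw [gaussianProfile_eq_integral]
  refine (tendsto_integral_posPart_one_sub_exp hlaw).congr' ?_
  have hmin : 0 < min ρ (1 - ρ) := lt_min hρ.1 (sub_pos.2 hρ.2)
  filter_upwards [hh, hδ.eventually_lt_const hmin] with n hhn hδn
  refine (tvDist_bernoulli_eq_integral hρ fun x => ?_).symm
  have hx := abs_lt.1 ((hhn x).trans_lt hδn)
  have := min_le_left ρ (1 - ρ)
  have := min_le_right ρ (1 - ρ)
  constructor <;> linarith

/-! ### Exchanging the contents of two sites -/

section Exchange

variable {V : Type*} [DecidableEq V]

/-- The image of a set of particle positions under the exchange of `x` and `y`: the action of the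
exchange dynamics on the index sets of correlation functions. -/
def swapSet (x y : V) (S : Finset V) : Finset V := S.map (Equiv.swap x y).toEmbedding

theorem mem_swapSet {x y z : V} {S : Finset V} : z ∈ swapSet x y S ↔ Equiv.swap x y z ∈ S := by
  rw [swapSet, Finset.mem_map_equiv, Equiv.symm_swap]

@[simp] theorem card_swapSet (x y : V) (S : Finset V) : #(swapSet x y S) = #S :=
  Finset.card_map _

@[simp] theorem swapSet_swapSet (x y : V) (S : Finset V) : swapSet x y (swapSet x y S) = S := by
  ext z; simp [mem_swapSet]

theorem mem_swapSet_left {x y : V} {S : Finset V} : x ∈ swapSet x y S ↔ y ∈ S := by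
  simp [mem_swapSet]

theorem mem_swapSet_right {x y : V} {S : Finset V} : y ∈ swapSet x y S ↔ x ∈ S := by
  simp [mem_swapSet]

theorem mem_swapSet_of_ne {x y z : V} {S : Finset V} (hx : z ≠ x) (hy : z ≠ y) :
    z ∈ swapSet x y S ↔ z ∈ S := by
  rw [mem_swapSet, Equiv.swap_apply_of_ne_of_ne hx hy]

theorem swapSet_eq_self {x y : V} {S : Finset V} (h : x ∈ S ↔ y ∈ S) : swapSet x y S = S := by
  ext z
  rcases eq_or_ne z x with rfl | hx
  · rw [mem_swapSet_left, h]
  rcases eq_or_ne z y with rfl | hy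
  · rw [mem_swapSet_right, h]
  · exact mem_swapSet_of_ne hx hy

theorem swapSet_erase {x y : V} {S : Finset V} (hxy : x ≠ y) (hx : x ∈ S) (hy : y ∈ S) :
    swapSet x y (S.erase x) = S.erase y := by
  ext z
  rcases eq_or_ne z x with rfl | hzx
  · simp [mem_swapSet_left, hx, hy, hxy, hxy.symm]
  rcases eq_or_ne z y with rfl | hzy
  · simp [mem_swapSet_right]
  · simp [mem_swapSet_of_ne hzx hzy, hzx, hzy]

theorem injOn_erase_erase {x y : V} (hxy : x ≠ y) :
    Set.InjOn (fun S : Finset V => (S.erase x).erase y) {S | x ∈ S ∧ y ∈ S} :=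
  (Finset.erase_injOn' y).comp ((Finset.erase_injOn' x).mono fun _ hS => hS.1)
    fun _ hS => Finset.mem_erase.2 ⟨hxy.symm, hS.2⟩

variable [Fintype V]

theorem sum_swapSet {M : Type*} [AddCommMonoid M] (x y : V) (f : Finset V → M) :
    ∑ S, f (swapSet x y S) = ∑ S, f S :=
  Equiv.sum_comp (Function.Involutive.toPerm _ (swapSet_swapSet x y)) f

theorem card_mul_eq_sum (S : Finset V) (c : ℝ) : (#S : ℝ) * c = ∑ x, if x ∈ S then c else 0 := by
  rw [Finset.sum_ite_mem, Finset.univ_inter, Finset.sum_const, nsmul_eq_mul]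

end Exchange

theorem sum_comp_le_sum_of_injOn {ι ι' : Type*} {s : Finset ι} {t : Finset ι'} {i : ι → ι'}
    (hmaps : ∀ j ∈ s, i j ∈ t) (hinj : Set.InjOn i s) {f : ι' → ℝ} (hf : ∀ j ∈ t, 0 ≤ f j) :
    ∑ j ∈ s, f (i j) ≤ ∑ j ∈ t, f j := by
  classical
  rw [← Finset.sum_image hinj]
  exact Finset.sum_le_sum_of_subset_of_nonneg (Finset.image_subset_iff.2 hmaps)
    fun j hj _ => hf j hj

section WeightedMass

variable {V : Type*} [Fintype V]

/-- The energy of the correlation functions `κ` with a weight `a` per particle. -/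
noncomputable def energy (a : ℝ) (κ : Finset V → ℝ) : ℝ := ∑ S, a ^ #S * κ S ^ 2

/-- The energy of the correlation functions, in which each set also counts with its size. -/
noncomputable def cardEnergy (a : ℝ) (κ : Finset V → ℝ) : ℝ := ∑ S, (#S : ℝ) * (a ^ #S * κ S ^ 2)

theorem energy_nonneg {a : ℝ} (ha : 0 ≤ a) (κ : Finset V → ℝ) : 0 ≤ energy a κ :=
  Finset.sum_nonneg fun S _ => by positivity

theorem cardEnergy_nonneg {a : ℝ} (ha : 0 ≤ a) (κ : Finset V → ℝ) : 0 ≤ cardEnergy a κ :=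
  Finset.sum_nonneg fun S _ => by positivity

theorem energy_le_cardEnergy_add {a : ℝ} (ha : 0 ≤ a) (κ : Finset V → ℝ) :
    energy a κ ≤ cardEnergy a κ + κ ∅ ^ 2 := by
  classical
  have hempty : κ ∅ ^ 2 = ∑ S : Finset V, if S = ∅ then κ ∅ ^ 2 else 0 := by simp
  rw [energy, cardEnergy, hempty, ← Finset.sum_add_distrib]
  refine Finset.sum_le_sum fun S _ => ?_
  split_ifs with hS
  · simp [hS]
  · have hcard : (1 : ℝ) ≤ #S := by
      exact_mod_cast Finset.card_pos.2 (Finset.nonempty_iff_ne_empty.2 hS)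
    rw [add_zero]
    exact le_mul_of_one_le_left (by positivity) hcard

variable [DecidableEq V]

/-- The Dirichlet form of the exchange across `{x, y}`, with respect to the weights `W`. -/
noncomputable def swapEnergy (W : Finset V → ℝ) (x y : V) (κ : Finset V → ℝ) : ℝ :=
  ∑ S, W S * (κ (swapSet x y S) - κ S) ^ 2

/-- The `W`-weighted square mass of `κ` on the sets containing `x`. -/
noncomputable def siteMass (W : Finset V → ℝ) (x : V) (κ : Finset V → ℝ) : ℝ :=
  ∑ S with x ∈ S, W S * κ S ^ 2

/-- The `W`-weighted square mass of `κ` on the sets containing both `x` and `y`. -/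
noncomputable def pairMass (W : Finset V → ℝ) (x y : V) (κ : Finset V → ℝ) : ℝ :=
  ∑ S with x ∈ S ∧ y ∈ S, W S * κ S ^ 2

variable {W : Finset V → ℝ} {κ : Finset V → ℝ}

theorem swapEnergy_nonneg (hW : ∀ S, 0 ≤ W S) (x y : V) (κ : Finset V → ℝ) :
    0 ≤ swapEnergy W x y κ :=
  Finset.sum_nonneg fun S _ => mul_nonneg (hW S) (sq_nonneg _)

theorem siteMass_nonneg (hW : ∀ S, 0 ≤ W S) (x : V) (κ : Finset V → ℝ) : 0 ≤ siteMass W x κ :=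
  Finset.sum_nonneg fun S _ => mul_nonneg (hW S) (sq_nonneg _)

theorem pairMass_nonneg (hW : ∀ S, 0 ≤ W S) (x y : V) (κ : Finset V → ℝ) :
    0 ≤ pairMass W x y κ :=
  Finset.sum_nonneg fun S _ => mul_nonneg (hW S) (sq_nonneg _)

theorem pairMass_eq_siteMass (W : Finset V → ℝ) (x y : V) (κ : Finset V → ℝ) :
    pairMass W x y κ = siteMass (fun S => if y ∈ S then W S else 0) x κ := by
  simp only [pairMass, siteMass, ite_mul, zero_mul, ← Finset.sum_filter, Finset.filter_filter]

theorem pairMass_le_siteMass (hW : ∀ S, 0 ≤ W S) (x y : V) (κ : Finset V → ℝ) :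
    pairMass W x y κ ≤ siteMass W y κ :=
  Finset.sum_le_sum_of_subset_of_nonneg (Finset.monotone_filter_right _ fun _ _ h => h.2)
    fun S _ _ => mul_nonneg (hW S) (sq_nonneg _)

theorem sum_siteMass (W κ : Finset V → ℝ) :
    ∑ x, siteMass W x κ = ∑ S, (#S : ℝ) * (W S * κ S ^ 2) := by
  simp_rw [siteMass, card_mul_eq_sum, Finset.sum_filter]
  exact Finset.sum_comm

theorem sum_mul_swapSet_sub {x y : V} (hinv : ∀ S, W (swapSet x y S) = W S) :
    ∑ S, W S * κ S * (κ (swapSet x y S) - κ S) = -(1 / 2) * swapEnergy W x y κ := by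
  have hshift : ∑ S, W S * κ (swapSet x y S) ^ 2 = ∑ S, W S * κ S ^ 2 := by
    simpa only [hinv] using sum_swapSet x y fun S => W S * κ S ^ 2
  have hexpand : ∑ S, W S * κ S * (κ (swapSet x y S) - κ S) + 1 / 2 * swapEnergy W x y κ
      = 1 / 2 * ∑ S, W S * κ (swapSet x y S) ^ 2 - 1 / 2 * ∑ S, W S * κ S ^ 2 := by
    simp only [swapEnergy, Finset.mul_sum, ← Finset.sum_add_distrib, ← Finset.sum_sub_distrib]
    exact Finset.sum_congr rfl fun S _ => by ring
  linarith

/-- Young's inequality, with a parameter chosen so that the factors `1 + 1 / m` telescope along a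
path. -/
theorem siteMass_le_add_swapEnergy {x y : V} (hW : ∀ S, 0 ≤ W S)
    (hinv : ∀ S, W (swapSet x y S) = W S) {m : ℝ} (hm : 0 < m) (κ : Finset V → ℝ) :
    siteMass W y κ ≤ (1 + 1 / m) * siteMass W x κ + (1 + m) * swapEnergy W x y κ := by
  have hshift : ∑ S with y ∈ S, W S * κ (swapSet x y S) ^ 2 = siteMass W x κ := by
    rw [siteMass, Finset.sum_filter, Finset.sum_filter,
      ← sum_swapSet x y fun S => if x ∈ S then W S * κ S ^ 2 else 0]
    simp only [mem_swapSet_left, hinv]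
  have hyoung (p q : ℝ) : q ^ 2 ≤ (1 + 1 / m) * p ^ 2 + (1 + m) * (p - q) ^ 2 := by
    have hsq : (1 + 1 / m) * p ^ 2 + (1 + m) * (p - q) ^ 2 - q ^ 2
        = 1 / m * (p + m * (p - q)) ^ 2 := by field
    have : 0 ≤ 1 / m * (p + m * (p - q)) ^ 2 := by positivity
    linarith
  calc siteMass W y κ
      ≤ ∑ S with y ∈ S, ((1 + 1 / m) * (W S * κ (swapSet x y S) ^ 2)
          + (1 + m) * (W S * (κ (swapSet x y S) - κ S) ^ 2)) :=
        Finset.sum_le_sum fun S _ =>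
          (mul_le_mul_of_nonneg_left (hyoung (κ (swapSet x y S)) (κ S)) (hW S)).trans_eq (by ring)
    _ = (1 + 1 / m) * siteMass W x κ
          + (1 + m) * ∑ S with y ∈ S, W S * (κ (swapSet x y S) - κ S) ^ 2 := by
        rw [Finset.sum_add_distrib, ← Finset.mul_sum, ← Finset.mul_sum, hshift]
    _ ≤ (1 + 1 / m) * siteMass W x κ + (1 + m) * swapEnergy W x y κ := by
        gcongr
        exact Finset.sum_le_sum_of_subset_of_nonneg (Finset.filter_subset _ _)
          fun S _ _ => mul_nonneg (hW S) (sq_nonneg _)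

theorem siteMass_le_of_path (hW : ∀ S, 0 ≤ W S) (κ : Finset V → ℝ) (x : ℕ → V) (m : ℕ)
    (hinv : ∀ i < m, ∀ S, W (swapSet (x i) (x (i + 1)) S) = W S) :
    siteMass W (x m) κ
      ≤ (m + 1) * (siteMass W (x 0) κ
        + ∑ i ∈ Finset.range m, swapEnergy W (x i) (x (i + 1)) κ) := by
  induction m with
  | zero => simp
  | succ m ih =>
    have hm : (0 : ℝ) < m + 1 := by positivity
    have hstep := siteMass_le_add_swapEnergy hW (hinv m m.lt_succ_self) hm κ
    have hprev := mul_le_mul_of_nonneg_left (ih fun i hi => hinv i (hi.trans m.lt_succ_self))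
      (by positivity : (0 : ℝ) ≤ 1 + 1 / (m + 1))
    rw [← mul_assoc, show (1 + 1 / ((m : ℝ) + 1)) * (m + 1) = m + 2 by field] at hprev
    rw [Finset.sum_range_succ]
    push_cast
    linarith

theorem sum_pair_erase_sub_erase_sq_le {x y : V} (hxy : x ≠ y) {a : ℝ} (ha : 0 ≤ a)
    (κ : Finset V → ℝ) :
    ∑ S with x ∈ S ∧ y ∈ S, a ^ #S * (κ (S.erase x) - κ (S.erase y)) ^ 2
      ≤ a * swapEnergy (fun S => a ^ #S) x y κ := by
  calc _ = ∑ S : Finset V with x ∈ S ∧ y ∈ S, a * (a ^ #(S.erase x)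
            * (κ (swapSet x y (S.erase x)) - κ (S.erase x)) ^ 2) := by
        refine Finset.sum_congr rfl fun S hS => ?_
        obtain ⟨hx, hy⟩ := (Finset.mem_filter.1 hS).2
        rw [swapSet_erase hxy hx hy, ← Finset.card_erase_add_one hx, pow_succ]
        ring
    _ ≤ ∑ S, a * (a ^ #S * (κ (swapSet x y S) - κ S) ^ 2) :=
        sum_comp_le_sum_of_injOn (t := Finset.univ) (i := fun S : Finset V => S.erase x)
          (f := fun S => a * (a ^ #S * (κ (swapSet x y S) - κ S) ^ 2))
          (fun _ _ => Finset.mem_univ _)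
          ((Finset.erase_injOn' x).mono fun S hS => (Finset.mem_filter.1 (Finset.mem_coe.1 hS)).2.1)
          fun S _ => by positivity
    _ = a * swapEnergy (fun S => a ^ #S) x y κ := (Finset.mul_sum _ _ _).symm

theorem sum_pair_erase_erase_sq_le {x y : V} (hxy : x ≠ y) {a : ℝ} (ha : 0 ≤ a)
    (κ : Finset V → ℝ) :
    ∑ S with x ∈ S ∧ y ∈ S, (#S : ℝ) * a ^ #S * κ ((S.erase x).erase y) ^ 2
      ≤ a ^ 2 * (cardEnergy a κ + 2 * energy a κ) := by
  calc _ = ∑ S : Finset V with x ∈ S ∧ y ∈ S, a ^ 2 * (((#((S.erase x).erase y) : ℝ) + 2)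
            * a ^ #((S.erase x).erase y) * κ ((S.erase x).erase y) ^ 2) := by
        refine Finset.sum_congr rfl fun S hS => ?_
        obtain ⟨hx, hy⟩ := (Finset.mem_filter.1 hS).2
        rw [← Finset.card_erase_add_one hx,
          ← Finset.card_erase_add_one (Finset.mem_erase.2 ⟨hxy.symm, hy⟩)]
        push_cast
        ring
    _ ≤ ∑ S : Finset V, a ^ 2 * (((#S : ℝ) + 2) * a ^ #S * κ S ^ 2) :=
        sum_comp_le_sum_of_injOn (t := Finset.univ)
          (i := fun S : Finset V => (S.erase x).erase y)
          (f := fun S => a ^ 2 * (((#S : ℝ) + 2) * a ^ #S * κ S ^ 2))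
          (fun _ _ => Finset.mem_univ _)
          ((injOn_erase_erase hxy).mono fun S hS => (Finset.mem_filter.1 (Finset.mem_coe.1 hS)).2)
          fun S _ => by positivity
    _ = a ^ 2 * (cardEnergy a κ + 2 * energy a κ) := by
        simp only [cardEnergy, energy, Finset.mul_sum, ← Finset.sum_add_distrib]
        exact Finset.sum_congr rfl fun S _ => by ring

end WeightedMass

/-! ### The dual dynamics -/

/-- The edges `{x, x+1}` of the bulk, as ordered pairs `(x, x+1)`. -/
def edges (n : ℕ) : Finset (Site n × Site n) :=
  Finset.univ.filter fun e => (e.2 : ℕ) = (e.1 : ℕ) + 1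

/-- The sites in contact with a reservoir. -/
def boundary (n : ℕ) : Finset (Site n) :=
  Finset.univ.filter fun x => (x : ℕ) = 1 ∨ (x : ℕ) = n - 1

section Dual

variable {n : ℕ}

theorem mem_edges {e : Site n × Site n} : e ∈ edges n ↔ (e.2 : ℕ) = (e.1 : ℕ) + 1 := by
  simp [edges]

theorem mem_boundary {x : Site n} : x ∈ boundary n ↔ (x : ℕ) = 1 ∨ (x : ℕ) = n - 1 := by
  simp [boundary]

theorem ne_of_mem_edges {e : Site n × Site n} (he : e ∈ edges n) : e.1 ≠ e.2 := fun h => by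
  have := mem_edges.1 he
  rw [h] at this
  omega

theorem card_site_le (n : ℕ) : Fintype.card (Site n) ≤ n := by simp

theorem injOn_snd_edges (n : ℕ) : Set.InjOn Prod.snd (edges n : Set (Site n × Site n)) := by
  intro e he e' he' h
  have hfst := mem_edges.1 (Finset.mem_coe.1 he)
  rw [h, mem_edges.1 (Finset.mem_coe.1 he')] at hfst
  exact Prod.ext (Subtype.ext (Nat.succ_injective hfst).symm) h

theorem sum_edges_le_sum_site {f : Site n → ℝ} (hf : ∀ x, 0 ≤ f x) :
    ∑ e ∈ edges n, f e.2 ≤ ∑ x, f x :=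
  sum_comp_le_sum_of_injOn (fun _ _ => Finset.mem_univ _) (injOn_snd_edges n) fun x _ => hf x

theorem card_edges_le (n : ℕ) : #(edges n) ≤ n :=
  (Finset.card_le_card_of_injOn Prod.snd (fun _ _ => Finset.mem_univ _)
    (injOn_snd_edges n)).trans (card_site_le n)

/-- The Dirichlet form of the dual dynamics, in which particles move by exchanges across the edges
and are killed at the boundary, with respect to the weights `W`. -/
noncomputable def dirichletForm (n : ℕ) (W κ : Finset (Site n) → ℝ) : ℝ :=
  ∑ e ∈ edges n, swapEnergy W e.1 e.2 κ + ∑ S, W S * (#(S ∩ boundary n) * κ S ^ 2)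

variable {W W' : Finset (Site n) → ℝ}

theorem dirichletForm_nonneg (hW : ∀ S, 0 ≤ W S) (κ : Finset (Site n) → ℝ) :
    0 ≤ dirichletForm n W κ :=
  add_nonneg (Finset.sum_nonneg fun e _ => swapEnergy_nonneg hW e.1 e.2 κ)
    (Finset.sum_nonneg fun S _ => mul_nonneg (hW S) (by positivity))

theorem dirichletForm_mono (h : ∀ S, W S ≤ W' S) (κ : Finset (Site n) → ℝ) :
    dirichletForm n W κ ≤ dirichletForm n W' κ := by
  unfold dirichletForm swapEnergy
  gcongr <;> exact h _

theorem sum_dirichletForm {ι : Type*} (s : Finset ι) (W : ι → Finset (Site n) → ℝ)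
    (κ : Finset (Site n) → ℝ) :
    ∑ i ∈ s, dirichletForm n (W i) κ = dirichletForm n (fun S => ∑ i ∈ s, W i S) κ := by
  simp only [dirichletForm, swapEnergy, Finset.sum_add_distrib, Finset.sum_mul]
  rw [Finset.sum_comm (s := s)]
  simp only [Finset.sum_comm (s := s)]

theorem siteMass_le_of_mem_boundary (hW : ∀ S, 0 ≤ W S) {x : Site n} (hx : x ∈ boundary n)
    (κ : Finset (Site n) → ℝ) :
    siteMass W x κ ≤ ∑ S, W S * (#(S ∩ boundary n) * κ S ^ 2) := by
  rw [siteMass, Finset.sum_filter]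
  refine Finset.sum_le_sum fun S _ => ?_
  have hWS := hW S
  split_ifs with hxS
  · have hcard : (1 : ℝ) ≤ #(S ∩ boundary n) := by
      exact_mod_cast Finset.card_pos.2 ⟨x, Finset.mem_inter.2 ⟨hxS, hx⟩⟩
    exact mul_le_mul_of_nonneg_left (le_mul_of_one_le_left (sq_nonneg _) hcard) hWS
  · positivity

/-- A particle at `x` is carried to the left reservoir by nearest-neighbour moves across the edges
to the left of `x`, so only these moves have to preserve the weights. -/
theorem siteMass_le_dirichletForm (hW : ∀ S, 0 ≤ W S) (x : Site n)
    (hinv : ∀ e ∈ edges n, (e.2 : ℕ) ≤ x → ∀ S, W (swapSet e.1 e.2 S) = W S)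
    (κ : Finset (Site n) → ℝ) :
    siteMass W x κ ≤ n * dirichletForm n W κ := by
  obtain ⟨hx1, hxn⟩ := Finset.mem_Ico.1 x.2
  let path (i : ℕ) : Site n := ⟨min (i + 1) x, Finset.mem_Ico.2 ⟨by omega, by omega⟩⟩
  have hpath {i : ℕ} (hi : i < (x : ℕ)) : (path i : ℕ) = i + 1 := min_eq_left hi
  have hend : path (x - 1) = x :=
    Subtype.ext ((hpath (Nat.sub_lt hx1 one_pos)).trans (Nat.sub_add_cancel hx1))
  have hedge {i : ℕ} (hi : i < (x : ℕ) - 1) : (path i, path (i + 1)) ∈ edges n :=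
    mem_edges.2 (by rw [hpath (by omega), hpath (by omega)])
  have hstart := siteMass_le_of_mem_boundary hW
    (mem_boundary.2 (.inl (hpath (Nat.lt_of_lt_of_le zero_lt_one hx1)))) κ
  have hmoves : ∑ i ∈ Finset.range (x - 1), swapEnergy W (path i) (path (i + 1)) κ
      ≤ ∑ e ∈ edges n, swapEnergy W e.1 e.2 κ :=
    sum_comp_le_sum_of_injOn (i := fun i => (path i, path (i + 1)))
      (f := fun e : Site n × Site n => swapEnergy W e.1 e.2 κ)
      (fun i hi => hedge (by simpa using hi))
      (fun i hi j hj h => by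
        have hij := congrArg (fun e : Site n × Site n => (e.1 : ℕ)) h
        simp only [Finset.coe_range, mem_Iio] at hi hj
        simpa [hpath (show i < (x : ℕ) by omega), hpath (show j < (x : ℕ) by omega)] using hij)
      fun e _ => swapEnergy_nonneg hW e.1 e.2 κ
  have hmass := siteMass_le_of_path hW κ path (x - 1) fun i hi =>
    hinv _ (hedge hi) (by rw [hpath (by omega)]; omega)
  have hlen : (((x : ℕ) - 1 : ℕ) : ℝ) + 1 ≤ n := by exact_mod_cast (by omega : (x : ℕ) - 1 + 1 ≤ n)
  rw [hend] at hmass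
  refine hmass.trans ?_
  rw [dirichletForm, add_comm (∑ e ∈ edges n, _)]
  have hmass0 := siteMass_nonneg hW (path 0) κ
  have hmoves0 := Finset.sum_nonneg fun i (_ : i ∈ Finset.range ((x : ℕ) - 1)) =>
    swapEnergy_nonneg hW (path i) (path (i + 1)) κ
  gcongr

/-- The Poincaré inequality of the dual dynamics. -/
theorem sum_card_mul_sq_le_dirichletForm {w : ℕ → ℝ} (hw : ∀ k, 0 ≤ w k)
    (κ : Finset (Site n) → ℝ) :
    ∑ S, (#S : ℝ) * (w #S * κ S ^ 2) ≤ (n : ℝ) ^ 2 * dirichletForm n (fun S => w #S) κ := by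
  have hD := dirichletForm_nonneg (W := fun S => w #S) (fun S => hw _) κ
  calc ∑ S, (#S : ℝ) * (w #S * κ S ^ 2)
      = ∑ x : Site n, siteMass (fun S => w #S) x κ := (sum_siteMass _ κ).symm
    _ ≤ ∑ _x : Site n, n * dirichletForm n (fun S => w #S) κ :=
        Finset.sum_le_sum fun x _ => siteMass_le_dirichletForm (fun S => hw _) x (by simp) κ
    _ = Fintype.card (Site n) * (n * dirichletForm n (fun S => w #S) κ) := by
        rw [Finset.sum_const, nsmul_eq_mul, Finset.card_univ]
    _ ≤ n * (n * dirichletForm n (fun S => w #S) κ) := by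
        gcongr
        exact_mod_cast card_site_le n
    _ = (n : ℝ) ^ 2 * dirichletForm n (fun S => w #S) κ := by ring

/-- A trace inequality: it gains a factor `n` over the Poincaré inequality because, with the right
particle of the pair kept fixed, only the left one has to be moved to the reservoir. -/
theorem sum_edges_pairMass_le_dirichletForm {w : ℕ → ℝ} (hw : ∀ k, 0 ≤ w k)
    (κ : Finset (Site n) → ℝ) :
    ∑ e ∈ edges n, pairMass (fun S => w #S) e.1 e.2 κ
      ≤ n * dirichletForm n (fun S => #S * w #S) κ := by
  let W (z : Site n) (S : Finset (Site n)) : ℝ := if z ∈ S then w #S else 0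
  have hW (z S) : 0 ≤ W z S := ite_nonneg (hw _) le_rfl
  have hedge (e) (he : e ∈ edges n) :
      pairMass (fun S => w #S) e.1 e.2 κ ≤ n * dirichletForm n (W e.2) κ := by
    rw [pairMass_eq_siteMass]
    refine siteMass_le_dirichletForm (hW e.2) e.1 (fun e' he' hle S => ?_) κ
    have hee := mem_edges.1 he
    have hee' := mem_edges.1 he'
    have hne {z : Site n} (hz : (z : ℕ) ≤ e.1) : e.2 ≠ z := fun h => by rw [h] at hee; omega
    simp only [W, mem_swapSet_of_ne (hne (z := e'.1) (by omega)) (hne hle), card_swapSet]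
  calc _ ≤ ∑ e ∈ edges n, n * dirichletForm n (W e.2) κ := Finset.sum_le_sum hedge
    _ = n * ∑ e ∈ edges n, dirichletForm n (W e.2) κ := (Finset.mul_sum _ _ _).symm
    _ ≤ n * ∑ z, dirichletForm n (W z) κ := by
        gcongr
        exact sum_edges_le_sum_site fun z => dirichletForm_nonneg (hW z) κ
    _ = n * dirichletForm n (fun S => #S * w #S) κ := by
        simp only [sum_dirichletForm, W, card_mul_eq_sum]

theorem sum_edges_pairMass_le_sum_card (hW : ∀ S, 0 ≤ W S) (κ : Finset (Site n) → ℝ) :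
    ∑ e ∈ edges n, pairMass W e.1 e.2 κ ≤ ∑ S, (#S : ℝ) * (W S * κ S ^ 2) :=
  calc _ ≤ ∑ e ∈ edges n, siteMass W e.2 κ :=
        Finset.sum_le_sum fun e _ => pairMass_le_siteMass hW e.1 e.2 κ
    _ ≤ ∑ x, siteMass W x κ := sum_edges_le_sum_site fun x => siteMass_nonneg hW x κ
    _ = ∑ S, (#S : ℝ) * (W S * κ S ^ 2) := sum_siteMass W κ

end Dual

section CorrelationDrift

/-- The contribution of the edge `{x, y}` to the time derivative of the correlation functions `κ` of
the exclusion process, where `g` is the gradient across the edge of the profile at which the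
occupation numbers are centred. -/
noncomputable def edgeDrift {V : Type*} [DecidableEq V] (g : ℝ) (κ : Finset V → ℝ) (x y : V)
    (S : Finset V) : ℝ :=
  κ (swapSet x y S) - κ S - if x ∈ S ∧ y ∈ S then
    g ^ 2 * κ ((S.erase x).erase y) + 2 * g * (κ (S.erase x) - κ (S.erase y)) else 0

/-- The time derivative of the correlation functions `κ` of the exclusion process, centred at a
solution of the discrete heat equation with gradient `g e` across the edge `e`. -/
noncomputable def correlationDrift (n : ℕ) (g : Site n × Site n → ℝ) (κ : Finset (Site n) → ℝ)
    (S : Finset (Site n)) : ℝ :=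
  (n : ℝ) ^ 2 * (∑ e ∈ edges n, edgeDrift (g e) κ e.1 e.2 S - #(S ∩ boundary n) * κ S)

theorem neg_two_mul_source_le {a c k A : ℝ} (ha : 0 < a) (hc : 0 < c) (hk : 0 < k) (hA : 0 ≤ A)
    (g p q d : ℝ) :
    -2 * (A * p * (g ^ 2 * q + 2 * g * d))
      ≤ 1 / (4 * a) * (A * d ^ 2)
        + g ^ 2 * (16 * a * (A * p ^ 2) + c * (A / k * p ^ 2) + 1 / c * (k * A * q ^ 2)) := by
  have hsquares : 1 / (4 * a) * (A * d ^ 2)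
        + g ^ 2 * (16 * a * (A * p ^ 2) + c * (A / k * p ^ 2) + 1 / c * (k * A * q ^ 2))
        - -2 * (A * p * (g ^ 2 * q + 2 * g * d))
      = A / (4 * a) * (d + 8 * a * g * p) ^ 2 + A * g ^ 2 * (c / k) * (p + k / c * q) ^ 2 := by
    field
  have : 0 ≤ A / (4 * a) * (d + 8 * a * g * p) ^ 2
      + A * g ^ 2 * (c / k) * (p + k / c * q) ^ 2 := by positivity
  linarith

variable {V : Type*} [Fintype V] [DecidableEq V]

theorem neg_two_mul_sum_source_le {x y : V} (hxy : x ≠ y) {a c : ℝ} (ha : 0 < a) (hc : 0 < c)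
    (g : ℝ) (κ : Finset V → ℝ) :
    -2 * ∑ S : Finset V with x ∈ S ∧ y ∈ S, a ^ #S * κ S
        * (g ^ 2 * κ ((S.erase x).erase y) + 2 * g * (κ (S.erase x) - κ (S.erase y)))
      ≤ 1 / 4 * swapEnergy (fun S => a ^ #S) x y κ
        + g ^ 2 * (16 * a * pairMass (fun S => a ^ #S) x y κ
          + c * pairMass (fun S => a ^ #S / #S) x y κ
          + a ^ 2 / c * (cardEnergy a κ + 2 * energy a κ)) := by
  calc _ ≤ ∑ S : Finset V with x ∈ S ∧ y ∈ S,
          (1 / (4 * a) * (a ^ #S * (κ (S.erase x) - κ (S.erase y)) ^ 2)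
          + g ^ 2 * (16 * a * (a ^ #S * κ S ^ 2) + c * (a ^ #S / #S * κ S ^ 2)
            + 1 / c * (#S * a ^ #S * κ ((S.erase x).erase y) ^ 2))) := by
        rw [Finset.mul_sum]
        refine Finset.sum_le_sum fun S hS => neg_two_mul_source_le ha hc ?_ (by positivity) _ _ _ _
        exact_mod_cast Finset.card_pos.2 ⟨x, (Finset.mem_filter.1 hS).2.1⟩
    _ = 1 / (4 * a) * ∑ S : Finset V with x ∈ S ∧ y ∈ S,
            a ^ #S * (κ (S.erase x) - κ (S.erase y)) ^ 2
          + g ^ 2 * (16 * a * pairMass (fun S => a ^ #S) x y κ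
            + c * pairMass (fun S => a ^ #S / #S) x y κ
            + 1 / c * ∑ S : Finset V with x ∈ S ∧ y ∈ S,
              #S * a ^ #S * κ ((S.erase x).erase y) ^ 2) := by
        simp only [pairMass, mul_add, Finset.sum_add_distrib, Finset.mul_sum]
    _ ≤ 1 / (4 * a) * (a * swapEnergy (fun S => a ^ #S) x y κ)
          + g ^ 2 * (16 * a * pairMass (fun S => a ^ #S) x y κ
            + c * pairMass (fun S => a ^ #S / #S) x y κ
            + 1 / c * (a ^ 2 * (cardEnergy a κ + 2 * energy a κ))) := by
        gcongr
        · exact sum_pair_erase_sub_erase_sq_le hxy ha.le κ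
        · exact sum_pair_erase_erase_sq_le hxy ha.le κ
    _ = _ := by field

theorem two_mul_sum_mul_edgeDrift_le {x y : V} (hxy : x ≠ y) {a c : ℝ} (ha : 0 < a) (hc : 0 < c)
    (g : ℝ) (κ : Finset V → ℝ) :
    2 * ∑ S, a ^ #S * κ S * edgeDrift g κ x y S
      ≤ -(3 / 4) * swapEnergy (fun S => a ^ #S) x y κ
        + g ^ 2 * (16 * a * pairMass (fun S => a ^ #S) x y κ
          + c * pairMass (fun S => a ^ #S / #S) x y κ
          + a ^ 2 / c * (cardEnergy a κ + 2 * energy a κ)) := by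
  have hsplit : ∑ S, a ^ #S * κ S * edgeDrift g κ x y S
      = ∑ S, a ^ #S * κ S * (κ (swapSet x y S) - κ S)
        - ∑ S : Finset V with x ∈ S ∧ y ∈ S, a ^ #S * κ S
          * (g ^ 2 * κ ((S.erase x).erase y) + 2 * g * (κ (S.erase x) - κ (S.erase y))) := by
    rw [Finset.sum_filter, ← Finset.sum_sub_distrib]
    refine Finset.sum_congr rfl fun S _ => ?_
    rw [edgeDrift]
    split_ifs <;> ring
  have hexchange := sum_mul_swapSet_sub (W := fun S => a ^ #S) (x := x) (y := y) (κ := κ) (by simp)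
  have hsource := neg_two_mul_sum_source_le hxy ha hc g κ
  rw [hsplit]
  linarith

variable {n : ℕ}

theorem two_mul_sum_mul_correlationDrift (a : ℝ) (g : Site n × Site n → ℝ)
    (κ : Finset (Site n) → ℝ) :
    2 * ∑ S, a ^ #S * κ S * correlationDrift n g κ S
      = n ^ 2 * (2 * ∑ e ∈ edges n, ∑ S, a ^ #S * κ S * edgeDrift (g e) κ e.1 e.2 S)
        - 2 * n ^ 2 * ∑ S, a ^ #S * (#(S ∩ boundary n) * κ S ^ 2) := by
  simp only [Finset.mul_sum]
  rw [Finset.sum_comm, ← Finset.sum_sub_distrib]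
  refine Finset.sum_congr rfl fun S _ => ?_
  rw [correlationDrift, mul_sub, Finset.mul_sum, mul_sub, mul_sub, Finset.mul_sum, Finset.mul_sum]
  congr 1
  · exact Finset.sum_congr rfl fun e _ => by ring
  · ring

theorem sum_edges_pairMass_div_card_le {a : ℝ} (ha : 0 ≤ a) (κ : Finset (Site n) → ℝ) :
    ∑ e ∈ edges n, pairMass (fun S => a ^ #S / #S) e.1 e.2 κ
      ≤ n * dirichletForm n (fun S => a ^ #S) κ := by
  refine (sum_edges_pairMass_le_dirichletForm (w := fun k => a ^ k / k)
    (fun k => by positivity) κ).trans ?_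
  gcongr
  refine dirichletForm_mono (fun S => ?_) κ
  rcases eq_or_ne (#S : ℝ) 0 with h | h
  · rw [h, zero_mul]; positivity
  · rw [mul_div_cancel₀ _ h]

theorem sum_edges_source_le {a c M : ℝ} (ha : 0 ≤ a) (hc : 0 ≤ c) (hM : 0 ≤ M)
    (κ : Finset (Site n) → ℝ) :
    ∑ e ∈ edges n, (16 * a * pairMass (fun S => a ^ #S) e.1 e.2 κ
        + c * pairMass (fun S => a ^ #S / #S) e.1 e.2 κ + M)
      ≤ 16 * a * cardEnergy a κ + c * (n * dirichletForm n (fun S => a ^ #S) κ) + n * M := by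
  rw [Finset.sum_add_distrib, Finset.sum_add_distrib, ← Finset.mul_sum, ← Finset.mul_sum,
    Finset.sum_const, nsmul_eq_mul]
  gcongr
  · exact sum_edges_pairMass_le_sum_card (fun S => by positivity) κ
  · exact sum_edges_pairMass_div_card_le ha κ
  · exact card_edges_le n

theorem sq_mul_two_mul_sum_mul_edgeDrift_le {a c G γ : ℝ} (ha : 0 < a) (hc : 0 < c)
    (hγ : (n : ℝ) ^ 2 * γ ^ 2 ≤ G) {e : Site n × Site n} (he : e ∈ edges n)
    (κ : Finset (Site n) → ℝ) :
    (n : ℝ) ^ 2 * (2 * ∑ S, a ^ #S * κ S * edgeDrift γ κ e.1 e.2 S)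
      ≤ -(3 / 4) * n ^ 2 * swapEnergy (fun S => a ^ #S) e.1 e.2 κ
        + G * (16 * a * pairMass (fun S => a ^ #S) e.1 e.2 κ
          + c * pairMass (fun S => a ^ #S / #S) e.1 e.2 κ
          + a ^ 2 / c * (cardEnergy a κ + 2 * energy a κ)) := by
  have hpair := pairMass_nonneg (W := fun S => a ^ #S) (fun S => by positivity) e.1 e.2 κ
  have hpair' := pairMass_nonneg (W := fun S => a ^ #S / #S) (fun S => by positivity) e.1 e.2 κ
  have hcard := cardEnergy_nonneg ha.le κ
  have henergy := energy_nonneg ha.le κ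
  have hdrift := mul_le_mul_of_nonneg_left
    (two_mul_sum_mul_edgeDrift_le (ne_of_mem_edges he) ha hc γ κ) (sq_nonneg (n : ℝ))
  have hsource := mul_le_mul_of_nonneg_right hγ
    (by positivity : 0 ≤ 16 * a * pairMass (fun S => a ^ #S) e.1 e.2 κ
      + c * pairMass (fun S => a ^ #S / #S) e.1 e.2 κ
      + a ^ 2 / c * (cardEnergy a κ + 2 * energy a κ))
  linarith

/-- Young's inequality is used with `c = ν * n` on each edge: summed over the edges, the `c`-term is
of the order of the Dirichlet form by the trace inequality. -/
theorem two_mul_sum_mul_correlationDrift_le_dirichletForm (hn : 0 < n) {a ν G : ℝ} (ha : 0 < a)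
    (hν : 0 < ν) (hG : 0 ≤ G) {g : Site n × Site n → ℝ}
    (hg : ∀ e ∈ edges n, (n : ℝ) ^ 2 * g e ^ 2 ≤ G) (κ : Finset (Site n) → ℝ) :
    2 * ∑ S, a ^ #S * κ S * correlationDrift n g κ S
      ≤ (-(3 / 4) + ν * G) * (n ^ 2 * dirichletForm n (fun S => a ^ #S) κ)
        + 16 * a * G * cardEnergy a κ + a ^ 2 * G / ν * (cardEnergy a κ + 2 * energy a κ) := by
  have hn' : (0 : ℝ) < n := by exact_mod_cast hn
  have hE : 0 ≤ cardEnergy a κ + 2 * energy a κ :=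
    add_nonneg (cardEnergy_nonneg ha.le κ) (mul_nonneg zero_le_two (energy_nonneg ha.le κ))
  have hedges := Finset.sum_le_sum fun e he =>
    sq_mul_two_mul_sum_mul_edgeDrift_le ha (mul_pos hν hn') (hg e he) he κ
  rw [Finset.sum_add_distrib, ← Finset.mul_sum, ← Finset.mul_sum, ← Finset.mul_sum,
    ← Finset.mul_sum] at hedges
  have hsource := mul_le_mul_of_nonneg_left (sum_edges_source_le ha.le (mul_pos hν hn').le
    (mul_nonneg (by positivity : 0 ≤ a ^ 2 / (ν * n)) hE) κ) hG
  have hcancel : (n : ℝ) * (a ^ 2 / (ν * n) * (cardEnergy a κ + 2 * energy a κ))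
      = a ^ 2 / ν * (cardEnergy a κ + 2 * energy a κ) := by field
  have hkill : 0 ≤ (n : ℝ) ^ 2 * ∑ S, a ^ #S * (#(S ∩ boundary n) * κ S ^ 2) :=
    mul_nonneg (sq_nonneg _) (Finset.sum_nonneg fun S _ => by positivity)
  have hform : dirichletForm n (fun S => a ^ #S) κ = ∑ e ∈ edges n,
    swapEnergy (fun S => a ^ #S) e.1 e.2 κ + ∑ S, a ^ #S * (#(S ∩ boundary n) * κ S ^ 2) := rfl
  rw [hcancel] at hsource
  rw [two_mul_sum_mul_correlationDrift]
  linear_combination hedges + hsource + 5 / 4 * hkill + 3 / 4 * (n : ℝ) ^ 2 * hform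

theorem two_mul_sum_mul_correlationDrift_le (hn : 0 < n) {a ν G : ℝ} (ha : 0 < a) (hν : 0 < ν)
    (hG : 0 ≤ G) (hνG : ν * G ≤ 1 / 4) {g : Site n × Site n → ℝ}
    (hg : ∀ e ∈ edges n, (n : ℝ) ^ 2 * g e ^ 2 ≤ G) (κ : Finset (Site n) → ℝ) :
    2 * ∑ S, a ^ #S * κ S * correlationDrift n g κ S
      ≤ (-(1 / 2) + 16 * a * G + 3 * a ^ 2 * G / ν) * cardEnergy a κ
        + 2 * a ^ 2 * G / ν * κ ∅ ^ 2 := by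
  have hbound := two_mul_sum_mul_correlationDrift_le_dirichletForm hn ha hν hG hg κ
  have hpoincare : cardEnergy a κ ≤ n ^ 2 * dirichletForm n (fun S => a ^ #S) κ :=
    sum_card_mul_sq_le_dirichletForm (fun k => by positivity) κ
  have hdissip : (-(3 / 4) + ν * G) * (n ^ 2 * dirichletForm n (fun S => a ^ #S) κ)
      ≤ -(1 / 2) * cardEnergy a κ := by
    nlinarith [cardEnergy_nonneg ha.le κ]
  have henergy := mul_le_mul_of_nonneg_left (energy_le_cardEnergy_add ha.le κ)
    (by positivity : 0 ≤ 2 * (a ^ 2 * G / ν))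
  linear_combination hbound + hdissip + henergy

end CorrelationDrift

/-! ### Decay of correlations -/

section Decay

theorem le_add_of_hasDerivAt_le_exp {F F' : ℝ → ℝ} {c : ℝ} (hc : 0 < c)
    (hF : ∀ s, HasDerivAt F (F' s) s) (hF' : ∀ s, 0 ≤ s → F' s ≤ Real.exp (-c * s)) {t : ℝ}
    (ht : 0 ≤ t) : F t ≤ F 0 + 1 / c := by
  have hH (s : ℝ) : HasDerivAt (fun s => F s + 1 / c * Real.exp (-c * s))
      (F' s - Real.exp (-c * s)) s := by
    refine ((hF s).add (((hasDerivAt_id s).const_mul (-c)).exp.const_mul (1 / c))).congr_deriv ?_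
    simp only [id]
    field
  have hanti : AntitoneOn (fun s => F s + 1 / c * Real.exp (-c * s)) (Ici 0) := by
    refine antitoneOn_of_deriv_nonpos (convex_Ici 0)
      (fun s _ => (hH s).continuousAt.continuousWithinAt)
      (fun s _ => (hH s).differentiableAt.differentiableWithinAt) fun s hs => ?_
    rw [(hH s).deriv, sub_nonpos]
    exact hF' s (interior_subset hs)
  have hle := hanti self_mem_Ici (mem_Ici.2 ht) ht
  have hpos : 0 ≤ 1 / c * Real.exp (-c * t) := by positivity
  simp only [mul_zero, Real.exp_zero, mul_one] at hle
  linarith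

theorem hasDerivAt_energy {V : Type*} [Fintype V] {a : ℝ → ℝ} {κ : ℝ → Finset V → ℝ}
    {κ' : Finset V → ℝ} {c s : ℝ} (ha : HasDerivAt a (c * a s) s)
    (hκ : ∀ S, HasDerivAt (fun r => κ r S) (κ' S) s) :
    HasDerivAt (fun r => energy (a r) (κ r))
      (c * cardEnergy (a s) (κ s) + 2 * ∑ S, a s ^ #S * κ s S * κ' S) s := by
  refine (HasDerivAt.fun_sum fun S _ => (ha.fun_pow #S).fun_mul ((hκ S).fun_pow 2)).congr_deriv ?_
  rw [cardEnergy, Finset.mul_sum, Finset.mul_sum, ← Finset.sum_add_distrib]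
  refine Finset.sum_congr rfl fun S _ => ?_
  rcases #S with _ | k
  · simp; ring
  · rw [Nat.add_sub_cancel, pow_succ]
    push_cast
    ring

/-- The weight per particle with which the energy of the correlation functions stays bounded up to
time `t` if the squared rescaled gradients of the profile are at most `G * exp (-t)`. -/
noncomputable def correlationWeight (G t : ℝ) : ℝ := Real.exp (t / 8) / (128 * G)

theorem correlationWeight_pos {G : ℝ} (hG : 0 < G) (t : ℝ) : 0 < correlationWeight G t := by
  unfold correlationWeight
  positivity

theorem hasDerivAt_correlationWeight (G t : ℝ) :
    HasDerivAt (correlationWeight G) (1 / 8 * correlationWeight G t) t := by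
  refine (((hasDerivAt_id t).div_const 8).exp.div_const (128 * G)).congr_deriv ?_
  simp only [correlationWeight, id]
  ring

variable {n : ℕ} {G : ℝ}

theorem correlationDrift_empty (g : Site n × Site n → ℝ) (κ : Finset (Site n) → ℝ) :
    correlationDrift n g κ ∅ = 0 := by
  simp [correlationDrift, edgeDrift, swapSet]

theorem energy_drift_le_exp (hn : 0 < n) (hG : 0 < G) {s : ℝ} (hs : 0 ≤ s)
    {g : Site n × Site n → ℝ} (hg : ∀ e ∈ edges n, (n : ℝ) ^ 2 * g e ^ 2 ≤ G * Real.exp (-s))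
    {κ : Finset (Site n) → ℝ} (hκ : κ ∅ = 1) :
    1 / 8 * cardEnergy (correlationWeight G s) κ
        + 2 * ∑ S, correlationWeight G s ^ #S * κ S * correlationDrift n g κ S
      ≤ Real.exp (-(3 / 4) * s) := by
  have hexp {c : ℝ} (hc : c ≤ 0) : Real.exp (c * s) ≤ 1 :=
    Real.exp_le_one_iff.2 (mul_nonpos_of_nonpos_of_nonneg hc hs)
  have hνG : 1 / (4 * G) * (G * Real.exp (-s)) ≤ 1 / 4 := by
    have hcancel : 1 / (4 * G) * (G * Real.exp (-s)) = Real.exp (-1 * s) / 4 := by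
      rw [neg_one_mul]; field
    linarith [hexp (c := -1) (by norm_num)]
  have hdrift := two_mul_sum_mul_correlationDrift_le hn (correlationWeight_pos hG s)
    (by positivity : 0 < 1 / (4 * G)) (by positivity) hνG hg κ
  have hlin : 16 * correlationWeight G s * (G * Real.exp (-s)) = Real.exp (-(7 / 8) * s) / 8 := by
    rw [show -(7 / 8) * s = s / 8 + -s by ring, Real.exp_add, correlationWeight]
    field
  have hquad : correlationWeight G s ^ 2 * (G * Real.exp (-s)) / (1 / (4 * G))
      = Real.exp (-(3 / 4) * s) / 4096 := by
    rw [show -(3 / 4) * s = s / 8 + s / 8 + -s by ring, Real.exp_add, Real.exp_add,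
      correlationWeight]
    field
  have hcard := cardEnergy_nonneg (correlationWeight_pos hG s).le κ
  have hdissip : (-(1 / 2) + Real.exp (-(7 / 8) * s) / 8 + 3 * (Real.exp (-(3 / 4) * s) / 4096))
      * cardEnergy (correlationWeight G s) κ ≤ -(1 / 8) * cardEnergy (correlationWeight G s) κ := by
    gcongr
    linarith [hexp (c := -(7 / 8)) (by norm_num), hexp (c := -(3 / 4)) (by norm_num)]
  rw [hlin, mul_assoc 3, mul_div_assoc (3 : ℝ), mul_assoc 2, mul_div_assoc (2 : ℝ), hquad,
    hκ] at hdrift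
  linarith [Real.exp_pos (-(3 / 4) * s)]

variable {g : ℝ → Site n × Site n → ℝ} {κ : ℝ → Finset (Site n) → ℝ}

theorem apply_empty_eq_one (hκ : ∀ s S, HasDerivAt (fun r => κ r S)
      (correlationDrift n (g s) (κ s) S) s)
    (hκ₀ : ∀ S, κ 0 S = if S = ∅ then 1 else 0) (t : ℝ) : κ t ∅ = 1 := by
  have hderiv (s : ℝ) : HasDerivAt (fun r => κ r ∅) 0 s :=
    correlationDrift_empty (g s) (κ s) ▸ hκ s ∅
  rw [is_const_of_deriv_eq_zero (fun s => (hderiv s).differentiableAt)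
    (fun s => (hderiv s).deriv) t 0, hκ₀, if_pos rfl]

theorem energy_correlationWeight_le (hn : 0 < n) (hG : 0 < G)
    (hg : ∀ s, 0 ≤ s → ∀ e ∈ edges n, (n : ℝ) ^ 2 * g s e ^ 2 ≤ G * Real.exp (-s))
    (hκ : ∀ s S, HasDerivAt (fun r => κ r S) (correlationDrift n (g s) (κ s) S) s)
    (hκ₀ : ∀ S, κ 0 S = if S = ∅ then 1 else 0) {t : ℝ} (ht : 0 ≤ t) :
    energy (correlationWeight G t) (κ t) ≤ 3 := by
  have hinit : energy (correlationWeight G 0) (κ 0) = 1 := by simp [energy, hκ₀]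
  have hle := le_add_of_hasDerivAt_le_exp (by norm_num : (0 : ℝ) < 3 / 4)
    (fun s => hasDerivAt_energy (hasDerivAt_correlationWeight G s) (hκ s))
    (fun s hs => energy_drift_le_exp hn hG hs (hg s hs) (apply_empty_eq_one hκ hκ₀ s)) ht
  rw [hinit] at hle
  linarith

theorem sum_erase_empty_pow_mul_sq_le {V : Type*} [Fintype V] [DecidableEq V] {A a : ℝ}
    (hA : 0 ≤ A) (ha : 0 < a) (hAa : A ≤ a) (κ : Finset V → ℝ) :
    ∑ S ∈ Finset.univ.erase ∅, A ^ #S * κ S ^ 2 ≤ A / a * energy a κ := by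
  have hpow {k : ℕ} (hk : k ≠ 0) : A ^ k ≤ A / a * a ^ k := by
    obtain ⟨k, rfl⟩ := Nat.exists_eq_succ_of_ne_zero hk
    calc A ^ (k + 1) = A ^ k * A := pow_succ A k
      _ ≤ a ^ k * A := by gcongr
      _ = A / a * a ^ (k + 1) := by field
  calc ∑ S ∈ Finset.univ.erase ∅, A ^ #S * κ S ^ 2
      ≤ ∑ S ∈ Finset.univ.erase ∅, A / a * (a ^ #S * κ S ^ 2) := by
        refine Finset.sum_le_sum fun S hS => ?_
        rw [← mul_assoc]
        gcongr
        exact hpow (Finset.card_ne_zero_of_mem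
          (Finset.nonempty_iff_ne_empty.2 (Finset.ne_of_mem_erase hS)).choose_spec)
    _ ≤ ∑ S, A / a * (a ^ #S * κ S ^ 2) :=
        Finset.sum_le_sum_of_subset_of_nonneg (Finset.erase_subset _ _)
          fun S _ _ => by positivity
    _ = A / a * energy a κ := (Finset.mul_sum _ _ _).symm

theorem sum_erase_empty_pow_mul_sq_le_exp (hn : 0 < n) (hG : 0 < G) {A : ℝ} (hA : 0 ≤ A)
    (hg : ∀ s, 0 ≤ s → ∀ e ∈ edges n, (n : ℝ) ^ 2 * g s e ^ 2 ≤ G * Real.exp (-s))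
    (hκ : ∀ s S, HasDerivAt (fun r => κ r S) (correlationDrift n (g s) (κ s) S) s)
    (hκ₀ : ∀ S, κ 0 S = if S = ∅ then 1 else 0) {t : ℝ} (ht : 0 ≤ t)
    (hAt : A ≤ correlationWeight G t) :
    ∑ S ∈ Finset.univ.erase ∅, A ^ #S * κ t S ^ 2 ≤ 384 * G * A * Real.exp (-(t / 8)) := by
  have ha := correlationWeight_pos hG t
  calc _ ≤ A / correlationWeight G t * energy (correlationWeight G t) (κ t) :=
        sum_erase_empty_pow_mul_sq_le hA ha hAt (κ t)
    _ ≤ A / correlationWeight G t * 3 := by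
        gcongr
        exact energy_correlationWeight_le hn hG hg hκ hκ₀ ht
    _ = 384 * G * A * Real.exp (-(t / 8)) := by
        rw [correlationWeight, Real.exp_neg]
        field

end Decay

/-! ### The hierarchy of correlation functions -/

section CorrelationEquation

variable {n : ℕ}

/-- The right-hand side `n² Δ u` of the discrete heat equation on `Λ_n` with reservoirs of density
`ρ`, written as the divergence of the currents through the edges and through the boundary. -/
noncomputable def heatDrift (n : ℕ) (ρ : ℝ) (u : Site n → ℝ) (x : Site n) : ℝ :=
  (n : ℝ) ^ 2 * (∑ e ∈ edges n, (u e.2 - u e.1) * ((if e.1 = x then 1 else 0)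
    - if e.2 = x then 1 else 0) + if x ∈ boundary n then ρ - u x else 0)

/-- The rate, up to the factor `n²`, at which a reservoir of density `ρ` flips the site `x`. -/
noncomputable def flipRate (ρ : ℝ) (η : Config n) (x : Site n) : ℝ :=
  ρ * (1 - occ η x) + (1 - ρ) * occ η x

theorem occ_exchange (x y z : Site n) (η : Config n) :
    occ (exchange x y η) z = occ η (Equiv.swap x y z) := rfl

theorem occ_flip_self (x : Site n) (η : Config n) : occ (flip x η) x = 1 - occ η x := by
  rw [occ, occ, flip, Function.update_self]
  cases η x <;> simp

theorem occ_flip_of_ne {x z : Site n} (h : z ≠ x) (η : Config n) :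
    occ (flip x η) z = occ η z := by
  rw [occ, occ, flip, Function.update_of_ne h]

theorem occ_mul_self (η : Config n) (x : Site n) : occ η x * occ η x = occ η x := by
  unfold occ
  split_ifs <;> simp

theorem monomial_insert (u : Site n → ℝ) {S : Finset (Site n)} {x : Site n} (h : x ∉ S)
    (η : Config n) : monomial u (insert x S) η = (occ η x - u x) * monomial u S η :=
  Finset.prod_insert h

theorem monomial_exchange_of_notMem (u : Site n → ℝ) {S : Finset (Site n)} {x y : Site n}
    (hx : x ∉ S) (hy : y ∉ S) (η : Config n) :
    monomial u S (exchange x y η) = monomial u S η := by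
  refine Finset.prod_congr rfl fun z hz => ?_
  rw [occ_exchange, Equiv.swap_apply_of_ne_of_ne (ne_of_mem_of_not_mem hz hx)
    (ne_of_mem_of_not_mem hz hy)]

theorem monomial_flip_of_notMem (u : Site n → ℝ) {S : Finset (Site n)} {x : Site n} (hx : x ∉ S)
    (η : Config n) : monomial u S (flip x η) = monomial u S η :=
  Finset.prod_congr rfl fun z hz => by rw [occ_flip_of_ne (ne_of_mem_of_not_mem hz hx)]

theorem monomial_exchange_sub_of_mem_of_mem (u : Site n → ℝ) {S : Finset (Site n)} {x y : Site n}
    (hxy : x ≠ y) (hx : x ∈ S) (hy : y ∈ S) (η : Config n) :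
    monomial u S (exchange x y η) - monomial u S η
      = -((u y - u x) ^ 2 * monomial u ((S.erase x).erase y) η
        + (u y - u x) * (monomial u (S.erase x) η - monomial u (S.erase y) η)) := by
  obtain ⟨R, hxR, hyR, rfl⟩ : ∃ R, x ∉ R ∧ y ∉ R ∧ S = insert x (insert y R) :=
    ⟨(S.erase x).erase y, by simp, by simp,
      by rw [Finset.insert_erase (Finset.mem_erase.2 ⟨hxy.symm, hy⟩), Finset.insert_erase hx]⟩
  have hxR' : x ∉ insert y R := by simp [hxy, hxR]
  have hyR' : y ∉ insert x R := by simp [hxy.symm, hyR]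
  rw [Finset.erase_insert hxR', Finset.erase_insert hyR, Finset.insert_comm,
    Finset.erase_insert hyR', monomial_insert u hyR', monomial_insert u hyR',
    monomial_insert u hxR, monomial_insert u hxR, monomial_insert u hyR,
    monomial_exchange_of_notMem u hxR hyR, occ_exchange, occ_exchange, Equiv.swap_apply_left,
    Equiv.swap_apply_right]
  ring

theorem monomial_exchange_sub_of_mem_of_notMem (u : Site n → ℝ) {S : Finset (Site n)}
    {x y : Site n} (hx : x ∈ S) (hy : y ∉ S) (η : Config n) :
    monomial u S (exchange x y η) - monomial u S η
      = monomial u (swapSet x y S) η - monomial u S η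
        + (u y - u x) * monomial u (S.erase x) η := by
  obtain ⟨T, hxT, rfl⟩ : ∃ T, x ∉ T ∧ S = insert x T :=
    ⟨S.erase x, Finset.notMem_erase x S, (Finset.insert_erase hx).symm⟩
  have hyT : y ∉ T := fun h => hy (Finset.mem_insert_of_mem h)
  have hswap : swapSet x y (insert x T) = insert y T := by
    have hT : swapSet x y T = T := swapSet_eq_self (iff_of_false hxT hyT)
    rw [swapSet, Finset.map_insert, ← swapSet, hT, Equiv.coe_toEmbedding, Equiv.swap_apply_left]
  rw [hswap, Finset.erase_insert hxT, monomial_insert u hxT, monomial_insert u hxT,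
    monomial_insert u hyT, monomial_exchange_of_notMem u hxT hyT, occ_exchange,
    Equiv.swap_apply_left]
  ring

theorem exchange_comm (x y : Site n) (η : Config n) : exchange x y η = exchange y x η := by
  unfold exchange
  rw [Equiv.swap_comm]

theorem monomial_exchange_sub (u : Site n → ℝ) (S : Finset (Site n)) {x y : Site n} (hxy : x ≠ y)
    (η : Config n) :
    monomial u S (exchange x y η) - monomial u S η
      = edgeDrift (u y - u x) (fun T => monomial u T η) x y S
        + (u y - u x) * ((if x ∈ S then monomial u (S.erase x) η else 0)
          - if y ∈ S then monomial u (S.erase y) η else 0) := by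
  unfold edgeDrift
  by_cases hx : x ∈ S <;> by_cases hy : y ∈ S
  · rw [monomial_exchange_sub_of_mem_of_mem u hxy hx hy, swapSet_eq_self (iff_of_true hx hy),
      if_pos ⟨hx, hy⟩, if_pos hx, if_pos hy]
    ring
  · rw [monomial_exchange_sub_of_mem_of_notMem u hx hy, if_neg fun h => hy h.2, if_pos hx,
      if_neg hy]
    ring
  · rw [exchange_comm, monomial_exchange_sub_of_mem_of_notMem u hy hx, if_neg fun h => hx h.1,
      if_neg hx, if_pos hy, swapSet, swapSet, Equiv.swap_comm]
    ring
  · rw [monomial_exchange_of_notMem u hx hy, swapSet_eq_self (iff_of_false hx hy),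
      if_neg fun h => hy h.2, if_neg hx, if_neg hy]
    ring

theorem flipRate_mul_monomial_flip_sub (ρ : ℝ) (u : Site n → ℝ) (S : Finset (Site n)) (x : Site n)
    (η : Config n) :
    flipRate ρ η x * (monomial u S (flip x η) - monomial u S η)
      = if x ∈ S then (ρ - u x) * monomial u (S.erase x) η - monomial u S η else 0 := by
  split_ifs with hx
  · obtain ⟨T, hxT, rfl⟩ : ∃ T, x ∉ T ∧ S = insert x T :=
      ⟨S.erase x, Finset.notMem_erase x S, (Finset.insert_erase hx).symm⟩
    rw [Finset.erase_insert hxT, monomial_insert u hxT, monomial_insert u hxT,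
      monomial_flip_of_notMem u hxT, occ_flip_self, flipRate]
    linear_combination (4 * ρ - 2) * monomial u T η * occ_mul_self η x
  · rw [monomial_flip_of_notMem u hx, sub_self, mul_zero]

theorem generator_eq (ρ : ℝ) (f : Config n → ℝ) (η : Config n) :
    generator n ρ f η = (n : ℝ) ^ 2 * (∑ e ∈ edges n, (f (exchange e.1 e.2 η) - f η)
      + ∑ x ∈ boundary n, flipRate ρ η x * (f (flip x η) - f η)) := by
  simp only [generator, edges, boundary, flipRate, Finset.sum_filter, Fintype.sum_prod_type,
    mul_add]

theorem sum_heatDrift_mul (ρ : ℝ) (u : Site n → ℝ) (S : Finset (Site n)) (c : Site n → ℝ) :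
    ∑ x ∈ S, heatDrift n ρ u x * c x
      = (n : ℝ) ^ 2 * (∑ e ∈ edges n, (u e.2 - u e.1) * ((if e.1 ∈ S then c e.1 else 0)
          - if e.2 ∈ S then c e.2 else 0)
        + ∑ x ∈ boundary n, if x ∈ S then (ρ - u x) * c x else 0) := by
  simp only [heatDrift, mul_assoc, add_mul, Finset.sum_mul, ← Finset.mul_sum,
    Finset.sum_add_distrib]
  congr 2
  · rw [Finset.sum_comm]
    simp only [← Finset.mul_sum, sub_mul, ite_mul, one_mul, zero_mul, Finset.sum_sub_distrib,
      Finset.sum_ite_eq]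
  · simp only [ite_mul, zero_mul, ← Finset.sum_filter, Finset.filter_mem_eq_inter,
      Finset.inter_comm]

/-- Differentiating the centring `u` along the heat equation cancels the terms of degree
`#S - 1` which the generator produces from the gradient of `u`. -/
theorem generator_monomial_sub (ρ : ℝ) (u : Site n → ℝ) (S : Finset (Site n)) (η : Config n) :
    generator n ρ (monomial u S) η - ∑ x ∈ S, heatDrift n ρ u x * monomial u (S.erase x) η
      = correlationDrift n (fun e => u e.2 - u e.1) (fun T => monomial u T η) S := by
  have hedges : ∑ e ∈ edges n, (monomial u S (exchange e.1 e.2 η) - monomial u S η)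
      = ∑ e ∈ edges n, edgeDrift (u e.2 - u e.1) (fun T => monomial u T η) e.1 e.2 S
        + ∑ e ∈ edges n, (u e.2 - u e.1) * ((if e.1 ∈ S then monomial u (S.erase e.1) η else 0)
          - if e.2 ∈ S then monomial u (S.erase e.2) η else 0) := by
    rw [← Finset.sum_add_distrib]
    exact Finset.sum_congr rfl fun e he => monomial_exchange_sub u S (ne_of_mem_edges he) η
  have hboundary : ∑ x ∈ boundary n, flipRate ρ η x * (monomial u S (flip x η) - monomial u S η)
      = (∑ x ∈ boundary n, if x ∈ S then (ρ - u x) * monomial u (S.erase x) η else 0)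
        - #(S ∩ boundary n) * monomial u S η := by
    simp only [flipRate_mul_monomial_flip_sub, Finset.sum_ite_mem, Finset.sum_sub_distrib,
      Finset.sum_const, nsmul_eq_mul, Finset.inter_comm]
  rw [generator_eq, sum_heatDrift_mul ρ u S fun x => monomial u (S.erase x) η, correlationDrift,
    hedges, hboundary]
  ring

theorem sum_rateMatrix_mul (ρ : ℝ) (f : Config n → ℝ) (η : Config n) :
    ∑ ζ, rateMatrix n ρ η ζ * f ζ = generator n ρ f η := by
  have hdiff (a b : Config n) :
      ∑ ζ, ((Pi.single ζ 1 : Config n → ℝ) a - (Pi.single ζ 1 : Config n → ℝ) b) * f ζ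
        = f a - f b := by
    simp [sub_mul, Finset.sum_sub_distrib, Pi.single_apply]
  simp only [rateMatrix, Matrix.of_apply, generator_eq, mul_assoc, ← Finset.mul_sum, add_mul,
    Finset.sum_add_distrib, Finset.sum_mul]
  congr 2
  · rw [Finset.sum_comm]
    simp only [hdiff]
  · rw [Finset.sum_comm]
    simp only [← Finset.mul_sum, hdiff]

theorem hasDerivAt_transition (ρ t : ℝ) :
    HasDerivAt (fun s => transition n ρ s) (transition n ρ t * rateMatrix n ρ) t := by
  let : NormedRing (Matrix (Config n) (Config n) ℝ) := Matrix.linftyOpNormedRing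
  let : NormedAlgebra ℝ (Matrix (Config n) (Config n) ℝ) := Matrix.linftyOpNormedAlgebra
  exact hasDerivAt_exp_smul_const (rateMatrix n ρ) t

theorem hasDerivAt_lawWeight (ρ : ℝ) (u : Site n → ℝ) (t : ℝ) (ζ : Config n) :
    HasDerivAt (fun s => lawWeight n ρ u s ζ)
      (∑ η, lawWeight n ρ u t η * rateMatrix n ρ η ζ) t := by
  have hentry (η : Config n) : HasDerivAt (fun s => transition n ρ s η ζ)
      ((transition n ρ t * rateMatrix n ρ) η ζ) t :=
    hasDerivAt_pi.1 (hasDerivAt_pi.1 (hasDerivAt_transition ρ t) η) ζ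
  refine (HasDerivAt.fun_sum fun η _ => (hentry η).const_mul (bernoulliWeight u η)).congr_deriv ?_
  simp only [lawWeight, Matrix.mul_apply, Finset.mul_sum, Finset.sum_mul, mul_assoc]
  exact Finset.sum_comm

/-- The correlation functions at time `t` of the process started from the product measure with
density `u₀`, centred at `u`. -/
noncomputable def correlation (n : ℕ) (ρ : ℝ) (u₀ u : Site n → ℝ) (t : ℝ)
    (S : Finset (Site n)) : ℝ :=
  ∑ ζ, lawWeight n ρ u₀ t ζ * monomial u S ζ

theorem hasDerivAt_monomial {u : ℝ → Site n → ℝ} {u' : Site n → ℝ} {t : ℝ}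
    (hu : ∀ x, HasDerivAt (fun s => u s x) (u' x) t) (S : Finset (Site n)) (η : Config n) :
    HasDerivAt (fun s => monomial (u s) S η)
      (-∑ x ∈ S, u' x * monomial (u t) (S.erase x) η) t := by
  refine (HasDerivAt.fun_finsetProd fun x _ => (hu x).const_sub (occ η x)).congr_deriv ?_
  rw [← Finset.sum_neg_distrib]
  refine Finset.sum_congr rfl fun x _ => ?_
  rw [smul_eq_mul, monomial]
  ring

theorem edgeDrift_sum {V ι : Type*} [DecidableEq V] [Fintype ι] (g : ℝ) (w : ι → ℝ)
    (κ : ι → Finset V → ℝ) (x y : V) (S : Finset V) :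
    edgeDrift g (fun T => ∑ i, w i * κ i T) x y S = ∑ i, w i * edgeDrift g (κ i) x y S := by
  unfold edgeDrift
  split_ifs
  · simp only [Finset.mul_sum, ← Finset.sum_sub_distrib, ← Finset.sum_add_distrib]
    exact Finset.sum_congr rfl fun i _ => by ring
  · simp only [sub_zero, ← Finset.sum_sub_distrib, mul_sub]

theorem correlationDrift_sum {ι : Type*} [Fintype ι] (g : Site n × Site n → ℝ) (w : ι → ℝ)
    (κ : ι → Finset (Site n) → ℝ) (S : Finset (Site n)) :
    correlationDrift n g (fun T => ∑ i, w i * κ i T) S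
      = ∑ i, w i * correlationDrift n g (κ i) S := by
  simp only [correlationDrift, edgeDrift_sum]
  rw [Finset.sum_comm, Finset.mul_sum, ← Finset.sum_sub_distrib, Finset.mul_sum]
  refine Finset.sum_congr rfl fun i _ => ?_
  rw [← Finset.mul_sum]
  ring

theorem hasDerivAt_correlation (ρ : ℝ) (u₀ : Site n → ℝ) {u : ℝ → Site n → ℝ} {t : ℝ}
    (hu : ∀ x, HasDerivAt (fun s => u s x) (heatDrift n ρ (u t) x) t) (S : Finset (Site n)) :
    HasDerivAt (fun s => correlation n ρ u₀ (u s) s S)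
      (correlationDrift n (fun e => u t e.2 - u t e.1) (correlation n ρ u₀ (u t) t) S) t := by
  have hdual : ∑ ζ, (∑ η, lawWeight n ρ u₀ t η * rateMatrix n ρ η ζ) * monomial (u t) S ζ
      = ∑ η, lawWeight n ρ u₀ t η * generator n ρ (monomial (u t) S) η := by
    simp only [← sum_rateMatrix_mul, Finset.sum_mul, Finset.mul_sum, mul_assoc]
    exact Finset.sum_comm
  refine (HasDerivAt.fun_sum fun ζ _ =>
    (hasDerivAt_lawWeight ρ u₀ t ζ).mul (hasDerivAt_monomial hu S ζ)).congr_deriv ?_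
  calc ∑ ζ, ((∑ η, lawWeight n ρ u₀ t η * rateMatrix n ρ η ζ) * monomial (u t) S ζ
        + lawWeight n ρ u₀ t ζ * -∑ x ∈ S, heatDrift n ρ (u t) x * monomial (u t) (S.erase x) ζ)
      = ∑ ζ, lawWeight n ρ u₀ t ζ * (generator n ρ (monomial (u t) S) ζ
        - ∑ x ∈ S, heatDrift n ρ (u t) x * monomial (u t) (S.erase x) ζ) := by
        simp only [hdual, mul_sub, mul_neg, Finset.sum_sub_distrib, ← sub_eq_add_neg]
    _ = correlationDrift n (fun e => u t e.2 - u t e.1) (correlation n ρ u₀ (u t) t) S := by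
        simp only [generator_monomial_sub, ← correlationDrift_sum]
        rfl

theorem lawWeight_zero (ρ : ℝ) (u : Site n → ℝ) (ζ : Config n) :
    lawWeight n ρ u 0 ζ = bernoulliWeight u ζ := by
  simp [lawWeight, transition, Matrix.one_apply]

theorem correlation_zero (ρ : ℝ) (u : Site n → ℝ) (S : Finset (Site n)) :
    correlation n ρ u u 0 S = if S = ∅ then 1 else 0 := by
  simp only [correlation, lawWeight_zero, sum_bernoulliWeight_mul_monomial]

end CorrelationEquation

/-! ### The discrete heat equation -/

/-- The eigenvalues of `-n² Δ`, where `Δ` is the discrete Laplacian on `{1, …, n-1}` with Dirichlet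
boundary conditions. -/
noncomputable def heatEigenvalue (n ℓ : ℕ) : ℝ :=
  4 * (n : ℝ) ^ 2 * Real.sin (Real.pi * ℓ / (2 * n)) ^ 2

/-- The discrete counterpart of `fourierCoeff`: the sine coefficients of `f` sampled at `y / n`. -/
noncomputable def sineCoeff (n : ℕ) (f : ℝ → ℝ) (ℓ : ℕ) : ℝ :=
  √2 / n * ∑ y ∈ Finset.range n, f (y / n) * Real.sin (Real.pi * ℓ * y / n)

/-- The solution of the discrete heat equation on `{1, …, n-1}` with zero boundary values and
initial values `f (x / n)`. Allowing `x` to be real makes the odd reflections at `0` and `n`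
available. -/
noncomputable def heatSolution (n : ℕ) (f : ℝ → ℝ) (t x : ℝ) : ℝ :=
  ∑ ℓ ∈ Finset.range n, sineCoeff n f ℓ * Real.exp (-heatEigenvalue n ℓ * t)
    * (√2 * Real.sin (Real.pi * ℓ * x / n))

/-- The forward difference of `heatSolution` in space. -/
noncomputable def heatGradient (n : ℕ) (f : ℝ → ℝ) (t x : ℝ) : ℝ :=
  heatSolution n f t (x + 1) - heatSolution n f t x

section SpectralDecomposition

variable {n : ℕ} {f : ℝ → ℝ}

theorem heatSolution_zero_right (n : ℕ) (f : ℝ → ℝ) (t : ℝ) : heatSolution n f t 0 = 0 := by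
  simp [heatSolution]

theorem heatSolution_neg (n : ℕ) (f : ℝ → ℝ) (t x : ℝ) :
    heatSolution n f t (-x) = -heatSolution n f t x := by
  simp only [heatSolution, mul_neg, neg_div, Real.sin_neg, Finset.sum_neg_distrib]

theorem heatSolution_natCast_add (hn : n ≠ 0) (f : ℝ → ℝ) (t x : ℝ) :
    heatSolution n f t (n + x) = -heatSolution n f t (n - x) := by
  have hsin (ℓ : ℕ) :
      Real.sin (Real.pi * ℓ * (n + x) / n) = -Real.sin (Real.pi * ℓ * (n - x) / n) := by
    have hadd : Real.pi * ℓ * (n + x) / n = ℓ * Real.pi + Real.pi * ℓ * x / n := by field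
    have hsub : Real.pi * ℓ * (n - x) / n = ℓ * Real.pi - Real.pi * ℓ * x / n := by field
    rw [hadd, hsub, Real.sin_add, Real.sin_sub, Real.sin_nat_mul_pi]
    ring
  simp only [heatSolution, hsin, mul_neg, Finset.sum_neg_distrib]

theorem heatSolution_natCast (hn : n ≠ 0) (f : ℝ → ℝ) (t : ℝ) : heatSolution n f t n = 0 := by
  have h := heatSolution_natCast_add hn f t 0
  rw [add_zero, sub_zero] at h
  linarith

theorem sin_add_two_mul_sub_two_mul_sin_add (a b : ℝ) :
    Real.sin (a + 2 * b) - 2 * Real.sin a + Real.sin (a - 2 * b)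
      = -(4 * Real.sin b ^ 2) * Real.sin a := by
  rw [Real.sin_add, Real.sin_sub, Real.cos_two_mul, Real.cos_sq']
  ring

theorem hasDerivAt_heatSolution (n : ℕ) (f : ℝ → ℝ) (t x : ℝ) :
    HasDerivAt (fun s => heatSolution n f s x) ((n : ℝ) ^ 2 * (heatSolution n f t (x + 1)
      - 2 * heatSolution n f t x + heatSolution n f t (x - 1))) t := by
  have hmode (ℓ : ℕ) : HasDerivAt (fun s => Real.exp (-heatEigenvalue n ℓ * s))
      (Real.exp (-heatEigenvalue n ℓ * t) * -heatEigenvalue n ℓ) t := by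
    simpa using ((hasDerivAt_id t).const_mul (-heatEigenvalue n ℓ)).exp
  refine (HasDerivAt.fun_sum fun ℓ _ => ((hmode ℓ).const_mul (sineCoeff n f ℓ)).mul_const
    (√2 * Real.sin (Real.pi * ℓ * x / n))).congr_deriv ?_
  simp only [heatSolution, Finset.mul_sum, ← Finset.sum_sub_distrib, ← Finset.sum_add_distrib]
  refine Finset.sum_congr rfl fun ℓ _ => ?_
  have hadd : Real.pi * ℓ * (x + 1) / n = Real.pi * ℓ * x / n + 2 * (Real.pi * ℓ / (2 * n)) := by
    field
  have hsub : Real.pi * ℓ * (x - 1) / n = Real.pi * ℓ * x / n - 2 * (Real.pi * ℓ / (2 * n)) := by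
    field
  have heigen : heatEigenvalue n ℓ = 4 * (n : ℝ) ^ 2 * Real.sin (Real.pi * ℓ / (2 * n)) ^ 2 := rfl
  rw [hadd, hsub]
  linear_combination -sineCoeff n f ℓ * Real.exp (-heatEigenvalue n ℓ * t) * √2
    * Real.sin (Real.pi * ℓ * x / n) * heigen
    - (n : ℝ) ^ 2 * sineCoeff n f ℓ * Real.exp (-heatEigenvalue n ℓ * t) * √2
    * sin_add_two_mul_sub_two_mul_sin_add (Real.pi * ℓ * x / n) (Real.pi * ℓ / (2 * n))

theorem two_mul_sin_mul_sum_cos (φ : ℝ) (m : ℕ) :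
    2 * Real.sin φ * ∑ ℓ ∈ Finset.range m, Real.cos (2 * ℓ * φ)
      = Real.sin ((2 * m - 1) * φ) + Real.sin φ := by
  induction m with
  | zero => simp
  | succ m ih =>
    have hnext : (2 * ((m + 1 : ℕ) : ℝ) - 1) * φ = 2 * m * φ + φ := by push_cast; ring
    have hprev : (2 * (m : ℝ) - 1) * φ = 2 * m * φ - φ := by ring
    rw [Finset.sum_range_succ, mul_add, ih, hnext, hprev, Real.sin_add, Real.sin_sub]
    ring

theorem sum_cos_pi_mul_div {j : ℕ} (hj₀ : 0 < j) (hj : j < 2 * n) :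
    ∑ ℓ ∈ Finset.range n, Real.cos (Real.pi * ℓ * j / n) = (1 - (-1) ^ j) / 2 := by
  have hn : (n : ℝ) ≠ 0 := by rintro h; simp_all
  set φ := Real.pi * j / (2 * n) with hφ
  have hj' : (j : ℝ) < 2 * n := by exact_mod_cast hj
  have hsin : 0 < Real.sin φ := by
    refine Real.sin_pos_of_pos_of_lt_pi (by positivity) ?_
    rw [hφ, div_lt_iff₀ (by positivity)]
    gcongr
  have hangle : (2 * (n : ℝ) - 1) * φ = j * Real.pi - φ := by rw [hφ]; field
  have hsum := two_mul_sin_mul_sum_cos φ n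
  rw [hangle, Real.sin_sub, Real.sin_nat_mul_pi, Real.cos_nat_mul_pi] at hsum
  have hterm (ℓ : ℕ) : Real.pi * ℓ * j / n = 2 * ℓ * φ := by rw [hφ]; field
  simp only [hterm]
  refine mul_left_cancel₀ hsin.ne' ?_
  linear_combination hsum / 2

theorem sum_two_mul_sin_mul_sin {x y : ℕ} (hx₀ : 0 < x) (hx : x < n) (hy₀ : 0 < y) (hy : y < n) :
    ∑ ℓ ∈ Finset.range n, 2 * Real.sin (Real.pi * ℓ * x / n) * Real.sin (Real.pi * ℓ * y / n)
      = if x = y then (n : ℝ) else 0 := by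
  wlog hxy : y ≤ x generalizing x y
  · have h := this hy₀ hy hx₀ hx (not_le.1 hxy).le
    simp only [eq_comm (a := x), ← h]
    exact Finset.sum_congr rfl fun ℓ _ => by ring
  obtain ⟨d, rfl⟩ := Nat.exists_eq_add_of_le hxy
  have hsub (ℓ : ℕ) : Real.pi * ℓ * ((y + d : ℕ) : ℝ) / n - Real.pi * ℓ * y / n
      = Real.pi * ℓ * d / n := by push_cast; ring
  have hadd (ℓ : ℕ) : Real.pi * ℓ * ((y + d : ℕ) : ℝ) / n + Real.pi * ℓ * y / n
      = Real.pi * ℓ * ((2 * y + d : ℕ) : ℝ) / n := by push_cast; ring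
  simp only [Real.two_mul_sin_mul_sin, Finset.sum_sub_distrib, hsub, hadd]
  rw [sum_cos_pi_mul_div (j := 2 * y + d) (by omega) (by omega), pow_add, pow_mul, neg_one_sq,
    one_pow, one_mul]
  rcases Nat.eq_zero_or_pos d with rfl | hd
  · simp
  · rw [sum_cos_pi_mul_div hd (by omega), sub_self, if_neg (by omega)]

theorem heatSolution_zero_left (hf₀ : f 0 = 0) (hf₁ : f 1 = 0) {x : ℕ} (hx : x ≤ n) :
    heatSolution n f 0 x = f (x / n) := by
  rcases Nat.eq_zero_or_pos x with rfl | hx₀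
  · simp [heatSolution_zero_right, hf₀]
  have hn : (n : ℝ) ≠ 0 := by exact_mod_cast (hx₀.trans_le hx).ne'
  rcases hx.eq_or_lt with rfl | hxn
  · rw [heatSolution_natCast hx₀.ne', div_self hn, hf₁]
  have hsqrt : √2 * √2 = (2 : ℝ) := Real.mul_self_sqrt zero_le_two
  calc heatSolution n f 0 x
      = ∑ ℓ ∈ Finset.range n, ∑ y ∈ Finset.range n, f (y / n) / n
          * (2 * Real.sin (Real.pi * ℓ * x / n) * Real.sin (Real.pi * ℓ * y / n)) := by
        simp only [heatSolution, sineCoeff, mul_zero, Real.exp_zero, mul_one, Finset.mul_sum,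
          Finset.sum_mul]
        refine Finset.sum_congr rfl fun ℓ _ => Finset.sum_congr rfl fun y _ => ?_
        linear_combination (f (y / n) * Real.sin (Real.pi * ℓ * y / n)
          * Real.sin (Real.pi * ℓ * x / n) / n) * hsqrt
    _ = ∑ y ∈ Finset.range n, f (y / n) / n * if x = y then (n : ℝ) else 0 := by
        rw [Finset.sum_comm]
        refine Finset.sum_congr rfl fun y hy => ?_
        rw [← Finset.mul_sum]
        rcases Nat.eq_zero_or_pos y with rfl | hy₀
        · simp [hf₀]
        · rw [sum_two_mul_sin_mul_sin hx₀ hxn hy₀ (Finset.mem_range.1 hy)]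
    _ = f (x / n) := by
        simp only [mul_ite, mul_zero, Finset.sum_ite_eq, Finset.mem_range, hxn, if_true]
        exact div_mul_cancel₀ _ hn

theorem natCast_div_mem_Icc {x n : ℕ} (hx : x ≤ n) : (x : ℝ) / n ∈ Icc (0 : ℝ) 1 :=
  ⟨by positivity, div_le_one_of_le₀ (by exact_mod_cast hx) n.cast_nonneg⟩

theorem four_mul_sq_le_heatEigenvalue {ℓ : ℕ} (hℓ : ℓ ≤ n) :
    4 * (ℓ : ℝ) ^ 2 ≤ heatEigenvalue n ℓ := by
  rcases eq_or_ne (n : ℝ) 0 with hn | hn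
  · obtain rfl : ℓ = 0 := by simp_all
    simp [heatEigenvalue]
  have hangle : Real.pi * ℓ / (2 * n) ≤ Real.pi / 2 := by
    have hℓn : (ℓ : ℝ) ≤ n := by exact_mod_cast hℓ
    rw [mul_div_mul_comm]
    exact mul_le_of_le_one_right (by positivity) (div_le_one_of_le₀ hℓn n.cast_nonneg)
  have hjordan := Real.mul_le_sin (x := Real.pi * ℓ / (2 * n)) (by positivity) hangle
  calc 4 * (ℓ : ℝ) ^ 2
      = 4 * (n : ℝ) ^ 2 * (2 / Real.pi * (Real.pi * ℓ / (2 * n))) ^ 2 := by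
        field [Real.pi_ne_zero]
    _ ≤ heatEigenvalue n ℓ := by
        unfold heatEigenvalue
        gcongr

theorem abs_sineCoeff_le {M : ℝ} (hM : ∀ x ∈ Icc (0 : ℝ) 1, |f x| ≤ M) (n ℓ : ℕ) :
    |sineCoeff n f ℓ| ≤ √2 * M := by
  have hM₀ : 0 ≤ M := (abs_nonneg _).trans (hM 0 (by simp))
  have hsum : |∑ y ∈ Finset.range n, f (y / n) * Real.sin (Real.pi * ℓ * y / n)| ≤ n * M :=
    calc |∑ y ∈ Finset.range n, f (y / n) * Real.sin (Real.pi * ℓ * y / n)|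
        ≤ ∑ y ∈ Finset.range n, |f (y / n) * Real.sin (Real.pi * ℓ * y / n)| :=
          Finset.abs_sum_le_sum_abs _ _
      _ ≤ ∑ _y ∈ Finset.range n, M := by
          refine Finset.sum_le_sum fun y hy => ?_
          rw [abs_mul]
          exact (mul_le_mul (hM _ (natCast_div_mem_Icc (Finset.mem_range.1 hy).le))
            (Real.abs_sin_le_one _) (abs_nonneg _) hM₀).trans_eq (mul_one M)
      _ = n * M := by simp
  calc |sineCoeff n f ℓ|
      ≤ √2 / n * (n * M) := by
        rw [sineCoeff, abs_mul, abs_of_nonneg (by positivity)]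
        gcongr
    _ = (n : ℝ) / n * (√2 * M) := by ring
    _ ≤ √2 * M := mul_le_of_le_one_left (by positivity) (div_self_le_one _)

end SpectralDecomposition

section GradientBound

variable {n : ℕ} {f : ℝ → ℝ}

theorem norm_le_norm_zero_of_hasDerivAt_sub_smul {E : Type*} [NormedAddCommGroup E]
    [NormedSpace ℝ E] {q r : ℝ → E} {c : ℝ} (hq : ∀ s, HasDerivAt q (r s - c • q s) s)
    (hr : ∀ s, ‖r s‖ ≤ c * ‖q s‖) {t : ℝ} (ht : 0 ≤ t) : ‖q t‖ ≤ ‖q 0‖ := by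
  have hexp (s : ℝ) : HasDerivAt (fun s => Real.exp (c * s)) (Real.exp (c * s) * c) s := by
    simpa using ((hasDerivAt_id s).const_mul c).exp
  have hderiv (s : ℝ) :
      HasDerivAt (fun s => Real.exp (c * s) • q s) (Real.exp (c * s) • r s) s := by
    refine ((hexp s).smul (hq s)).congr_deriv ?_
    module
  have hgronwall := norm_le_gronwallBound_of_norm_deriv_right_le (a := 0) (b := t) (δ := ‖q 0‖)
    (K := c) (ε := 0) (fun s _ => (hderiv s).continuousAt.continuousWithinAt)
    (fun s _ => (hderiv s).hasDerivWithinAt) (by simp)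
    (fun s _ => by
      rw [norm_smul, norm_smul, add_zero, mul_left_comm]
      exact mul_le_mul_of_nonneg_left (hr s) (norm_nonneg _)) t ⟨ht, le_rfl⟩
  rw [gronwallBound_ε0, sub_zero, norm_smul, Real.norm_of_nonneg (Real.exp_pos _).le,
    mul_comm] at hgronwall
  exact le_of_mul_le_mul_right hgronwall (Real.exp_pos _)

theorem hasDerivAt_heatGradient (n : ℕ) (f : ℝ → ℝ) (t x : ℝ) :
    HasDerivAt (fun s => heatGradient n f s x) ((n : ℝ) ^ 2 * (heatGradient n f t (x + 1)
      + heatGradient n f t (x - 1)) - 2 * (n : ℝ) ^ 2 * heatGradient n f t x) t := by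
  refine ((hasDerivAt_heatSolution n f t (x + 1)).sub
    (hasDerivAt_heatSolution n f t x)).congr_deriv ?_
  simp only [heatGradient, add_sub_cancel_right, sub_add_cancel]
  ring

theorem heatGradient_neg_one (n : ℕ) (f : ℝ → ℝ) (t : ℝ) :
    heatGradient n f t (-1) = heatGradient n f t 0 := by
  simp [heatGradient, heatSolution_neg, heatSolution_zero_right]

theorem heatGradient_natCast (hn : n ≠ 0) (f : ℝ → ℝ) (t : ℝ) :
    heatGradient n f t n = heatGradient n f t (n - 1) := by
  simp [heatGradient, heatSolution_natCast_add hn, heatSolution_natCast hn]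

theorem abs_heatGradient_add_one_le_norm (f : ℝ → ℝ) (t : ℝ) (i : Fin n) :
    |heatGradient n f t (i + 1)| ≤ ‖fun j : Fin n => heatGradient n f t j‖ := by
  rcases Nat.lt_or_ge (i + 1) n with hi | hi
  · simpa using norm_le_pi_norm (fun j : Fin n => heatGradient n f t j) ⟨i + 1, hi⟩
  · have hin : ((i : ℕ) : ℝ) + 1 = n := by exact_mod_cast le_antisymm i.2 hi
    rw [hin, heatGradient_natCast i.pos.ne', ← hin, add_sub_cancel_right]
    exact norm_le_pi_norm (fun j : Fin n => heatGradient n f t j) i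

theorem abs_heatGradient_sub_one_le_norm (f : ℝ → ℝ) (t : ℝ) (i : Fin n) :
    |heatGradient n f t (i - 1)| ≤ ‖fun j : Fin n => heatGradient n f t j‖ := by
  rcases Nat.eq_zero_or_pos (i : ℕ) with hi | hi
  · rw [hi, Nat.cast_zero, zero_sub, heatGradient_neg_one]
    simpa [hi] using norm_le_pi_norm (fun j : Fin n => heatGradient n f t j) i
  · simpa [Nat.cast_pred hi] using
      norm_le_pi_norm (fun j : Fin n => heatGradient n f t j) ⟨i - 1, by omega⟩

/-- The gradient solves the discrete heat equation with reflecting boundary, which satisfies the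
maximum principle. -/
theorem norm_heatGradient_le (f : ℝ → ℝ) {t : ℝ} (ht : 0 ≤ t) :
    ‖fun i : Fin n => heatGradient n f t i‖ ≤ ‖fun i : Fin n => heatGradient n f 0 i‖ := by
  refine norm_le_norm_zero_of_hasDerivAt_sub_smul (c := 2 * (n : ℝ) ^ 2)
    (q := fun s (i : Fin n) => heatGradient n f s i)
    (r := fun s i => (n : ℝ) ^ 2 * (heatGradient n f s (i + 1) + heatGradient n f s (i - 1)))
    (fun s => hasDerivAt_pi.2 fun i => hasDerivAt_heatGradient n f s i)
    (fun s => (pi_norm_le_iff_of_nonneg (by positivity)).2 fun i => ?_) ht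
  rw [norm_mul, Real.norm_of_nonneg (by positivity), Real.norm_eq_abs]
  calc (n : ℝ) ^ 2 * |heatGradient n f s (i + 1) + heatGradient n f s (i - 1)|
      ≤ (n : ℝ) ^ 2 * (‖fun j : Fin n => heatGradient n f s j‖
        + ‖fun j : Fin n => heatGradient n f s j‖) := by
        gcongr
        exact (abs_add_le _ _).trans (add_le_add (abs_heatGradient_add_one_le_norm f s i)
          (abs_heatGradient_sub_one_le_norm f s i))
    _ = 2 * (n : ℝ) ^ 2 * ‖fun j : Fin n => heatGradient n f s j‖ := by ring

theorem abs_heatGradient_zero_le (hf₀ : f 0 = 0) (hf₁ : f 1 = 0) {K : ℝ≥0}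
    (hK : LipschitzOnWith K f (Icc 0 1)) {x : ℕ} (hx : x < n) :
    |heatGradient n f 0 x| ≤ K / n := by
  have hlip := hK.dist_le_mul _ (natCast_div_mem_Icc (Nat.succ_le_of_lt hx)) _
    (natCast_div_mem_Icc hx.le)
  have hdist : dist (((x + 1 : ℕ) : ℝ) / n) (x / n) = 1 / n := by
    rw [Real.dist_eq, ← sub_div, Nat.cast_succ, add_sub_cancel_left, abs_of_nonneg (by positivity)]
  rw [heatGradient, ← Nat.cast_succ, heatSolution_zero_left hf₀ hf₁ (Nat.succ_le_of_lt hx),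
    heatSolution_zero_left hf₀ hf₁ hx.le, ← Real.dist_eq]
  rwa [hdist, mul_one_div] at hlip

theorem abs_heatGradient_le (hf₀ : f 0 = 0) (hf₁ : f 1 = 0) {K : ℝ≥0}
    (hK : LipschitzOnWith K f (Icc 0 1)) {t : ℝ} (ht : 0 ≤ t) {x : ℕ} (hx : x < n) :
    |heatGradient n f t x| ≤ K / n :=
  calc |heatGradient n f t x| ≤ ‖fun i : Fin n => heatGradient n f t i‖ :=
        norm_le_pi_norm (fun i : Fin n => heatGradient n f t i) ⟨x, hx⟩
    _ ≤ ‖fun i : Fin n => heatGradient n f 0 i‖ := norm_heatGradient_le f ht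
    _ ≤ K / n := (pi_norm_le_iff_of_nonneg (by positivity)).2 fun i =>
        abs_heatGradient_zero_le hf₀ hf₁ hK i.2

theorem exp_neg_heatEigenvalue_mul_le {ℓ : ℕ} (hℓ : ℓ ≤ n) {t : ℝ} (ht : 1 ≤ t) :
    Real.exp (-heatEigenvalue n ℓ * t) * ℓ ≤ Real.exp (-t) * (1 / 2) ^ ℓ := by
  rcases Nat.eq_zero_or_pos ℓ with rfl | hℓ₀
  · simpa using Real.exp_nonneg (-t)
  have hℓ₁ : (1 : ℝ) ≤ ℓ := by exact_mod_cast hℓ₀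
  have hrate : -heatEigenvalue n ℓ * t ≤ -t + -3 * ℓ := by
    nlinarith [four_mul_sq_le_heatEigenvalue hℓ, mul_nonneg (sub_nonneg.2 hℓ₁) (sub_nonneg.2 ht)]
  have hexp : Real.exp (-2) ≤ 1 / 2 := by
    rw [Real.exp_neg, one_div]
    exact inv_anti₀ two_pos (by linarith [Real.add_one_le_exp (2 : ℝ)])
  calc Real.exp (-heatEigenvalue n ℓ * t) * ℓ
      ≤ Real.exp (-t + -3 * ℓ) * Real.exp ℓ := by
        gcongr
        linarith [Real.add_one_le_exp (ℓ : ℝ)]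
    _ = Real.exp (-t) * Real.exp (-2) ^ ℓ := by
        rw [← Real.exp_nat_mul, ← Real.exp_add, ← Real.exp_add]
        ring_nf
    _ ≤ Real.exp (-t) * (1 / 2) ^ ℓ := by gcongr

theorem abs_sin_sub_sin_le (a b : ℝ) : |Real.sin a - Real.sin b| ≤ |a - b| := by
  simpa [Real.dist_eq] using Real.lipschitzWith_sin.dist_le_mul a b

theorem abs_heatGradient_le_exp {M : ℝ} (hM : ∀ x ∈ Icc (0 : ℝ) 1, |f x| ≤ M) {t : ℝ}
    (ht : 1 ≤ t) (x : ℝ) :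
    |heatGradient n f t x| ≤ 4 * Real.pi * M * Real.exp (-t) / n := by
  have hM₀ : 0 ≤ M := (abs_nonneg _).trans (hM 0 (by simp))
  have hsin (ℓ : ℕ) : |Real.sin (Real.pi * ℓ * (x + 1) / n) - Real.sin (Real.pi * ℓ * x / n)|
      ≤ Real.pi * ℓ / n := by
    refine (abs_sin_sub_sin_le _ _).trans_eq ?_
    rw [← sub_div, ← mul_sub, add_sub_cancel_left, mul_one, abs_of_nonneg (by positivity)]
  have hterm (ℓ : ℕ) (hℓ : ℓ ∈ Finset.range n) :
      |sineCoeff n f ℓ * Real.exp (-heatEigenvalue n ℓ * t)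
        * (√2 * (Real.sin (Real.pi * ℓ * (x + 1) / n) - Real.sin (Real.pi * ℓ * x / n)))|
      ≤ 2 * Real.pi * M * Real.exp (-t) / n * (1 / 2) ^ ℓ := by
    rw [abs_mul, abs_mul, abs_mul, abs_of_pos (Real.exp_pos _), abs_of_nonneg (Real.sqrt_nonneg 2)]
    calc _ ≤ √2 * M * Real.exp (-heatEigenvalue n ℓ * t) * (√2 * (Real.pi * ℓ / n)) := by
          gcongr
          · exact abs_sineCoeff_le hM n ℓ
          · exact hsin ℓ
      _ = 2 * Real.pi * M / n * (Real.exp (-heatEigenvalue n ℓ * t) * ℓ) := by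
          linear_combination M * Real.exp (-heatEigenvalue n ℓ * t) * (Real.pi * ℓ / n)
            * Real.mul_self_sqrt (zero_le_two (α := ℝ))
      _ ≤ 2 * Real.pi * M / n * (Real.exp (-t) * (1 / 2) ^ ℓ) :=
          mul_le_mul_of_nonneg_left
            (exp_neg_heatEigenvalue_mul_le (Finset.mem_range.1 hℓ).le ht) (by positivity)
      _ = 2 * Real.pi * M * Real.exp (-t) / n * (1 / 2) ^ ℓ := by ring
  simp only [heatGradient, heatSolution, ← Finset.sum_sub_distrib, ← mul_sub]
  calc _ ≤ ∑ ℓ ∈ Finset.range n, 2 * Real.pi * M * Real.exp (-t) / n * (1 / 2 : ℝ) ^ ℓ :=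
        (Finset.abs_sum_le_sum_abs _ _).trans (Finset.sum_le_sum hterm)
    _ ≤ 2 * Real.pi * M * Real.exp (-t) / n * 2 := by
        rw [← Finset.mul_sum]
        gcongr
        exact sum_geometric_two_le n
    _ = 4 * Real.pi * M * Real.exp (-t) / n := by ring

/-- Short times are covered by the maximum principle, long times by the spectral gap. -/
theorem sq_mul_heatGradient_sq_le (hf₀ : f 0 = 0) (hf₁ : f 1 = 0) {K : ℝ≥0}
    (hK : LipschitzOnWith K f (Icc 0 1)) {M : ℝ} (hM : ∀ x ∈ Icc (0 : ℝ) 1, |f x| ≤ M) {t : ℝ}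
    (ht : 0 ≤ t) {x : ℕ} (hx : x < n) :
    (n : ℝ) ^ 2 * heatGradient n f t x ^ 2
      ≤ (3 * K ^ 2 + 16 * Real.pi ^ 2 * M ^ 2) * Real.exp (-t) := by
  have hn : (0 : ℝ) < n := by exact_mod_cast x.zero_le.trans_lt hx
  rw [← mul_pow]
  rcases le_total t 1 with ht₁ | ht₁
  · have hgrad : |n * heatGradient n f t x| ≤ K := by
      rw [abs_mul, abs_of_pos hn, ← le_div_iff₀' hn]
      exact abs_heatGradient_le hf₀ hf₁ hK ht hx
    have hthree : 1 ≤ 3 * Real.exp (-t) := by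
      rw [Real.exp_neg, ← div_eq_mul_inv, one_le_div (Real.exp_pos t)]
      linarith [Real.exp_le_exp.2 ht₁, Real.exp_one_lt_d9]
    calc (n * heatGradient n f t x) ^ 2 ≤ (K : ℝ) ^ 2 * 1 := by
          rw [mul_one]
          exact sq_le_sq' (neg_le_of_abs_le hgrad) (le_of_abs_le hgrad)
      _ ≤ (K : ℝ) ^ 2 * (3 * Real.exp (-t)) := by gcongr
      _ ≤ (3 * K ^ 2 + 16 * Real.pi ^ 2 * M ^ 2) * Real.exp (-t) := by
          rw [← mul_assoc, mul_comm _ (3 : ℝ)]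
          gcongr
          exact le_add_of_nonneg_right (by positivity)
  · have hgrad : |n * heatGradient n f t x| ≤ 4 * Real.pi * M * Real.exp (-t) := by
      rw [abs_mul, abs_of_pos hn, ← le_div_iff₀' hn]
      exact abs_heatGradient_le_exp hM ht₁ x
    calc (n * heatGradient n f t x) ^ 2 ≤ (4 * Real.pi * M * Real.exp (-t)) ^ 2 :=
          sq_le_sq' (neg_le_of_abs_le hgrad) (le_of_abs_le hgrad)
      _ = 16 * Real.pi ^ 2 * M ^ 2 * Real.exp (-t) * Real.exp (-t) := by ring
      _ ≤ 16 * Real.pi ^ 2 * M ^ 2 * Real.exp (-t) :=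
          mul_le_of_le_one_right (by positivity) (Real.exp_le_one_iff.2 (by linarith))
      _ ≤ (3 * K ^ 2 + 16 * Real.pi ^ 2 * M ^ 2) * Real.exp (-t) := by
          gcongr
          exact le_add_of_nonneg_left (by positivity)

end GradientBound

section Profile

variable {n : ℕ}

theorem sum_edges_fst (H : ℕ → ℝ) (x : Site n) :
    ∑ e ∈ edges n, (if e.1 = x then H e.2 - H e.1 else 0)
      = if (x : ℕ) + 1 < n then H (x + 1) - H x else 0 := by
  rw [edges, Finset.sum_filter, Fintype.sum_prod_type, Finset.sum_eq_single_of_mem x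
    (Finset.mem_univ x) fun y _ hy => Finset.sum_eq_zero fun z _ => by simp [hy]]
  simp only [if_true]
  split_ifs with h
  · let z : Site n := ⟨x + 1, Finset.mem_Ico.2 ⟨by omega, h⟩⟩
    rw [Finset.sum_eq_single_of_mem z (Finset.mem_univ z)
      fun y _ hy => if_neg fun h' => hy (Subtype.ext h'), if_pos rfl]
  · refine Finset.sum_eq_zero fun z _ => if_neg fun h' => ?_
    have := (Finset.mem_Ico.1 z.2).2
    omega

theorem sum_edges_snd (H : ℕ → ℝ) (x : Site n) :
    ∑ e ∈ edges n, (if e.2 = x then H e.2 - H e.1 else 0)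
      = if 1 < (x : ℕ) then H x - H (x - 1) else 0 := by
  have hx := Finset.mem_Ico.1 x.2
  rw [edges, Finset.sum_filter, Fintype.sum_prod_type_right, Finset.sum_eq_single_of_mem x
    (Finset.mem_univ x) fun y _ hy => Finset.sum_eq_zero fun z _ => by simp [hy]]
  simp only [if_true]
  split_ifs with h
  · let z : Site n := ⟨x - 1, Finset.mem_Ico.2 ⟨by omega, by omega⟩⟩
    rw [Finset.sum_eq_single_of_mem z (Finset.mem_univ z)
      fun y _ hy => if_neg fun h' => hy (Subtype.ext (by simp only [z]; omega)),
      if_pos (by simp only [z]; omega)]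
  · refine Finset.sum_eq_zero fun z _ => if_neg fun h' => ?_
    have := (Finset.mem_Ico.1 z.2).1
    omega

/-- For `n = 2` the single site has only one reservoir, and the identity fails. -/
theorem heatDrift_eq (hn : 3 ≤ n) {ρ : ℝ} {H : ℕ → ℝ} (hH₀ : H 0 = ρ) (hHn : H n = ρ)
    (x : Site n) :
    heatDrift n ρ (fun y => H y) x = (n : ℝ) ^ 2 * (H (x + 1) - 2 * H x + H (x - 1)) := by
  have hx := Finset.mem_Ico.1 x.2
  simp only [heatDrift, mul_sub, mul_ite, mul_one, mul_zero, Finset.sum_sub_distrib, mem_boundary]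
  rw [sum_edges_fst H x, sum_edges_snd H x]
  by_cases hleft : (x : ℕ) = 1
  · rw [hleft, if_pos (by omega), if_neg (by omega), if_pos (Or.inl rfl), Nat.sub_self, hH₀]
    ring
  by_cases hright : (x : ℕ) = n - 1
  · rw [if_neg (by omega), if_pos (by omega), if_pos (Or.inr hright),
      show (x : ℕ) + 1 = n by omega, hHn]
    ring
  · rw [if_pos (by omega), if_pos (by omega), if_neg (by tauto)]
    ring

/-- The solution at time `t` of the discrete heat equation with reservoirs of density `ρ`, started
from the profile `u₀`. -/
noncomputable def profile (n : ℕ) (ρ : ℝ) (u₀ : ℝ → ℝ) (t : ℝ) (x : Site n) : ℝ :=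
  ρ + heatSolution n (fun y => u₀ y - ρ) t (x : ℕ)

theorem hasDerivAt_profile (hn : 3 ≤ n) (ρ : ℝ) (u₀ : ℝ → ℝ) (t : ℝ) (x : Site n) :
    HasDerivAt (fun s => profile n ρ u₀ s x) (heatDrift n ρ (profile n ρ u₀ t) x) t := by
  have hx := Finset.mem_Ico.1 x.2
  refine ((hasDerivAt_heatSolution n _ t (x : ℕ)).const_add ρ).congr_deriv ?_
  have hdrift := heatDrift_eq hn (ρ := ρ)
    (H := fun k => ρ + heatSolution n (fun y => u₀ y - ρ) t k)
    (by simp [heatSolution_zero_right]) (by simp [heatSolution_natCast (by omega : n ≠ 0)]) x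
  refine Eq.trans ?_ hdrift.symm
  simp only [Nat.cast_add, Nat.cast_one, Nat.cast_pred hx.1]
  ring

theorem profile_zero {ρ : ℝ} {u₀ : ℝ → ℝ} (h₀ : u₀ 0 = ρ) (h₁ : u₀ 1 = ρ) :
    profile n ρ u₀ 0 = discretize n u₀ := by
  ext x
  rw [profile, heatSolution_zero_left (by simp [h₀]) (by simp [h₁]) (Finset.mem_Ico.1 x.2).2.le,
    discretize, add_sub_cancel]

theorem profile_snd_sub_profile_fst {ρ : ℝ} {u₀ : ℝ → ℝ} {t : ℝ} {e : Site n × Site n}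
    (he : e ∈ edges n) : profile n ρ u₀ t e.2 - profile n ρ u₀ t e.1
      = heatGradient n (fun y => u₀ y - ρ) t (e.1 : ℕ) := by
  rw [profile, profile, mem_edges.1 he, Nat.cast_succ, heatGradient]
  ring

end Profile

/-! ### The heat equation at the cutoff time -/

section RiemannSum

variable {n : ℕ} {K : ℝ≥0}

theorem abs_sub_integral_cell_le {F : ℝ → ℝ} (hF : LipschitzOnWith K F (Icc 0 1)) {k : ℕ}
    (hk : k < n) :
    |1 / (n : ℝ) * F (k / n) - ∫ x in (k / n : ℝ)..((k + 1 : ℕ) / n), F x| ≤ K / n * (1 / n) := by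
  have hle : (k : ℝ) / n ≤ (k + 1 : ℕ) / n := by gcongr; exact k.le_succ
  have hlen : ((k + 1 : ℕ) : ℝ) / n - k / n = 1 / n := by push_cast; ring
  have hleft := natCast_div_mem_Icc hk.le
  have hcell : Icc (k / n : ℝ) ((k + 1 : ℕ) / n) ⊆ Icc 0 1 :=
    Icc_subset_Icc hleft.1 (natCast_div_mem_Icc (Nat.succ_le_of_lt hk)).2
  have hint : IntervalIntegrable F volume (k / n : ℝ) ((k + 1 : ℕ) / n) :=
    ContinuousOn.intervalIntegrable_of_Icc hle (hF.continuousOn.mono hcell)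
  have hvar (x : ℝ) (hx : x ∈ uIoc (k / n : ℝ) ((k + 1 : ℕ) / n)) :
      ‖F (k / n) - F x‖ ≤ K / n := by
    rw [uIoc_of_le hle] at hx
    calc ‖F (k / n) - F x‖ ≤ K * dist (k / n : ℝ) x :=
          hF.dist_le_mul _ hleft _ (hcell (Ioc_subset_Icc_self hx))
      _ ≤ K * (1 / n) := by
          gcongr
          rw [dist_comm, Real.dist_eq, abs_of_pos (sub_pos.2 hx.1)]
          linarith [hx.2]
      _ = K / n := mul_one_div _ _
  calc |1 / (n : ℝ) * F (k / n) - ∫ x in (k / n : ℝ)..((k + 1 : ℕ) / n), F x|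
      = ‖∫ x in (k / n : ℝ)..((k + 1 : ℕ) / n), (F (k / n) - F x)‖ := by
        rw [intervalIntegral.integral_sub intervalIntegrable_const hint,
          intervalIntegral.integral_const, hlen, smul_eq_mul, Real.norm_eq_abs]
    _ ≤ K / n * |((k + 1 : ℕ) : ℝ) / n - k / n| :=
        intervalIntegral.norm_integral_le_of_norm_le_const hvar
    _ = K / n * (1 / n) := by rw [hlen, abs_of_nonneg (by positivity)]

theorem abs_riemannSum_sub_integral_le {F : ℝ → ℝ} (hF : LipschitzOnWith K F (Icc 0 1))
    (hn : n ≠ 0) :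
    |1 / (n : ℝ) * ∑ k ∈ Finset.range n, F (k / n) - ∫ x in (0 : ℝ)..1, F x| ≤ K / n := by
  have hn' : (n : ℝ) ≠ 0 := by exact_mod_cast hn
  have hint (k : ℕ) (hk : k < n) :
      IntervalIntegrable F volume (k / n : ℝ) ((k + 1 : ℕ) / n) :=
    ContinuousOn.intervalIntegrable_of_Icc (by gcongr; exact k.le_succ) <|
      hF.continuousOn.mono <| Icc_subset_Icc (natCast_div_mem_Icc hk.le).1
        (natCast_div_mem_Icc (Nat.succ_le_of_lt hk)).2
  have hcells := intervalIntegral.sum_integral_adjacent_intervals (f := F) (μ := volume)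
    (a := fun k : ℕ => (k : ℝ) / n) hint
  rw [Nat.cast_zero, zero_div, div_self hn'] at hcells
  rw [← hcells, Finset.mul_sum, ← Finset.sum_sub_distrib]
  calc _ ≤ ∑ _k ∈ Finset.range n, (K / n * (1 / n) : ℝ) :=
        (Finset.abs_sum_le_sum_abs _ _).trans
          (Finset.sum_le_sum fun k hk => abs_sub_integral_cell_le hF (Finset.mem_range.1 hk))
    _ = K / n := by
        rw [Finset.sum_const, Finset.card_range, nsmul_eq_mul]
        field

theorem lipschitzOnWith_mul_sin {f : ℝ → ℝ} {M : ℝ≥0} (hK : LipschitzOnWith K f (Icc 0 1))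
    (hM : ∀ x ∈ Icc (0 : ℝ) 1, |f x| ≤ M) (a : ℝ≥0) :
    LipschitzOnWith (K + M * a) (fun x => f x * Real.sin (a * x)) (Icc 0 1) := by
  refine LipschitzOnWith.of_dist_le_mul fun x hx y hy => ?_
  have hf : |f x - f y| ≤ K * |x - y| := hK.dist_le_mul x hx y hy
  have hsin : |Real.sin (a * x) - Real.sin (a * y)| ≤ a * |x - y| := by
    refine (abs_sin_sub_sin_le _ _).trans_eq ?_
    rw [← mul_sub, abs_mul, NNReal.abs_eq]
  calc |f x * Real.sin (a * x) - f y * Real.sin (a * y)|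
      = |(f x - f y) * Real.sin (a * x) + f y * (Real.sin (a * x) - Real.sin (a * y))| := by
        ring_nf
    _ ≤ |f x - f y| * |Real.sin (a * x)| + |f y| * |Real.sin (a * x) - Real.sin (a * y)| := by
        rw [← abs_mul, ← abs_mul]
        exact abs_add_le _ _
    _ ≤ K * |x - y| * 1 + M * (a * |x - y|) := by
        gcongr
        · exact Real.abs_sin_le_one _
        · exact hM y hy
    _ = (K + M * a : ℝ≥0) * |x - y| := by push_cast; ring

theorem exists_abs_sineCoeff_sub_le {f : ℝ → ℝ} {M : ℝ≥0} (hK : LipschitzOnWith K f (Icc 0 1))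
    (hM : ∀ x ∈ Icc (0 : ℝ) 1, |f x| ≤ M) (ℓ : ℕ) :
    ∃ C : ℝ, ∀ n : ℕ, n ≠ 0 → |sineCoeff n f ℓ - fourierCoeff 0 f ℓ| ≤ C / n := by
  have hlip := lipschitzOnWith_mul_sin hK hM (NNReal.pi * ℓ)
  refine ⟨√2 * (K + M * (NNReal.pi * ℓ) : ℝ≥0), fun n hn => ?_⟩
  have hriemann := abs_riemannSum_sub_integral_le hlip hn
  have hcoeff : sineCoeff n f ℓ = √2 * (1 / n * ∑ y ∈ Finset.range n,
      f (y / n) * Real.sin ((NNReal.pi * ℓ : ℝ≥0) * (y / n))) := by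
    rw [sineCoeff, ← mul_assoc, mul_one_div]
    simp only [NNReal.coe_mul, NNReal.coe_real_pi, NNReal.coe_natCast, mul_div_assoc]
  have hfourier : fourierCoeff 0 f ℓ
      = √2 * ∫ x in (0 : ℝ)..1, f x * Real.sin ((NNReal.pi * ℓ : ℝ≥0) * x) := by
    simp only [fourierCoeff, sub_zero, NNReal.coe_mul, NNReal.coe_real_pi, NNReal.coe_natCast]
  rw [hcoeff, hfourier, ← mul_sub, abs_mul, abs_of_nonneg (Real.sqrt_nonneg 2), mul_div_assoc]
  gcongr

theorem tendsto_sineCoeff {f : ℝ → ℝ} {M : ℝ≥0} (hK : LipschitzOnWith K f (Icc 0 1))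
    (hM : ∀ x ∈ Icc (0 : ℝ) 1, |f x| ≤ M) (ℓ : ℕ) :
    Tendsto (fun n => sineCoeff n f ℓ) atTop (𝓝 (fourierCoeff 0 f ℓ)) := by
  obtain ⟨C, hC⟩ := exists_abs_sineCoeff_sub_le hK hM ℓ
  exact tendsto_iff_norm_sub_tendsto_zero.2 <| squeeze_zero' (.of_forall fun _ => norm_nonneg _)
    ((eventually_ne_atTop 0).mono hC) (tendsto_const_div_atTop_nhds_zero_nat C)

end RiemannSum

section CutoffTime

variable {n ℓ ℓ₀ : ℕ}

theorem heatEigenvalue_nonneg (n ℓ : ℕ) : 0 ≤ heatEigenvalue n ℓ := by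
  unfold heatEigenvalue
  positivity

theorem sq_sub_sin_sq_mem_Icc {y : ℝ} (hy : 0 ≤ y) :
    y ^ 2 - Real.sin y ^ 2 ∈ Icc 0 (y ^ 4 / 3) := by
  rcases hy.eq_or_lt with rfl | hy₀
  · simp
  have hsin := Real.sin_le hy
  have hcube := Real.sin_gt_sub_cube hy₀
  have hsq := Real.sin_sq_le_sq (x := y)
  refine ⟨sub_nonneg.2 hsq, ?_⟩
  calc y ^ 2 - Real.sin y ^ 2 = (y - Real.sin y) * (y + Real.sin y) := by ring
    _ ≤ (y - Real.sin y) * (2 * y) :=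
        mul_le_mul_of_nonneg_left (by linarith) (sub_nonneg.2 hsin)
    _ ≤ y ^ 3 / 6 * (2 * y) := mul_le_mul_of_nonneg_right (by linarith) (by positivity)
    _ = y ^ 4 / 3 := by ring

theorem sub_heatEigenvalue_mem_Icc (hn : n ≠ 0) (ℓ : ℕ) :
    Real.pi ^ 2 * ℓ ^ 2 - heatEigenvalue n ℓ ∈ Icc 0 (Real.pi ^ 4 * ℓ ^ 4 / (12 * n ^ 2)) := by
  have hn' : (n : ℝ) ≠ 0 := by exact_mod_cast hn
  have hsin := sq_sub_sin_sq_mem_Icc (y := Real.pi * ℓ / (2 * n)) (by positivity)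
  have hgap : Real.pi ^ 2 * ℓ ^ 2 - heatEigenvalue n ℓ = 4 * (n : ℝ) ^ 2
      * ((Real.pi * ℓ / (2 * n)) ^ 2 - Real.sin (Real.pi * ℓ / (2 * n)) ^ 2) := by
    rw [heatEigenvalue]
    field
  rw [hgap]
  refine ⟨mul_nonneg (by positivity) hsin.1, ?_⟩
  calc _ ≤ 4 * (n : ℝ) ^ 2 * ((Real.pi * ℓ / (2 * n)) ^ 4 / 3) :=
        mul_le_mul_of_nonneg_left hsin.2 (by positivity)
    _ = Real.pi ^ 4 * ℓ ^ 4 / (12 * n ^ 2) := by field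

theorem tendsto_cutoffTime_atTop (hℓ₀ : ℓ₀ ≠ 0) (b : ℝ) :
    Tendsto (fun n => cutoffTime ℓ₀ n b) atTop atTop :=
  tendsto_atTop_add_const_right _ _
    ((Real.tendsto_log_atTop.comp tendsto_natCast_atTop_atTop).const_mul_atTop (by positivity))

theorem tendsto_cutoffTime_div_natCast (ℓ₀ : ℕ) (b : ℝ) :
    Tendsto (fun n : ℕ => cutoffTime ℓ₀ n b / n) atTop (𝓝 0) := by
  have hlog : Tendsto (fun n : ℕ => Real.log n / n) atTop (𝓝 0) :=
    Real.isLittleO_log_id_atTop.tendsto_div_nhds_zero.comp tendsto_natCast_atTop_atTop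
  have hsum := (hlog.const_mul (1 / (2 * Real.pi ^ 2 * (ℓ₀ : ℝ) ^ 2))).add
    (tendsto_const_div_atTop_nhds_zero_nat (b / (Real.pi ^ 2 * (ℓ₀ : ℝ) ^ 2)))
  simp only [mul_zero, add_zero] at hsum
  exact hsum.congr fun n => by rw [cutoffTime]; ring

theorem tendsto_sub_heatEigenvalue_mul_cutoffTime (ℓ₀ ℓ : ℕ) (b : ℝ) :
    Tendsto (fun n => (Real.pi ^ 2 * ℓ ^ 2 - heatEigenvalue n ℓ) * cutoffTime ℓ₀ n b) atTop
      (𝓝 0) := by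
  have hbound : Tendsto (fun n : ℕ => Real.pi ^ 4 * ℓ ^ 4 / 12 / n * |cutoffTime ℓ₀ n b / n|) atTop
      (𝓝 0) := by
    simpa using (tendsto_const_div_atTop_nhds_zero_nat (Real.pi ^ 4 * ℓ ^ 4 / 12)).mul
      (tendsto_cutoffTime_div_natCast ℓ₀ b).abs
  refine squeeze_zero_norm' ?_ hbound
  filter_upwards [eventually_ne_atTop 0] with n hn
  have hgap := sub_heatEigenvalue_mem_Icc hn ℓ
  rw [Real.norm_eq_abs, abs_mul, abs_of_nonneg hgap.1, abs_div, Nat.abs_cast]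
  calc _ ≤ Real.pi ^ 4 * ℓ ^ 4 / (12 * n ^ 2) * |cutoffTime ℓ₀ n b| :=
        mul_le_mul_of_nonneg_right hgap.2 (abs_nonneg _)
    _ = Real.pi ^ 4 * ℓ ^ 4 / 12 / n * (|cutoffTime ℓ₀ n b| / n) := by field

/-- The cutoff time is chosen such that the mode `ℓ₀` decays exactly like `e⁻ᵇ / √n`. -/
theorem sqrt_mul_exp_neg_mul_cutoffTime (hℓ₀ : ℓ₀ ≠ 0) (hn : n ≠ 0) (b c : ℝ) :
    √n * Real.exp (-c * cutoffTime ℓ₀ n b)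
      = Real.exp (-b) * Real.exp ((Real.pi ^ 2 * ℓ₀ ^ 2 - c) * cutoffTime ℓ₀ n b) := by
  have hn' : (0 : ℝ) < n := by positivity
  have htime : Real.pi ^ 2 * ℓ₀ ^ 2 * cutoffTime ℓ₀ n b = Real.log n / 2 + b := by
    rw [cutoffTime]
    field
  have hsqrt : √(n : ℝ) = Real.exp (Real.log n / 2) := by
    rw [← Real.log_sqrt hn'.le, Real.exp_log (Real.sqrt_pos.2 hn')]
  rw [hsqrt, ← Real.exp_add, ← Real.exp_add]
  congr 1
  linear_combination -htime

theorem tendsto_sqrt_mul_exp_self (hℓ₀ : ℓ₀ ≠ 0) (b : ℝ) :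
    Tendsto (fun n : ℕ => √n * Real.exp (-heatEigenvalue n ℓ₀ * cutoffTime ℓ₀ n b)) atTop
      (𝓝 (Real.exp (-b))) := by
  have hlim := (tendsto_sub_heatEigenvalue_mul_cutoffTime ℓ₀ ℓ₀ b).rexp.const_mul (Real.exp (-b))
  rw [Real.exp_zero, mul_one] at hlim
  refine hlim.congr' ?_
  filter_upwards [eventually_ne_atTop 0] with n hn
  rw [sqrt_mul_exp_neg_mul_cutoffTime hℓ₀ hn]

theorem tendsto_sqrt_mul_exp_of_lt (hℓ₀ : ℓ₀ ≠ 0) (hℓ : ℓ₀ < ℓ) (b : ℝ) :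
    Tendsto (fun n : ℕ => √n * Real.exp (-heatEigenvalue n ℓ * cutoffTime ℓ₀ n b)) atTop
      (𝓝 0) := by
  have hgap : 0 < Real.pi ^ 2 * ((ℓ : ℝ) ^ 2 - ℓ₀ ^ 2) := by
    have : (ℓ₀ : ℝ) ^ 2 < ℓ ^ 2 := by gcongr
    exact mul_pos (by positivity) (sub_pos.2 this)
  have hexp := (tendsto_sub_heatEigenvalue_mul_cutoffTime ℓ₀ ℓ b).add_atBot
    (tendsto_neg_atTop_atBot.comp ((tendsto_cutoffTime_atTop hℓ₀ b).const_mul_atTop hgap))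
  have hlim := (Real.tendsto_exp_atBot.comp hexp).const_mul (Real.exp (-b))
  rw [mul_zero] at hlim
  refine hlim.congr' ?_
  filter_upwards [eventually_ne_atTop 0] with n hn
  rw [sqrt_mul_exp_neg_mul_cutoffTime hℓ₀ hn]
  simp only [Function.comp_apply]
  ring_nf

theorem sqrt_mul_exp_le_of_two_mul_le (hℓ₀ : ℓ₀ ≠ 0) (hℓ : 2 * ℓ₀ ≤ ℓ) (hℓn : ℓ < n) {b : ℝ}
    (ht : 1 ≤ cutoffTime ℓ₀ n b) :
    √n * Real.exp (-heatEigenvalue n ℓ * cutoffTime ℓ₀ n b)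
      ≤ Real.exp (-b) * Real.exp (1 - cutoffTime ℓ₀ n b) * (1 / 2) ^ ℓ := by
  have hℓ' : (2 : ℝ) * ℓ₀ ≤ ℓ := by exact_mod_cast hℓ
  have hℓ₁ : (1 : ℝ) ≤ ℓ := by exact_mod_cast (by omega : 1 ≤ ℓ)
  have hpi : Real.pi ^ 2 ≤ 12 := by nlinarith [Real.pi_lt_d2, Real.pi_pos]
  have hgap : Real.pi ^ 2 * ℓ₀ ^ 2 - heatEigenvalue n ℓ ≤ -ℓ := by
    nlinarith [four_mul_sq_le_heatEigenvalue hℓn.le, ℓ₀.cast_nonneg (α := ℝ)]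
  have hexp : (Real.pi ^ 2 * ℓ₀ ^ 2 - heatEigenvalue n ℓ) * cutoffTime ℓ₀ n b
      ≤ (1 - cutoffTime ℓ₀ n b) + ℓ * -1 := by
    nlinarith
  have hhalf : Real.exp (-1) ≤ 1 / 2 := by
    rw [Real.exp_neg, one_div]
    exact inv_anti₀ two_pos (by linarith [Real.add_one_le_exp (1 : ℝ)])
  rw [sqrt_mul_exp_neg_mul_cutoffTime hℓ₀ (by omega), mul_assoc]
  refine mul_le_mul_of_nonneg_left ?_ (Real.exp_pos _).le
  calc _ ≤ Real.exp (1 - cutoffTime ℓ₀ n b) * Real.exp (-1) ^ ℓ := by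
        rw [← Real.exp_nat_mul, ← Real.exp_add]
        exact Real.exp_le_exp.2 hexp
    _ ≤ Real.exp (1 - cutoffTime ℓ₀ n b) * (1 / 2) ^ ℓ :=
        mul_le_mul_of_nonneg_left (pow_le_pow_left₀ (Real.exp_pos _).le hhalf ℓ)
          (Real.exp_pos _).le

end CutoffTime

section ModeAmplitude

/-- The `ℓ`-th sine coefficient of `heatSolution n f t`, scaled by `√n` so that it is of order one
at the cutoff time. -/
noncomputable def modeAmplitude (n : ℕ) (f : ℝ → ℝ) (t : ℝ) (ℓ : ℕ) : ℝ :=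
  √n * (sineCoeff n f ℓ * Real.exp (-heatEigenvalue n ℓ * t))

variable {f : ℝ → ℝ} {K M : ℝ≥0} {ℓ₀ : ℕ}

theorem sum_sq_sum_mul_sin (n : ℕ) {a : ℕ → ℝ} (ha : a 0 = 0) :
    ∑ x ∈ Finset.range n,
        (∑ ℓ ∈ Finset.range n, a ℓ * (√2 * Real.sin (Real.pi * ℓ * x / n))) ^ 2
      = n * ∑ ℓ ∈ Finset.range n, a ℓ ^ 2 := by
  have hsqrt : √2 * √2 = (2 : ℝ) := Real.mul_self_sqrt zero_le_two
  calc _ = ∑ ℓ ∈ Finset.range n, ∑ k ∈ Finset.range n, a ℓ * a k * ∑ x ∈ Finset.range n,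
          2 * Real.sin (Real.pi * x * ℓ / n) * Real.sin (Real.pi * x * k / n) := by
        simp only [sq, Finset.sum_mul_sum]
        rw [Finset.sum_comm]
        refine Finset.sum_congr rfl fun ℓ _ => ?_
        rw [Finset.sum_comm]
        refine Finset.sum_congr rfl fun k _ => ?_
        rw [Finset.mul_sum]
        refine Finset.sum_congr rfl fun x _ => ?_
        rw [mul_right_comm Real.pi (x : ℝ), mul_right_comm Real.pi (x : ℝ)]
        linear_combination a ℓ * a k * Real.sin (Real.pi * ℓ * x / n)
          * Real.sin (Real.pi * k * x / n) * hsqrt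
    _ = ∑ ℓ ∈ Finset.range n, ∑ k ∈ Finset.range n, a ℓ * a k * if ℓ = k then (n : ℝ) else 0 := by
        refine Finset.sum_congr rfl fun ℓ hℓ => Finset.sum_congr rfl fun k hk => ?_
        rcases Nat.eq_zero_or_pos ℓ with rfl | hℓ₀
        · simp [ha]
        rcases Nat.eq_zero_or_pos k with rfl | hk₀
        · simp [ha]
        rw [sum_two_mul_sin_mul_sin hℓ₀ (Finset.mem_range.1 hℓ) hk₀ (Finset.mem_range.1 hk)]
    _ = n * ∑ ℓ ∈ Finset.range n, a ℓ ^ 2 := by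
        rw [Finset.mul_sum]
        refine Finset.sum_congr rfl fun ℓ hℓ => ?_
        simp only [mul_ite, mul_zero, Finset.sum_ite_eq, hℓ, if_true]
        ring

theorem sum_site_eq_sum_range (n : ℕ) {g : ℕ → ℝ} (hg : g 0 = 0) :
    ∑ x : Site n, g x = ∑ x ∈ Finset.range n, g x := by
  rw [Finset.sum_coe_sort (Finset.Ico 1 n) g, Finset.range_eq_Ico]
  refine Finset.sum_subset (Finset.Ico_subset_Ico_left zero_le_one) fun x hx hx' => ?_
  obtain rfl : x = 0 := by simp only [Finset.mem_Ico] at hx hx'; omega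
  exact hg

theorem sum_sq_heatSolution (n : ℕ) (f : ℝ → ℝ) (t : ℝ) :
    ∑ x : Site n, heatSolution n f t (x : ℕ) ^ 2
      = ∑ ℓ ∈ Finset.range n, modeAmplitude n f t ℓ ^ 2 := by
  rw [sum_site_eq_sum_range n (g := fun x => heatSolution n f t x ^ 2)
    (by simp [heatSolution_zero_right])]
  simp only [modeAmplitude, mul_pow √(n : ℝ), Real.sq_sqrt n.cast_nonneg, ← Finset.mul_sum]
  exact sum_sq_sum_mul_sin n (by simp [sineCoeff])

theorem abs_heatSolution_le (n : ℕ) (f : ℝ → ℝ) (t x : ℝ) :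
    |heatSolution n f t x| ≤ √2 * ((∑ ℓ ∈ Finset.range n, |modeAmplitude n f t ℓ|) / √n) := by
  rw [heatSolution, Finset.sum_div, Finset.mul_sum]
  refine (Finset.abs_sum_le_sum_abs _ _).trans (Finset.sum_le_sum fun ℓ hℓ => ?_)
  have hn : √(n : ℝ) ≠ 0 :=
    Real.sqrt_ne_zero'.2 (by exact_mod_cast ℓ.zero_le.trans_lt (Finset.mem_range.1 hℓ))
  rw [modeAmplitude, abs_mul √(n : ℝ), abs_of_nonneg (Real.sqrt_nonneg _),
    mul_div_cancel_left₀ _ hn, abs_mul _ (√2 * _), abs_mul √2, abs_of_nonneg (Real.sqrt_nonneg 2),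
    mul_left_comm]
  gcongr
  exact mul_le_of_le_one_right (abs_nonneg _) (Real.abs_sin_le_one _)

theorem abs_modeAmplitude_le (hM : ∀ x ∈ Icc (0 : ℝ) 1, |f x| ≤ M) (n : ℕ) (t : ℝ) (ℓ : ℕ) :
    |modeAmplitude n f t ℓ| ≤ √2 * M * (√n * Real.exp (-heatEigenvalue n ℓ * t)) := by
  rw [modeAmplitude, abs_mul, abs_mul, Real.abs_exp, abs_of_nonneg (Real.sqrt_nonneg _),
    mul_left_comm]
  gcongr
  exact abs_sineCoeff_le hM n ℓ

/-- Here the Riemann sum of a vanishing integral is `O(1 / n)`, which beats the scaling by `√n`. -/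
theorem tendsto_modeAmplitude_of_fourierCoeff_eq_zero (hK : LipschitzOnWith K f (Icc 0 1))
    (hM : ∀ x ∈ Icc (0 : ℝ) 1, |f x| ≤ M) {ℓ : ℕ} (hℓ : fourierCoeff 0 f ℓ = 0) {t : ℕ → ℝ}
    (ht : ∀ᶠ n in atTop, 0 ≤ t n) :
    Tendsto (fun n => modeAmplitude n f (t n) ℓ) atTop (𝓝 0) := by
  obtain ⟨C, hC⟩ := exists_abs_sineCoeff_sub_le hK hM ℓ
  have hbound : Tendsto (fun n : ℕ => C / √(n : ℝ)) atTop (𝓝 0) :=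
    (Real.tendsto_sqrt_atTop.comp tendsto_natCast_atTop_atTop).const_div_atTop C
  refine squeeze_zero_norm' ?_ hbound
  filter_upwards [eventually_ne_atTop 0, ht] with n hn htn
  have hcoeff : |sineCoeff n f ℓ| ≤ C / n := by simpa [hℓ] using hC n hn
  have hexp : Real.exp (-heatEigenvalue n ℓ * t n) ≤ 1 := by
    rw [Real.exp_le_one_iff, neg_mul, neg_nonpos]
    exact mul_nonneg (heatEigenvalue_nonneg n ℓ) htn
  rw [modeAmplitude, Real.norm_eq_abs, abs_mul, abs_mul, Real.abs_exp,
    abs_of_nonneg (Real.sqrt_nonneg _)]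
  calc _ ≤ √n * (C / n * 1) := mul_le_mul_of_nonneg_left
        (mul_le_mul hcoeff hexp (Real.exp_pos _).le ((abs_nonneg _).trans hcoeff))
        (Real.sqrt_nonneg _)
    _ = C * (√n / n) := by ring
    _ = C / √n := by rw [Real.sqrt_div_self', mul_one_div]

theorem tendsto_modeAmplitude_cutoffTime (hK : LipschitzOnWith K f (Icc 0 1))
    (hM : ∀ x ∈ Icc (0 : ℝ) 1, |f x| ≤ M) (hℓ₀ : ℓ₀ ≠ 0)
    (hc : ∀ ℓ < ℓ₀, fourierCoeff 0 f ℓ = 0) (b : ℝ) (ℓ : ℕ) :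
    Tendsto (fun n => modeAmplitude n f (cutoffTime ℓ₀ n b) ℓ) atTop
      (𝓝 (if ℓ = ℓ₀ then fourierCoeff 0 f ℓ₀ * Real.exp (-b) else 0)) := by
  rcases lt_trichotomy ℓ ℓ₀ with hlow | rfl | hhigh
  · rw [if_neg hlow.ne]
    exact tendsto_modeAmplitude_of_fourierCoeff_eq_zero hK hM (hc ℓ hlow)
      ((tendsto_cutoffTime_atTop hℓ₀ b).eventually_ge_atTop 0)
  · rw [if_pos rfl]
    exact ((tendsto_sineCoeff hK hM ℓ).mul (tendsto_sqrt_mul_exp_self hℓ₀ b)).congr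
      fun n => mul_left_comm _ _ _
  · rw [if_neg hhigh.ne']
    refine squeeze_zero_norm (fun n => abs_modeAmplitude_le hM n _ ℓ) ?_
    simpa using (tendsto_sqrt_mul_exp_of_lt hℓ₀ hhigh b).const_mul (√2 * M)

theorem tendsto_sum_Ico_abs_modeAmplitude (hM : ∀ x ∈ Icc (0 : ℝ) 1, |f x| ≤ M) (hℓ₀ : ℓ₀ ≠ 0)
    (b : ℝ) :
    Tendsto (fun n => ∑ ℓ ∈ Finset.Ico (2 * ℓ₀) n, |modeAmplitude n f (cutoffTime ℓ₀ n b) ℓ|)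
      atTop (𝓝 0) := by
  have htime := tendsto_cutoffTime_atTop hℓ₀ b
  have hexp : Tendsto (fun n => Real.exp (1 - cutoffTime ℓ₀ n b)) atTop (𝓝 0) :=
    Real.tendsto_exp_atBot.comp (tendsto_atBot_add_const_left _ 1 (tendsto_neg_atTop_atBot.comp
      htime))
  have hbound := hexp.const_mul (√2 * M * Real.exp (-b) * 2)
  rw [mul_zero] at hbound
  refine squeeze_zero' (.of_forall fun n => Finset.sum_nonneg fun _ _ => abs_nonneg _) ?_ hbound
  filter_upwards [htime.eventually_ge_atTop 1] with n ht
  calc _ ≤ ∑ ℓ ∈ Finset.Ico (2 * ℓ₀) n,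
          √2 * M * Real.exp (-b) * Real.exp (1 - cutoffTime ℓ₀ n b) * (1 / 2 : ℝ) ^ ℓ := by
        refine Finset.sum_le_sum fun ℓ hℓ => (abs_modeAmplitude_le hM n _ ℓ).trans ?_
        rw [Finset.mem_Ico] at hℓ
        rw [mul_assoc (√2 * (M : ℝ)), mul_assoc (√2 * (M : ℝ))]
        exact mul_le_mul_of_nonneg_left (sqrt_mul_exp_le_of_two_mul_le hℓ₀ hℓ.1 hℓ.2 ht)
          (by positivity)
    _ ≤ √2 * M * Real.exp (-b) * Real.exp (1 - cutoffTime ℓ₀ n b) * 2 := by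
        rw [← Finset.mul_sum]
        refine mul_le_mul_of_nonneg_left ?_ (by positivity)
        refine (Finset.sum_le_sum_of_subset_of_nonneg (fun ℓ hℓ => ?_)
          fun _ _ _ => by positivity).trans (sum_geometric_two_le n)
        exact Finset.mem_range.2 (Finset.mem_Ico.1 hℓ).2
    _ = √2 * M * Real.exp (-b) * 2 * Real.exp (1 - cutoffTime ℓ₀ n b) := by ring

theorem tendsto_sum_range_of_tendsto_ite {a : ℕ → ℕ → ℝ} {c : ℝ} {m : ℕ} (hm : ℓ₀ < m)
    (ha : ∀ ℓ, Tendsto (fun n => a n ℓ) atTop (𝓝 (if ℓ = ℓ₀ then c else 0)))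
    (htail : Tendsto (fun n => ∑ ℓ ∈ Finset.Ico m n, a n ℓ) atTop (𝓝 0)) :
    Tendsto (fun n => ∑ ℓ ∈ Finset.range n, a n ℓ) atTop (𝓝 c) := by
  have hlow := tendsto_finsetSum (Finset.range m) fun ℓ _ => ha ℓ
  rw [Finset.sum_ite_eq', if_pos (Finset.mem_range.2 hm)] at hlow
  rw [← add_zero c]
  refine (hlow.add htail).congr' ?_
  filter_upwards [eventually_ge_atTop m] with n hn
  exact Finset.sum_range_add_sum_Ico _ hn

theorem exists_tendsto_abs_heatSolution_le (hK : LipschitzOnWith K f (Icc 0 1))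
    (hM : ∀ x ∈ Icc (0 : ℝ) 1, |f x| ≤ M) (hℓ₀ : ℓ₀ ≠ 0)
    (hc : ∀ ℓ < ℓ₀, fourierCoeff 0 f ℓ = 0) (b : ℝ) :
    ∃ δ : ℕ → ℝ, Tendsto δ atTop (𝓝 0) ∧
      ∀ n x, |heatSolution n f (cutoffTime ℓ₀ n b) x| ≤ δ n := by
  refine ⟨_, ?_, fun n x => abs_heatSolution_le n f _ x⟩
  have hsum := tendsto_sum_range_of_tendsto_ite (c := |fourierCoeff 0 f ℓ₀ * Real.exp (-b)|)
    (by omega : ℓ₀ < 2 * ℓ₀) (fun ℓ => ?_) (tendsto_sum_Ico_abs_modeAmplitude hM hℓ₀ b)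
  · simpa using (hsum.div_atTop
      (Real.tendsto_sqrt_atTop.comp tendsto_natCast_atTop_atTop)).const_mul √2
  · simpa [apply_ite abs] using (tendsto_modeAmplitude_cutoffTime hK hM hℓ₀ hc b ℓ).abs

theorem tendsto_sum_sq_heatSolution (hK : LipschitzOnWith K f (Icc 0 1))
    (hM : ∀ x ∈ Icc (0 : ℝ) 1, |f x| ≤ M) (hℓ₀ : ℓ₀ ≠ 0)
    (hc : ∀ ℓ < ℓ₀, fourierCoeff 0 f ℓ = 0) (b : ℝ) :
    Tendsto (fun n => ∑ x : Site n, heatSolution n f (cutoffTime ℓ₀ n b) (x : ℕ) ^ 2) atTop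
      (𝓝 ((fourierCoeff 0 f ℓ₀ * Real.exp (-b)) ^ 2)) := by
  simp only [sum_sq_heatSolution]
  refine tendsto_sum_range_of_tendsto_ite (by omega : ℓ₀ < 2 * ℓ₀) (fun ℓ => ?_) ?_
  · simpa [ite_pow] using (tendsto_modeAmplitude_cutoffTime hK hM hℓ₀ hc b ℓ).pow 2
  · refine squeeze_zero (fun n => Finset.sum_nonneg fun _ _ => sq_nonneg _) (fun n => ?_)
      (by simpa using (tendsto_sum_Ico_abs_modeAmplitude hM hℓ₀ b).pow 2)
    simpa only [sq_abs] using Finset.sum_sq_le_sq_sum_of_nonneg fun ℓ _ =>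
      abs_nonneg (modeAmplitude n f (cutoffTime ℓ₀ n b) ℓ)

end ModeAmplitude

/-! ### Propagation of the product structure and the cutoff profile -/

section Comparison

variable {n : ℕ} {ρ : ℝ} {u₀ : ℝ → ℝ} {K : ℝ≥0}

theorem lipschitzOnWith_sub_const {s : Set ℝ} (hK : LipschitzOnWith K u₀ s) (c : ℝ) :
    LipschitzOnWith K (fun y => u₀ y - c) s :=
  fun _ hx _ hy => (edist_sub_right _ _ _).trans_le (hK hx hy)

theorem sq_mul_profile_sub_sq_le (h₀ : u₀ 0 = ρ) (h₁ : u₀ 1 = ρ)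
    (hK : LipschitzOnWith K u₀ (Icc 0 1)) {M : ℝ} (hM : ∀ x ∈ Icc (0 : ℝ) 1, |u₀ x - ρ| ≤ M)
    {t : ℝ} (ht : 0 ≤ t) {e : Site n × Site n} (he : e ∈ edges n) :
    (n : ℝ) ^ 2 * (profile n ρ u₀ t e.2 - profile n ρ u₀ t e.1) ^ 2
      ≤ (3 * K ^ 2 + 16 * Real.pi ^ 2 * M ^ 2) * Real.exp (-t) := by
  rw [profile_snd_sub_profile_fst he]
  exact sq_mul_heatGradient_sq_le (by simp [h₀]) (by simp [h₁]) (lipschitzOnWith_sub_const hK ρ) hM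
    ht (Finset.mem_Ico.1 e.1.2).2

theorem abs_distEq_sub_tvDist_profile_le (hn : 3 ≤ n) (h₀ : u₀ 0 = ρ) (h₁ : u₀ 1 = ρ) {G A t : ℝ}
    (hG : 0 < G) (hA : 0 ≤ A) (ht : 0 ≤ t)
    (hgrad : ∀ s, 0 ≤ s → ∀ e ∈ edges n,
      (n : ℝ) ^ 2 * (profile n ρ u₀ s e.2 - profile n ρ u₀ s e.1) ^ 2 ≤ G * Real.exp (-s))
    (hu : ∀ x, profile n ρ u₀ t x ∈ Ioo 0 1)
    (hχ : ∀ x, (profile n ρ u₀ t x * (1 - profile n ρ u₀ t x))⁻¹ ≤ A)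
    (hAt : A ≤ correlationWeight G t) :
    |distEq n ρ u₀ t - tvDist (ofWeight (bernoulliWeight (profile n ρ u₀ t)))
        (ofWeight (bernoulliWeight fun _ => ρ))| ≤ √(384 * G * A * Real.exp (-(t / 8))) := by
  let κ (s : ℝ) : Finset (Site n) → ℝ := correlation n ρ (discretize n u₀) (profile n ρ u₀ s) s
  have hκ (s : ℝ) (S : Finset (Site n)) : HasDerivAt (fun r => κ r S)
      (correlationDrift n (fun e => profile n ρ u₀ s e.2 - profile n ρ u₀ s e.1) (κ s) S) s :=
    hasDerivAt_correlation ρ _ (hasDerivAt_profile hn ρ u₀ s) S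
  have hκ₀ (S : Finset (Site n)) : κ 0 S = if S = ∅ then 1 else 0 := by
    simp only [κ, profile_zero h₀ h₁, correlation_zero]
  calc |distEq n ρ u₀ t - tvDist (ofWeight (bernoulliWeight (profile n ρ u₀ t)))
        (ofWeight (bernoulliWeight fun _ => ρ))|
      ≤ tvDist (ofWeight (lawWeight n ρ (discretize n u₀) t))
          (ofWeight (bernoulliWeight (profile n ρ u₀ t))) := abs_tvDist_sub_tvDist_le _ _ _
    _ ≤ √(∑ S ∈ Finset.univ.erase ∅, A ^ #S * κ t S ^ 2) :=
        tvDist_bernoulli_le_sqrt hu hχ (apply_empty_eq_one hκ hκ₀ t)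
    _ ≤ √(384 * G * A * Real.exp (-(t / 8))) := Real.sqrt_le_sqrt <|
        sum_erase_empty_pow_mul_sq_le_exp (by lia) hG hA hgrad hκ hκ₀ ht hAt

end Comparison

section CutoffTime

variable {ρ : ℝ} {u₀ : ℝ → ℝ} {K M : ℝ≥0} {ℓ₀ : ℕ}

theorem half_mul_one_sub_le_of_abs_sub_le (hρ : ρ ∈ Ioo 0 1) {p : ℝ}
    (hp : |p - ρ| ≤ ρ * (1 - ρ) / 4) : p ∈ Ioo 0 1 ∧ ρ * (1 - ρ) / 2 ≤ p * (1 - p) := by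
  obtain ⟨hρ₀, hρ₁⟩ := hρ
  obtain ⟨hlower, hupper⟩ := abs_le.1 hp
  have hvar : ρ * (1 - ρ) ≤ 1 := by nlinarith
  refine ⟨⟨by nlinarith, by nlinarith⟩, ?_⟩
  rcases le_total ρ p with hle | hle
  · nlinarith [mul_nonneg (sub_nonneg.2 hle) (by linarith : 0 ≤ 3 - ρ - p)]
  · nlinarith [mul_nonneg (sub_nonneg.2 hle) (by linarith : 0 ≤ 1 + ρ + p)]

theorem inv_mul_one_sub_le_of_abs_sub_le (hρ : ρ ∈ Ioo 0 1) {p : ℝ}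
    (hp : |p - ρ| ≤ ρ * (1 - ρ) / 4) : (p * (1 - p))⁻¹ ≤ 2 / (ρ * (1 - ρ)) := by
  have hχ : 0 < ρ * (1 - ρ) := mul_pos hρ.1 (sub_pos.2 hρ.2)
  rw [← inv_div]
  exact inv_anti₀ (half_pos hχ) (half_mul_one_sub_le_of_abs_sub_le hρ hp).2

theorem tendsto_correlationWeight_cutoffTime {G : ℝ} (hG : 0 < G) (hℓ₀ : ℓ₀ ≠ 0) (b : ℝ) :
    Tendsto (fun n => correlationWeight G (cutoffTime ℓ₀ n b)) atTop atTop :=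
  (Real.tendsto_exp_atTop.comp ((tendsto_cutoffTime_atTop hℓ₀ b).atTop_div_const
    (by norm_num))).atTop_div_const (by positivity)

theorem tendsto_sqrt_mul_exp_neg_cutoffTime (C : ℝ) (hℓ₀ : ℓ₀ ≠ 0) (b : ℝ) :
    Tendsto (fun n => √(C * Real.exp (-(cutoffTime ℓ₀ n b / 8)))) atTop (𝓝 0) := by
  have htime := (tendsto_cutoffTime_atTop hℓ₀ b).atTop_div_const (by norm_num : (0 : ℝ) < 8)
  simpa using ((Real.tendsto_exp_neg_atTop_nhds_zero.comp htime).const_mul C).sqrt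

theorem fourierCoeff_zero_sub_const (ρ : ℝ) (u₀ : ℝ → ℝ) (ℓ : ℕ) :
    fourierCoeff 0 (fun y => u₀ y - ρ) ℓ = fourierCoeff ρ u₀ ℓ := by
  simp only [fourierCoeff, sub_zero]

theorem exists_tendsto_abs_profile_sub_le (hK : LipschitzOnWith K u₀ (Icc 0 1))
    (hM : ∀ x ∈ Icc (0 : ℝ) 1, |u₀ x - ρ| ≤ M) (hℓ₀ : ℓ₀ ≠ 0)
    (hc : ∀ ℓ < ℓ₀, fourierCoeff ρ u₀ ℓ = 0) (b : ℝ) :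
    ∃ δ : ℕ → ℝ, Tendsto δ atTop (𝓝 0) ∧
      ∀ n x, |profile n ρ u₀ (cutoffTime ℓ₀ n b) x - ρ| ≤ δ n := by
  obtain ⟨δ, hδ, hbound⟩ := exists_tendsto_abs_heatSolution_le (lipschitzOnWith_sub_const hK ρ) hM
    hℓ₀ (fun ℓ hℓ => (fourierCoeff_zero_sub_const ρ u₀ ℓ).trans (hc ℓ hℓ)) b
  refine ⟨δ, hδ, fun n x => ?_⟩
  rw [profile, add_sub_cancel_left]
  exact hbound n (x : ℕ)

theorem tendsto_distEq_sub_tvDist_profile (hρ : ρ ∈ Ioo 0 1)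
    (hK : LipschitzOnWith K u₀ (Icc 0 1)) (h₀ : u₀ 0 = ρ) (h₁ : u₀ 1 = ρ)
    (hM : ∀ x ∈ Icc (0 : ℝ) 1, |u₀ x - ρ| ≤ M) (hℓ₀ : ℓ₀ ≠ 0)
    (hc : ∀ ℓ < ℓ₀, fourierCoeff ρ u₀ ℓ = 0) (b : ℝ) :
    Tendsto (fun n => distEq n ρ u₀ (cutoffTime ℓ₀ n b)
      - tvDist (ofWeight (bernoulliWeight (profile n ρ u₀ (cutoffTime ℓ₀ n b))))
        (ofWeight (bernoulliWeight fun _ => ρ))) atTop (𝓝 0) := by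
  have hχ : 0 < ρ * (1 - ρ) := mul_pos hρ.1 (sub_pos.2 hρ.2)
  obtain ⟨δ, hδ, hprofile⟩ := exists_tendsto_abs_profile_sub_le hK hM hℓ₀ hc b
  set G : ℝ := 1 + (3 * K ^ 2 + 16 * Real.pi ^ 2 * M ^ 2) with hG_def
  have hG : 0 < G := by positivity
  set A : ℝ := 2 / (ρ * (1 - ρ))
  refine squeeze_zero_norm' ?_ (tendsto_sqrt_mul_exp_neg_cutoffTime (384 * G * A) hℓ₀ b)
  filter_upwards [hδ.eventually_le_const (by positivity : 0 < ρ * (1 - ρ) / 4),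
    (tendsto_correlationWeight_cutoffTime hG hℓ₀ b).eventually_ge_atTop A,
    (tendsto_cutoffTime_atTop hℓ₀ b).eventually_ge_atTop 0, eventually_ge_atTop 3]
    with n hsmall hweight htime hn
  have hclose (x : Site n) := (hprofile n x).trans hsmall
  refine abs_distEq_sub_tvDist_profile_le hn h₀ h₁ hG (by positivity) htime
    (fun s hs e he => ?_) (fun x => (half_mul_one_sub_le_of_abs_sub_le hρ (hclose x)).1)
    (fun x => inv_mul_one_sub_le_of_abs_sub_le hρ (hclose x)) hweight
  refine (sq_mul_profile_sub_sq_le h₀ h₁ hK hM hs he).trans ?_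
  gcongr
  simp [hG_def]

theorem tendsto_tvDist_profile (hρ : ρ ∈ Ioo 0 1) (hK : LipschitzOnWith K u₀ (Icc 0 1))
    (hM : ∀ x ∈ Icc (0 : ℝ) 1, |u₀ x - ρ| ≤ M) (hℓ₀ : ℓ₀ ≠ 0)
    (hc : ∀ ℓ < ℓ₀, fourierCoeff ρ u₀ ℓ = 0) (b : ℝ) :
    Tendsto (fun n => tvDist
        (ofWeight (bernoulliWeight (profile n ρ u₀ (cutoffTime ℓ₀ n b))))
        (ofWeight (bernoulliWeight fun _ => ρ))) atTop
      (𝓝 (gaussianProfile (|fourierCoeff ρ u₀ ℓ₀| / √(ρ * (1 - ρ)) * Real.exp (-b)))) := by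
  have hχ : 0 < ρ * (1 - ρ) := mul_pos hρ.1 (sub_pos.2 hρ.2)
  have hm : (fourierCoeff ρ u₀ ℓ₀ * Real.exp (-b)) ^ 2
      = (|fourierCoeff ρ u₀ ℓ₀| / √(ρ * (1 - ρ)) * Real.exp (-b)) ^ 2 * (ρ * (1 - ρ)) := by
    rw [mul_pow, mul_pow, div_pow, sq_abs, Real.sq_sqrt hχ.le, mul_right_comm,
      div_mul_cancel₀ _ hχ.ne']
  have hsum := tendsto_sum_sq_heatSolution (lipschitzOnWith_sub_const hK ρ) hM hℓ₀
    (fun ℓ hℓ => (fourierCoeff_zero_sub_const ρ u₀ ℓ).trans (hc ℓ hℓ)) b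
  rw [fourierCoeff_zero_sub_const, hm] at hsum
  obtain ⟨δ, hδ, hprofile⟩ := exists_tendsto_abs_profile_sub_le hK hM hℓ₀ hc b
  refine tendsto_tvDist_bernoulli hρ hδ (.of_forall fun n x => ?_) hsum
  simpa only [profile, add_sub_cancel_left] using hprofile n x

theorem exists_lipschitzOnWith_Icc {a b : ℝ} (hdiff : DifferentiableOn ℝ u₀ (Icc a b))
    (hbdd : ∃ κ : ℝ, ∀ x ∈ Icc a b, |derivWithin u₀ (Icc a b) x| ≤ κ) :
    ∃ K, LipschitzOnWith K u₀ (Icc a b) := by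
  obtain ⟨κ, hκ⟩ := hbdd
  exact ⟨κ.toNNReal, (convex_Icc a b).lipschitzOnWith_of_nnnorm_derivWithin_le hdiff fun x hx =>
    NNReal.le_toNNReal_of_coe_le (hκ x hx)⟩

theorem fourierCoeff_eq_zero_of_isLeast
    (hℓ₀ : IsLeast {ℓ : ℕ | 1 ≤ ℓ ∧ fourierCoeff ρ u₀ ℓ ≠ 0} ℓ₀) {ℓ : ℕ} (hℓ : ℓ < ℓ₀) :
    fourierCoeff ρ u₀ ℓ = 0 := by
  rcases Nat.eq_zero_or_pos ℓ with rfl | hpos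
  · simp [fourierCoeff]
  · exact not_not.1 fun hne => (hℓ₀.2 ⟨hpos, hne⟩).not_gt hℓ

end CutoffTime

end SSEP

open SSEP in
theorem theorem1_general (ρ : ℝ) (hρ : ρ ∈ Ioo (0 : ℝ) 1) (u₀ : ℝ → ℝ) (K : ℝ≥0)
    (hK : LipschitzOnWith K u₀ (Icc 0 1)) (h0 : u₀ 0 = ρ) (h1 : u₀ 1 = ρ)
    (hu : ∀ x ∈ Icc (0 : ℝ) 1, u₀ x ∈ Icc (0 : ℝ) 1) (ℓ₀ : ℕ) (hℓ₀ : ℓ₀ ≠ 0)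
    (hc : ∀ ℓ < ℓ₀, SSEP.fourierCoeff ρ u₀ ℓ = 0) (b : ℝ) :
    Tendsto (fun n : ℕ => SSEP.distEq n ρ u₀ (SSEP.cutoffTime ℓ₀ n b)) atTop
      (𝓝 (SSEP.gaussianProfile
        (|SSEP.fourierCoeff ρ u₀ ℓ₀| / √(ρ * (1 - ρ)) * Real.exp (-b)))) := by
  have hM (x : ℝ) (hx : x ∈ Icc (0 : ℝ) 1) : |u₀ x - ρ| ≤ (1 : ℝ≥0) :=
    (abs_sub_le_of_le_of_le (hu x hx).1 (hu x hx).2 hρ.1.le hρ.2.le).trans_eq (sub_zero 1)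
  have hcomparison := tendsto_distEq_sub_tvDist_profile hρ hK h0 h1 hM hℓ₀ hc b
  have hproduct := tendsto_tvDist_profile hρ hK hM hℓ₀ hc b
  simpa only [sub_add_cancel, zero_add] using hcomparison.add hproduct

open SSEP in
theorem theorem1 (ρ : ℝ) (hρ : ρ ∈ Ioo (0 : ℝ) 1) (u₀ : ℝ → ℝ)
    (hdiff : DifferentiableOn ℝ u₀ (Icc 0 1))
    (hbdd : ∃ κ : ℝ, ∀ x ∈ Icc (0 : ℝ) 1, |derivWithin u₀ (Icc 0 1) x| ≤ κ)
    (h0 : u₀ 0 = ρ) (h1 : u₀ 1 = ρ)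
    (hu : ∀ x ∈ Icc (0 : ℝ) 1, u₀ x ∈ Ioo (0 : ℝ) 1)
    (ℓ₀ : ℕ) (hℓ₀ : IsLeast {ℓ : ℕ | 1 ≤ ℓ ∧ SSEP.fourierCoeff ρ u₀ ℓ ≠ 0} ℓ₀) (b : ℝ) :
    Tendsto (fun n : ℕ => SSEP.distEq n ρ u₀ (SSEP.cutoffTime ℓ₀ n b)) atTop
      (𝓝 (SSEP.gaussianProfile
        (|SSEP.fourierCoeff ρ u₀ ℓ₀| / √(ρ * (1 - ρ)) * Real.exp (-b)))) := by
  obtain ⟨K, hK⟩ := exists_lipschitzOnWith_Icc hdiff hbdd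
  exact theorem1_general ρ hρ u₀ K hK h0 h1 (fun x hx => Ioo_subset_Icc_self (hu x hx)) ℓ₀
    (Nat.one_le_iff_ne_zero.1 hℓ₀.1.1) (fun ℓ hℓ => fourierCoeff_eq_zero_of_isLeast hℓ₀ hℓ) b
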